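/- Let $\Bbbk$ be a commutative ring. A prop (over chain complexes) consists of chain complexes $\mathcal P(m,n)$, $m,n\ge 0$ ($m$ inputs, $n$ outputs), with actions of the symmetric groups on inputs and outputs, identities, and associative, unital, equivariant vertical compositions $\mathcal P(n,p)\otimes\mathcal P(m,n)\to\mathcal P(m,p)$ and horizontal compositions $\mathcal P(m,n)\otimes\mathcal P(m',n')\to\mathcal P(m+m',n+n')$ that satisfy the interchange and symmetry laws with Koszul signs. A Hopf prop is a prop over the symmetric monoidal category of (coassociative, counital) differential graded coalgebras: every $\mathcal P(m,n)$ is a coalgebra and all structure maps are morphisms of coalgebras. Let $\mathcal M$ be the prop over $\Bbbk$ generated by a counit $\epsilon\in\mathcal M(1,0)$ and a coproduct $\Delta\in\mathcal M(1,2)$ of degree $0$ and a product $*\in\mathcal M(2,1)$ of degree $1$, with $\partial\epsilon=0$, $\partial\Delta=0$ and $\partial * = \epsilon\otimes\mathrm{id}-\mathrm{id}\otimes\epsilon$, modulo the prop ideal generated by the relations $(\epsilon\otimes\mathrm{id})\circ\Delta=\mathrm{id}=(\mathrm{id}\otimes\epsilon)\circ\Delta$, $(\Delta\otimes\mathrm{id})\circ\Delta=(\mathrm{id}\otimes\Delta)\circ\Delta$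 and $\epsilon\circ *=0$. It is linearly spanned by the classes of $(m,n)$-graphs: finite directed graphs without directed loops, with $m$ incoming and $n$ outgoing labelled external half-edges, whose vertices are decorated by generators and have labelled incoming and outgoing half-edges. Such a graph represents an element of $\mathcal M(m,n)$ once its vertices are totally ordered, and a change of order multiplies this element by the sign of the permutation of the product vertices. Its degree is the number $d$ of its product vertices. Let $\mathrm N(\square^d)=\mathrm N(\square^1)^{\otimes d}$ be the chains of the $d$-cube, where $\mathrm N(\square^1)$ has basis $[0],[1],[0,1]$ and $\partial[0,1]=[1]-[0]$, with the Serre coproduct, i.e. the tensor product coalgebra structure (with Koszul signs) determined by $[0]\mapsto[0]\otimes[0]$, $[1]\mapsto[1]\otimes[1]$, $[0,1]\mapsto[0]\otimes[0,1]+[0,1]\otimes[1]$. For an $(m,n)$-graph $\Gamma$ of degree $d$ with totally ordered vertices, the characteristic map $\iota_\Gamma\colon\mathrm N(\square^d)\to\mathcal M(m,n)$ sends $x_1\otimes\dots\otimes x_d$ to the graph obtained from $\Gamma$ by keeping the $i$-th product vertex if $x_i=[0,1]$, and replacing it by $\mathrm{id}\otimes\epsilon$ if $x_i=[0]$ and by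 $\epsilon\otimes\mathrm{id}$ if $x_i=[1]$. Theorem. Each $\iota_\Gamma$ is a chain map with $\iota_\Gamma([0,1]^{\otimes d})=\Gamma$. The assignments $$\Delta_{\mathcal M}(\Gamma)=\iota_\Gamma^{\otimes 2}\circ\Delta\big([0,1]^{\otimes d}\big),\qquad \varepsilon_{\mathcal M}(\Gamma)=\begin{cases}1&\text{if } d=0,\\ 0&\text{if } d>0,\end{cases}$$ are independent of the chosen order of the vertices (a change of order multiplies both $\Gamma$ and the values by the same sign), and they determine unique well-defined linear maps $\Delta_{\mathcal M}\colon\mathcal M(m,n)\to\mathcal M(m,n)\otimes\mathcal M(m,n)$ and $\varepsilon_{\mathcal M}\colon\mathcal M(m,n)\to\Bbbk$ for all $m,n\ge 0$. These maps make $\mathcal M$ into a Hopf prop. -/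

import Mathlib

open scoped TensorProduct DirectSum

noncomputable section

namespace HopfProp

universe u v

/-! ### Graded modules: Koszul signs -/

section Koszul

variable {k : Type u} [CommRing k]
variable {A : Type v} [AddCommGroup A] [Module k A] (gA : ℤ → Submodule k A)
  [DirectSum.Decomposition gA]
variable {B : Type v} [AddCommGroup B] [Module k B] (gB : ℤ → Submodule k B)
  [DirectSum.Decomposition gB]

/-- The braiding of graded modules, `a ⊗ b ↦ (-1)^(|a||b|) b ⊗ a`. -/
def koszulSwap : A ⊗[k] B →ₗ[k] B ⊗[k] A :=
  (TensorProduct.congr (DirectSum.decomposeLinearEquiv gB).symm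
      (DirectSum.decomposeLinearEquiv gA).symm).toLinearMap ∘ₗ
    (TensorProduct.gradedComm k (fun i => gA i) (fun i => gB i)).toLinearMap ∘ₗ
    (TensorProduct.congr (DirectSum.decomposeLinearEquiv gA)
      (DirectSum.decomposeLinearEquiv gB)).toLinearMap

/-- The sign involution `a ↦ (-1)^|a| a`. -/
def koszulSign : A →ₗ[k] A :=
  DirectSum.toModule k ℤ A (fun i => ((i.negOnePow : ℤˣ) : ℤ) • (gA i).subtype) ∘ₗ
    (DirectSum.decomposeLinearEquiv gA).toLinearMap

/-- The differential of a tensor product of complexes,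
`∂ (a ⊗ b) = ∂ a ⊗ b + (-1)^|a| a ⊗ ∂ b`. -/
def tensorD (dA : A →ₗ[k] A) (dB : B →ₗ[k] B) : A ⊗[k] B →ₗ[k] A ⊗[k] B :=
  TensorProduct.map dA LinearMap.id + TensorProduct.map (koszulSign gA) dB


/-- The degree `i` part of a tensor product of graded modules. -/
def tensorDeg (gA : ℤ → Submodule k A) (gB : ℤ → Submodule k B) (i : ℤ) :
    Submodule k (A ⊗[k] B) :=
  ⨆ p : ℤ, Submodule.map₂ (TensorProduct.mk k A B) (gA p) (gB (i - p))

/-- The coproduct of a tensor product of coalgebras,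
`A ⊗ B → (A ⊗ A) ⊗ (B ⊗ B) → (A ⊗ B) ⊗ (A ⊗ B)`, where the second map is the braiding
(with its Koszul sign) of the two middle factors. -/
def tensorComul (cA : A →ₗ[k] A ⊗[k] A) (cB : B →ₗ[k] B ⊗[k] B) :
    A ⊗[k] B →ₗ[k] (A ⊗[k] B) ⊗[k] (A ⊗[k] B) :=
  (TensorProduct.assoc k A B (A ⊗[k] B)).symm.toLinearMap ∘ₗ
    LinearMap.lTensor A
      ((TensorProduct.assoc k B A B).toLinearMap ∘ₗ
        LinearMap.rTensor B (koszulSwap gA gB) ∘ₗ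
        (TensorProduct.assoc k A B B).symm.toLinearMap) ∘ₗ
    (TensorProduct.assoc k A A (B ⊗[k] B)).toLinearMap ∘ₗ
    TensorProduct.map cA cB

end Koszul

/-! ### Props over chain complexes and over coalgebras -/

/-- The data of a prop in complexes of `k`-modules: `hom m n` is the part with `m` inputs and `n`
outputs, given as the total module of a complex (`deg` is its grading, `d` its differential).
`relabel` is the structure of an `𝕊`-bimodule: the category `𝕊` has the natural numbers as objects
and the bijections `Fin m ≃ Fin m'` as morphisms (there are none unless `m = m'`).
`vcomp x y` is the vertical composite `x ∘ y` and `hcomp x y` is the horizontal composite `x ⊗ y`.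
The laws are in `PropData.IsProp`. -/
structure PropData (k : Type u) [CommRing k] where
  hom : ℕ → ℕ → Type v
  [acg : ∀ m n, AddCommGroup (hom m n)]
  [mod : ∀ m n, Module k (hom m n)]
  deg : ∀ m n, ℤ → Submodule k (hom m n)
  [dec : ∀ m n, DirectSum.Decomposition (deg m n)]
  d : ∀ m n, hom m n →ₗ[k] hom m n
  relabel : ∀ {m m' n n' : ℕ}, (Fin m ≃ Fin m') → (Fin n ≃ Fin n') → hom m n →ₗ[k] hom m' n'
  one : ∀ n, hom n n
  vcomp : ∀ m n p, hom n p →ₗ[k] hom m n →ₗ[k] hom m p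
  hcomp : ∀ m n m' n', hom m n →ₗ[k] hom m' n' →ₗ[k] hom (m + m') (n + n')

attribute [instance] PropData.acg PropData.mod PropData.dec

/-- The block sum of two bijections. -/
def blockSum {m m' n n' : ℕ} (e : Fin m ≃ Fin m') (f : Fin n ≃ Fin n') :
    Fin (m + n) ≃ Fin (m' + n') :=
  finSumFinEquiv.symm.trans ((Equiv.sumCongr e f).trans finSumFinEquiv)

/-- The laws of a (differential graded) prop. -/
structure PropData.IsProp {k : Type u} [CommRing k] (P : PropData.{u, v} k) : Prop where
  /- every `hom m n` is a chain complex -/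
  d_mem : ∀ m n (i : ℤ), ∀ x ∈ P.deg m n i, P.d m n x ∈ P.deg m n (i - 1)
  d_d : ∀ m n (x : P.hom m n), P.d m n (P.d m n x) = 0
  /- `relabel` is a functor to chain complexes -/
  relabel_mem : ∀ {m m' n n' : ℕ} (e : Fin m ≃ Fin m') (f : Fin n ≃ Fin n') (i : ℤ),
    ∀ x ∈ P.deg m n i, P.relabel e f x ∈ P.deg m' n' i
  relabel_d : ∀ {m m' n n' : ℕ} (e : Fin m ≃ Fin m') (f : Fin n ≃ Fin n') (x : P.hom m n),
    P.d m' n' (P.relabel e f x) = P.relabel e f (P.d m n x)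
  relabel_refl : ∀ {m n : ℕ} (x : P.hom m n),
    P.relabel (Equiv.refl (Fin m)) (Equiv.refl (Fin n)) x = x
  relabel_trans : ∀ {m m' m'' n n' n'' : ℕ} (e : Fin m ≃ Fin m') (e' : Fin m' ≃ Fin m'')
    (f : Fin n ≃ Fin n') (f' : Fin n' ≃ Fin n'') (x : P.hom m n),
    P.relabel (e.trans e') (f.trans f') x = P.relabel e' f' (P.relabel e f x)
  /- the identities are cycles of degree zero, and the two compositions are chain maps -/
  one_mem : ∀ n, P.one n ∈ P.deg n n 0
  one_d : ∀ n, P.d n n (P.one n) = 0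
  vcomp_mem : ∀ m n p (i j : ℤ), ∀ x ∈ P.deg n p i, ∀ y ∈ P.deg m n j,
    P.vcomp m n p x y ∈ P.deg m p (i + j)
  vcomp_d : ∀ m n p (i : ℤ), ∀ x ∈ P.deg n p i, ∀ y : P.hom m n,
    P.d m p (P.vcomp m n p x y) =
      P.vcomp m n p (P.d n p x) y + i.negOnePow • P.vcomp m n p x (P.d m n y)
  hcomp_mem : ∀ m n m' n' (i j : ℤ), ∀ x ∈ P.deg m n i, ∀ y ∈ P.deg m' n' j,
    P.hcomp m n m' n' x y ∈ P.deg (m + m') (n + n') (i + j)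
  hcomp_d : ∀ m n m' n' (i : ℤ), ∀ x ∈ P.deg m n i, ∀ y : P.hom m' n',
    P.d (m + m') (n + n') (P.hcomp m n m' n' x y) =
      P.hcomp m n m' n' (P.d m n x) y + i.negOnePow • P.hcomp m n m' n' x (P.d m' n' y)
  /- vertical composition is associative, unital and equivariant -/
  vcomp_assoc : ∀ m n p q (x : P.hom p q) (y : P.hom n p) (z : P.hom m n),
    P.vcomp m n q (P.vcomp n p q x y) z = P.vcomp m p q x (P.vcomp m n p y z)
  one_vcomp : ∀ m n (x : P.hom m n), P.vcomp m n n (P.one n) x = x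
  vcomp_one : ∀ m n (x : P.hom m n), P.vcomp m m n x (P.one m) = x
  vcomp_relabel : ∀ {m m' n n' p p' : ℕ} (e : Fin m ≃ Fin m') (f : Fin n ≃ Fin n')
    (g : Fin p ≃ Fin p') (x : P.hom n p) (y : P.hom m n),
    P.vcomp m' n' p' (P.relabel f g x) (P.relabel e f y) = P.relabel e g (P.vcomp m n p x y)
  /- horizontal composition is associative, unital, equivariant and symmetric -/
  hcomp_assoc : ∀ m n m' n' m'' n'' (x : P.hom m n) (y : P.hom m' n') (z : P.hom m'' n''),
    P.relabel (finCongr (add_assoc m m' m'')) (finCongr (add_assoc n n' n''))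
      (P.hcomp (m + m') (n + n') m'' n'' (P.hcomp m n m' n' x y) z) =
    P.hcomp m n (m' + m'') (n' + n'') x (P.hcomp m' n' m'' n'' y z)
  one_hcomp : ∀ m n (x : P.hom m n),
    P.relabel (finCongr (zero_add m)) (finCongr (zero_add n)) (P.hcomp 0 0 m n (P.one 0) x) = x
  hcomp_one : ∀ m n (x : P.hom m n),
    P.relabel (finCongr (add_zero m)) (finCongr (add_zero n)) (P.hcomp m n 0 0 x (P.one 0)) = x
  hcomp_relabel : ∀ {m₁ m₁' n₁ n₁' m₂ m₂' n₂ n₂' : ℕ} (e₁ : Fin m₁ ≃ Fin m₁')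
    (f₁ : Fin n₁ ≃ Fin n₁') (e₂ : Fin m₂ ≃ Fin m₂') (f₂ : Fin n₂ ≃ Fin n₂')
    (x : P.hom m₁ n₁) (y : P.hom m₂ n₂),
    P.hcomp m₁' n₁' m₂' n₂' (P.relabel e₁ f₁ x) (P.relabel e₂ f₂ y) =
      P.relabel (blockSum e₁ e₂) (blockSum f₁ f₂) (P.hcomp m₁ n₁ m₂ n₂ x y)
  hcomp_comm : ∀ m n m' n' (i j : ℤ), ∀ x ∈ P.deg m n i, ∀ y ∈ P.deg m' n' j,
    P.relabel (finAddFlip : Fin (m + m') ≃ Fin (m' + m))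
      (finAddFlip : Fin (n + n') ≃ Fin (n' + n)) (P.hcomp m n m' n' x y) =
    (i * j).negOnePow • P.hcomp m' n' m n y x
  /- the two compositions are compatible -/
  one_hcomp_one : ∀ m n, P.hcomp m m n n (P.one m) (P.one n) = P.one (m + n)
  interchange : ∀ m n p m' n' p' (i j : ℤ) (x : P.hom n p), ∀ x' ∈ P.deg n' p' i,
    ∀ y ∈ P.deg m n j, ∀ y' : P.hom m' n',
    P.vcomp (m + m') (n + n') (p + p') (P.hcomp n p n' p' x x') (P.hcomp m n m' n' y y') =
      (i * j).negOnePow • P.hcomp m p m' p' (P.vcomp m n p x y) (P.vcomp m' n' p' x' y')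

/-- A Hopf prop, i.e. a prop over the symmetric monoidal category of (coassociative, counital)
differential graded coalgebras: a prop `P` over chain complexes with a coproduct `Δ` and a counit
`ε` on every complex `P.hom m n` making it a coalgebra, such that the structure maps of the prop
(relabelings, identities, vertical and horizontal composition) are morphisms of coalgebras. -/
structure PropData.IsHopfProp {k : Type u} [CommRing k] (P : PropData.{u, v} k)
    (Δ : ∀ m n, P.hom m n →ₗ[k] P.hom m n ⊗[k] P.hom m n) (ε : ∀ m n, P.hom m n →ₗ[k] k) :
    Prop extends P.IsProp where
  /- every `hom m n` is a differential graded coalgebra -/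
  comul_mem : ∀ m n (i : ℤ), ∀ x ∈ P.deg m n i, Δ m n x ∈ tensorDeg (P.deg m n) (P.deg m n) i
  comul_d : ∀ m n (x : P.hom m n),
    Δ m n (P.d m n x) = tensorD (P.deg m n) (P.d m n) (P.d m n) (Δ m n x)
  counit_deg : ∀ m n (i : ℤ), i ≠ 0 → ∀ x ∈ P.deg m n i, ε m n x = 0
  counit_d : ∀ m n (x : P.hom m n), ε m n (P.d m n x) = 0
  coassoc : ∀ m n (x : P.hom m n),
    TensorProduct.assoc k _ _ _ (LinearMap.rTensor _ (Δ m n) (Δ m n x)) =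
      LinearMap.lTensor _ (Δ m n) (Δ m n x)
  counit_left : ∀ m n (x : P.hom m n),
    TensorProduct.lid k _ (LinearMap.rTensor _ (ε m n) (Δ m n x)) = x
  counit_right : ∀ m n (x : P.hom m n),
    TensorProduct.rid k _ (LinearMap.lTensor _ (ε m n) (Δ m n x)) = x
  /- the structure maps of the prop are morphisms of coalgebras -/
  relabel_comul : ∀ {m m' n n' : ℕ} (e : Fin m ≃ Fin m') (f : Fin n ≃ Fin n') (x : P.hom m n),
    Δ m' n' (P.relabel e f x) =
      TensorProduct.map (P.relabel e f) (P.relabel e f) (Δ m n x)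
  relabel_counit : ∀ {m m' n n' : ℕ} (e : Fin m ≃ Fin m') (f : Fin n ≃ Fin n') (x : P.hom m n),
    ε m' n' (P.relabel e f x) = ε m n x
  one_comul : ∀ n, Δ n n (P.one n) = P.one n ⊗ₜ[k] P.one n
  one_counit : ∀ n, ε n n (P.one n) = 1
  vcomp_comul : ∀ m n p,
    Δ m p ∘ₗ TensorProduct.lift (P.vcomp m n p) =
      TensorProduct.map (TensorProduct.lift (P.vcomp m n p))
          (TensorProduct.lift (P.vcomp m n p)) ∘ₗ
        tensorComul (P.deg n p) (P.deg m n) (Δ n p) (Δ m n)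
  vcomp_counit : ∀ m n p (x : P.hom n p) (y : P.hom m n),
    ε m p (P.vcomp m n p x y) = ε n p x * ε m n y
  hcomp_comul : ∀ m n m' n',
    Δ (m + m') (n + n') ∘ₗ TensorProduct.lift (P.hcomp m n m' n') =
      TensorProduct.map (TensorProduct.lift (P.hcomp m n m' n'))
          (TensorProduct.lift (P.hcomp m n m' n')) ∘ₗ
        tensorComul (P.deg m n) (P.deg m' n') (Δ m n) (Δ m' n')
  hcomp_counit : ∀ m n m' n' (x : P.hom m n) (y : P.hom m' n'),
    ε (m + m') (n + n') (P.hcomp m n m' n' x y) = ε m n x * ε m' n' y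

/-! ### Directed graphs with labelled half-edges -/

/-- The generators of the free prop: the counit, the coproduct, the product (of degree one), and
the degree zero element `∂₀ product`. -/
inductive Gen
  | counit
  | coproduct
  | product
  | dproduct
  deriving DecidableEq

/-- The number of inputs of a generator. -/
def Gen.ins : Gen → ℕ
  | .counit => 1
  | .coproduct => 1
  | .product => 2
  | .dproduct => 2

/-- The number of outputs of a generator. -/
def Gen.outs : Gen → ℕ
  | .counit => 0
  | .coproduct => 2
  | .product => 1
  | .dproduct => 1

/-- The cells `[0]`, `[1]` and `[0,1]` of the interval. -/
inductive Cell
  | zero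
  | one
  | I
  deriving DecidableEq

/-- A directed graph without directed loops, with vertex set `V`, with `m` incoming and `n`
outgoing external half-edges, labelled by `Fin m` and `Fin n`. Each vertex is decorated by a
generator, its incoming and outgoing half-edges being labelled by the inputs and the outputs of that
generator. A directed edge joins a half-edge at which it starts (incoming and external, or outgoing
from a vertex) to a half-edge at which it ends (outgoing and external, or incoming to a vertex);
`wire` sends the former to the latter. -/
structure Graph (V : Type) (m n : ℕ) where
  kind : V → Gen
  wire : Fin m ⊕ (Σ v, Fin (kind v).outs) ≃ Fin n ⊕ (Σ v, Fin (kind v).ins)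
  acyclic : ∀ v, ¬ Relation.TransGen
    (fun v w => ∃ i j, wire (Sum.inr ⟨v, i⟩) = Sum.inr ⟨w, j⟩) v v

theorem acyclic_of_map {V W : Type} {r : V → V → Prop} {s : W → W → Prop} (f : V → W)
    (h : ∀ a b, r a b → s (f a) (f b)) (hs : ∀ w, ¬ Relation.TransGen s w w) :
    ∀ v, ¬ Relation.TransGen r v v :=
  fun v hv => hs (f v) (Relation.TransGen.lift f h _ _ hv)

theorem acyclic_sum {V W : Type} {r : V ⊕ W → V ⊕ W → Prop} {s : V → V → Prop}
    {t : W → W → Prop} (hs : ∀ v, ¬ Relation.TransGen s v v)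
    (ht : ∀ w, ¬ Relation.TransGen t w w)
    (h₁ : ∀ a b, r (Sum.inl a) (Sum.inl b) → s a b)
    (h₂ : ∀ a b, r (Sum.inr a) (Sum.inr b) → t a b)
    (h₃ : ∀ a b, ¬ r (Sum.inl a) (Sum.inr b)) :
    ∀ x, ¬ Relation.TransGen r x x := by
  have key : ∀ x y, Relation.TransGen r x y →
      (∀ a, x = Sum.inl a → ∃ b, y = Sum.inl b ∧ Relation.TransGen s a b) ∧
      (∀ b, y = Sum.inr b → ∃ a, x = Sum.inr a ∧ Relation.TransGen t a b) := by
    intro x y hxy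
    have base : ∀ x y, r x y →
        (∀ a, x = Sum.inl a → ∃ b, y = Sum.inl b ∧ s a b) ∧
        (∀ b, y = Sum.inr b → ∃ a, x = Sum.inr a ∧ t a b) := by
      rintro (a | a) (b | b) h
      · exact ⟨fun _ h' => ⟨b, rfl, by cases h'; exact h₁ _ _ h⟩, fun _ h' => (by cases h')⟩
      · exact absurd h (h₃ _ _)
      · exact ⟨fun _ h' => (by cases h'), fun _ h' => (by cases h')⟩
      · exact ⟨fun _ h' => (by cases h'), fun _ h' => ⟨a, rfl, by cases h'; exact h₂ _ _ h⟩⟩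
    induction hxy with
    | single h =>
      refine ⟨fun a ha => ?_, fun b hb => ?_⟩
      · obtain ⟨b, hb, h'⟩ := (base _ _ h).1 a ha
        exact ⟨b, hb, .single h'⟩
      · obtain ⟨a, ha, h'⟩ := (base _ _ h).2 b hb
        exact ⟨a, ha, .single h'⟩
    | tail _ h ih =>
      refine ⟨fun a ha => ?_, fun c hc => ?_⟩
      · obtain ⟨b, hb, h'⟩ := ih.1 a ha
        obtain ⟨c, hc, h''⟩ := (base _ _ h).1 b hb
        exact ⟨c, hc, h'.tail h''⟩
      · obtain ⟨b, hb, h''⟩ := (base _ _ h).2 c hc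
        obtain ⟨a, ha, h'⟩ := ih.2 b hb
        exact ⟨a, ha, h'.tail h''⟩
  rintro (v | w) hx
  · obtain ⟨b, hb, h⟩ := (key _ _ hx).1 v rfl
    cases hb
    exact hs v h
  · obtain ⟨a, ha, h⟩ := (key _ _ hx).2 w rfl
    cases ha
    exact ht w h

namespace Graph

variable {V W : Type} {m m' n n' p : ℕ}

/-- Transport of a graph along a bijection of vertex sets. -/
def reindex (e : V ≃ W) (x : Graph V m n) : Graph W m n where
  kind w := x.kind (e.symm w)
  wire :=
    (Equiv.sumCongr (Equiv.refl _)
      (Equiv.sigmaCongrLeft (β := fun v => Fin (x.kind v).outs) e.symm)).trans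
    (x.wire.trans (Equiv.sumCongr (Equiv.refl _)
      (Equiv.sigmaCongrLeft (β := fun v => Fin (x.kind v).ins) e.symm).symm))
  acyclic := by
    refine acyclic_of_map e.symm ?_ x.acyclic
    rintro a b ⟨i, j, h⟩
    refine ⟨i, j, ?_⟩
    simp only [Equiv.trans_apply] at h
    rw [← Equiv.eq_symm_apply] at h
    exact h

/-- Relabelling of the external half-edges. -/
def relabel (e : Fin m ≃ Fin m') (f : Fin n ≃ Fin n') (x : Graph V m n) : Graph V m' n' where
  kind := x.kind
  wire := (Equiv.sumCongr e.symm (Equiv.refl _)).trans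
    (x.wire.trans (Equiv.sumCongr f (Equiv.refl _)))
  acyclic := by
    refine acyclic_of_map id ?_ x.acyclic
    rintro a b ⟨i, j, h⟩
    refine ⟨i, j, ?_⟩
    simp only [Equiv.trans_apply] at h
    rw [← Equiv.eq_symm_apply] at h
    exact h

/-- The graph consisting of `n` edges and no vertices. -/
def one (n : ℕ) : Graph (Fin 0) n n where
  kind := Fin.elim0
  wire := Equiv.sumCongr (Equiv.refl _) (Equiv.equivOfIsEmpty _ _)
  acyclic := fun v => v.elim0

/-- The grafting `x ∘ y` of two graphs: the `i`-th output of `y` is joined to the `i`-th input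
of `x`. -/
def vcomp (x : Graph V n p) (y : Graph W m n) : Graph (V ⊕ W) m p where
  kind := Sum.elim x.kind y.kind
  wire :=
    (Equiv.sumCongr (Equiv.refl (Fin m)) ((Equiv.sumSigmaDistrib
      (fun v => Fin (Sum.elim x.kind y.kind v).outs)).trans (Equiv.sumComm _ _))).trans
    ((Equiv.sumAssoc _ _ _).symm.trans
    ((Equiv.sumCongr y.wire (Equiv.refl _)).trans
    ((Equiv.sumAssoc _ _ _).trans
    ((Equiv.sumCongr (Equiv.refl (Fin n)) (Equiv.sumComm _ _)).trans
    ((Equiv.sumAssoc _ _ _).symm.trans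
    ((Equiv.sumCongr x.wire (Equiv.refl _)).trans
    ((Equiv.sumAssoc _ _ _).trans
    (Equiv.sumCongr (Equiv.refl (Fin p)) (Equiv.sumSigmaDistrib
      (fun v => Fin (Sum.elim x.kind y.kind v).ins)).symm))))))))
  acyclic := by
    refine acyclic_sum x.acyclic y.acyclic ?_ ?_ ?_
    · rintro a b ⟨i, j, h⟩
      refine ⟨i, j, ?_⟩
      rcases hx : x.wire (Sum.inr ⟨a, i⟩) with c | ⟨c, l⟩
      · simp [hx, Equiv.sumSigmaDistrib] at h
      · simp [hx, Equiv.sumSigmaDistrib] at h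
        obtain ⟨rfl, rfl⟩ := h
        rfl
    · rintro a b ⟨i, j, h⟩
      refine ⟨i, j, ?_⟩
      rcases hy : y.wire (Sum.inr ⟨a, i⟩) with c | ⟨c, l⟩
      · rcases hx : x.wire (Sum.inl c) with q | ⟨q, l⟩
        · simp [hx, hy, Equiv.sumSigmaDistrib] at h
        · simp [hx, hy, Equiv.sumSigmaDistrib] at h
          cases h
      · simp [hy, Equiv.sumSigmaDistrib] at h
        obtain ⟨rfl, rfl⟩ := h
        rfl
    · rintro a b ⟨i, j, h⟩
      rcases hx : x.wire (Sum.inr ⟨a, i⟩) with c | ⟨c, l⟩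
      · simp [hx, Equiv.sumSigmaDistrib] at h
      · simp [hx, Equiv.sumSigmaDistrib] at h
        cases h

/-- The disjoint union `x ⊗ y` of two graphs, the external half-edges of `x` coming first. -/
def hcomp (x : Graph V m n) (y : Graph W m' n') : Graph (V ⊕ W) (m + m') (n + n') where
  kind := Sum.elim x.kind y.kind
  wire :=
    (Equiv.sumCongr finSumFinEquiv.symm
      (Equiv.sumSigmaDistrib (fun v => Fin (Sum.elim x.kind y.kind v).outs))).trans
    ((Equiv.sumSumSumComm _ _ _ _).trans
    ((Equiv.sumCongr x.wire y.wire).trans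
    ((Equiv.sumSumSumComm _ _ _ _).trans
    (Equiv.sumCongr finSumFinEquiv
      (Equiv.sumSigmaDistrib (fun v => Fin (Sum.elim x.kind y.kind v).ins)).symm))))
  acyclic := by
    refine acyclic_sum x.acyclic y.acyclic ?_ ?_ ?_
    · rintro a b ⟨i, j, h⟩
      refine ⟨i, j, ?_⟩
      rcases hx : x.wire (Sum.inr ⟨a, i⟩) with c | ⟨c, l⟩
      · simp [hx, Equiv.sumSigmaDistrib] at h
      · simp [hx, Equiv.sumSigmaDistrib] at h
        obtain ⟨rfl, rfl⟩ := h
        rfl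
    · rintro a b ⟨i, j, h⟩
      refine ⟨i, j, ?_⟩
      rcases hy : y.wire (Sum.inr ⟨a, i⟩) with c | ⟨c, l⟩
      · simp [hy, Equiv.sumSigmaDistrib] at h
      · simp [hy, Equiv.sumSigmaDistrib] at h
        obtain ⟨rfl, rfl⟩ := h
        rfl
    · rintro a b ⟨i, j, h⟩
      rcases hx : x.wire (Sum.inr ⟨a, i⟩) with c | ⟨c, l⟩
      · simp [hx, Equiv.sumSigmaDistrib] at h
      · simp [hx, Equiv.sumSigmaDistrib] at h
        cases h

/-- The graph with one vertex, decorated by `g`, whose half-edges are joined in order to the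
external ones. -/
def corolla (g : Gen) : Graph (Fin 1) g.ins g.outs where
  kind _ := g
  wire :=
    (Equiv.sumComm _ _).trans
      (Equiv.sumCongr (Equiv.uniqueSigma (fun _ : Fin 1 => Fin g.outs))
        (Equiv.uniqueSigma (fun _ : Fin 1 => Fin g.ins)).symm)
  acyclic := by
    have key : ∀ a b : Fin 1, ¬ (∃ (i : Fin g.outs) (j : Fin g.ins),
        ((Equiv.sumComm _ _).trans
          (Equiv.sumCongr (Equiv.uniqueSigma (fun _ : Fin 1 => Fin g.outs))
          (Equiv.uniqueSigma (fun _ : Fin 1 => Fin g.ins)).symm)) (Sum.inr ⟨a, i⟩) =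
          Sum.inr ⟨b, j⟩) := by
      rintro a b ⟨i, j, h⟩
      simp at h
    intro v hv
    cases hv with
    | single h => exact key _ _ h
    | tail _ h => exact key _ _ h

end Graph

/-- Replacing a product according to a cell of the interval: `[0,1]` keeps the product, while `[1]`
and `[0]` replace it by `∂₀ product` and by `∂₀ product` with its two inputs transposed. Other
generators are kept. -/
def Gen.face : Cell → Gen → Gen
  | .zero, .product => .dproduct
  | .one, .product => .dproduct
  | .I, .product => .product
  | _, .counit => .counit
  | _, .coproduct => .coproduct
  | _, .dproduct => .dproduct

/-- The identification of outputs that belongs to `Gen.face`. -/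
def Gen.faceOuts (c : Cell) (g : Gen) : Fin g.outs ≃ Fin (g.face c).outs :=
  finCongr (by cases c <;> cases g <;> rfl)

/-- The identification of inputs that belongs to `Gen.face`. -/
def Gen.faceIns (c : Cell) (g : Gen) : Fin g.ins ≃ Fin (g.face c).ins :=
  (if c = .zero ∧ g = .product then Fin.revPerm else Equiv.refl _).trans
    (finCongr (by cases c <;> cases g <;> rfl))

/-- Replacing every product vertex `v` of a graph according to the cell `c v`. -/
def Graph.face {V : Type} {m n : ℕ} (c : V → Cell) (x : Graph V m n) : Graph V m n where
  kind v := (x.kind v).face (c v)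
  wire :=
    (Equiv.sumCongr (Equiv.refl _)
      (Equiv.sigmaCongrRight (fun v => (x.kind v).faceOuts (c v)))).symm.trans
    (x.wire.trans (Equiv.sumCongr (Equiv.refl _)
      (Equiv.sigmaCongrRight (fun v => (x.kind v).faceIns (c v)))))
  acyclic := by
    refine acyclic_of_map id ?_ x.acyclic
    rintro a b ⟨i, j, h⟩
    refine ⟨((x.kind a).faceOuts (c a)).symm i, ((x.kind b).faceIns (c b)).symm j, ?_⟩
    simp only [Equiv.trans_apply] at h
    rw [← Equiv.eq_symm_apply] at h
    exact h

/-- A graph with finitely many vertices and a chosen total order of them. -/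
structure OGraph (m n : ℕ) where
  N : ℕ
  graph : Graph (Fin N) m n

namespace OGraph

variable {m m' n n' p : ℕ}

/-- `v` is a product vertex. -/
abbrev IsProd (Γ : OGraph m n) (v : Fin Γ.N) : Prop := Γ.graph.kind v = .product

/-- The ordered set of product vertices. -/
abbrev Prods (Γ : OGraph m n) : Type := {v : Fin Γ.N // Γ.IsProd v}

/-- The degree of a graph, its number of product vertices. -/
def degree (Γ : OGraph m n) : ℕ := Fintype.card Γ.Prods

/-- Changing the order of the vertices along a bijection. -/
def reorder (Γ : OGraph m n) {N' : ℕ} (e : Fin Γ.N ≃ Fin N') : OGraph m n :=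
  ⟨N', Γ.graph.reindex e⟩

/-- The sign of the permutation of the product vertices, all of degree one, in a change of
order. -/
def reorderSign (Γ : OGraph m n) {N' : ℕ} (e : Fin Γ.N ≃ Fin N') : ℤ :=
  (-1) ^ (Finset.univ.filter (fun q : Γ.Prods × Γ.Prods =>
    q.1 < q.2 ∧ e q.2.1 < e q.1.1)).card

/-- Relabelling of the external half-edges. -/
def relabel (e : Fin m ≃ Fin m') (f : Fin n ≃ Fin n') (Γ : OGraph m n) : OGraph m' n' :=
  ⟨Γ.N, Γ.graph.relabel e f⟩

/-- The graph without vertices, the identity. -/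
def one (n : ℕ) : OGraph n n := ⟨0, Graph.one n⟩

/-- Grafting, the vertices of `x` coming before those of `y`. -/
def vcomp (x : OGraph n p) (y : OGraph m n) : OGraph m p :=
  ⟨x.N + y.N, (x.graph.vcomp y.graph).reindex finSumFinEquiv⟩

/-- Disjoint union, the vertices of `x` coming before those of `y`. -/
def hcomp (x : OGraph m n) (y : OGraph m' n') : OGraph (m + m') (n + n') :=
  ⟨x.N + y.N, (x.graph.hcomp y.graph).reindex finSumFinEquiv⟩

/-- A generator as a graph. -/
def gen (g : Gen) : OGraph g.ins g.outs := ⟨1, Graph.corolla g⟩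

/-- Replacing the product vertices according to a family of cells. -/
def face (Γ : OGraph m n) (c : Fin Γ.N → Cell) : OGraph m n := ⟨Γ.N, Γ.graph.face c⟩

/-- The face of `Γ` at one vertex. -/
def face₁ (Γ : OGraph m n) (v : Fin Γ.N) (c : Cell) : OGraph m n :=
  Γ.face (Function.update (fun _ => Cell.I) v c)

end OGraph

namespace OGraph

/-- The counit. -/
def counit : OGraph 1 0 := gen .counit

/-- The coproduct. -/
def coproduct : OGraph 1 2 := gen .coproduct

/-- The product. -/
def product : OGraph 2 1 := gen .product

/-- The degree zero generator `∂₀ product`. -/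
def dproduct : OGraph 2 1 := gen .dproduct

/-- The edge, the identity with one input and one output. -/
def edge : OGraph 1 1 := one 1

/-- The counit on the first input and the identity on the second one. -/
def counitEdge : OGraph 2 1 := counit.hcomp edge

/-- The identity on the first input and the counit on the second one. -/
def edgeCounit : OGraph 2 1 := edge.hcomp counit

end OGraph

/-! ### The free prop and the prop `M` -/

section Free

variable (k : Type u) [CommRing k]

/-- The module with basis all `(m, n)`-graphs with a total order of the vertices. The component of
biarity `(m, n)` of the free prop is its quotient by the relation that identifies different orders up
to sign. -/
abbrev FreeMod (m n : ℕ) : Type u := OGraph m n →₀ k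

/-- A graph as an element of the module generated by graphs. -/
def ofGraph {m n : ℕ} (Γ : OGraph m n) : FreeMod k m n := Finsupp.single Γ 1

/-- The component of degree `i`. -/
def freePart {m n : ℕ} (i : ℤ) : FreeMod k m n →ₗ[k] FreeMod k m n :=
  Finsupp.linearCombination k (fun Γ => if (Γ.degree : ℤ) = i then ofGraph k Γ else 0)

/-- The differential: the derivation with
`∂ product = ∂₀ product - (∂₀ product with its two inputs transposed)`,
with the Koszul sign of passing by the preceding product vertices. -/
def freeD {m n : ℕ} : FreeMod k m n →ₗ[k] FreeMod k m n :=
  Finsupp.linearCombination k (fun Γ => ∑ v : Γ.Prods,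
    ((-1 : ℤ) ^ (Finset.univ.filter (fun u : Γ.Prods => u < v)).card) •
      (ofGraph k (Γ.face₁ v .one) - ofGraph k (Γ.face₁ v .zero)))

/-- Relabelling of the external half-edges. -/
def freeRelabel {m m' n n' : ℕ} (e : Fin m ≃ Fin m') (f : Fin n ≃ Fin n') :
    FreeMod k m n →ₗ[k] FreeMod k m' n' :=
  Finsupp.lmapDomain k k (OGraph.relabel e f)

/-- Bilinear extension of grafting. -/
def freeVcomp (m n p : ℕ) : FreeMod k n p →ₗ[k] FreeMod k m n →ₗ[k] FreeMod k m p :=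
  Finsupp.linearCombination k (fun x => Finsupp.lmapDomain k k (fun y => x.vcomp y))

/-- Bilinear extension of disjoint union. -/
def freeHcomp (m n m' n' : ℕ) :
    FreeMod k m n →ₗ[k] FreeMod k m' n' →ₗ[k] FreeMod k (m + m') (n + n') :=
  Finsupp.linearCombination k (fun x => Finsupp.lmapDomain k k (fun y => x.hcomp y))

/-- The relations that present `M`. -/
inductive Rel : ∀ m n : ℕ, FreeMod k m n → Prop
  /- changing the order of the vertices changes a graph by a sign -/
  | reorder {m n : ℕ} (Γ : OGraph m n) {N' : ℕ} (e : Fin Γ.N ≃ Fin N') :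
      Rel m n (ofGraph k (Γ.reorder e) - Γ.reorderSign e • ofGraph k Γ)
  /- `∂₀ product` is the counit on the first input -/
  | dproduct : Rel 2 1 (ofGraph k OGraph.dproduct - ofGraph k OGraph.counitEdge)
  /- the coproduct is counital on the left and on the right, and coassociative -/
  | leftCounit : Rel 1 1
      (ofGraph k (OGraph.counitEdge.vcomp OGraph.coproduct) - ofGraph k OGraph.edge)
  | rightCounit : Rel 1 1
      (ofGraph k (OGraph.edgeCounit.vcomp OGraph.coproduct) - ofGraph k OGraph.edge)
  | coassoc : Rel 1 3
      (ofGraph k ((OGraph.coproduct.hcomp OGraph.edge).vcomp OGraph.coproduct) -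
        ofGraph k ((OGraph.edge.hcomp OGraph.coproduct).vcomp OGraph.coproduct))
  /- the counit of a product is zero -/
  | productCounit : Rel 2 0 (ofGraph k (OGraph.counit.vcomp OGraph.product))

/-- The differential graded prop ideal generated by the relations. -/
inductive InIdeal : ∀ m n : ℕ, FreeMod k m n → Prop
  | rel {m n : ℕ} {x : FreeMod k m n} (h : Rel k m n x) : InIdeal m n x
  | zero {m n : ℕ} : InIdeal m n 0
  | add {m n : ℕ} {x y : FreeMod k m n} (hx : InIdeal m n x) (hy : InIdeal m n y) :
      InIdeal m n (x + y)
  | smul {m n : ℕ} (c : k) {x : FreeMod k m n} (hx : InIdeal m n x) : InIdeal m n (c • x)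
  | part {m n : ℕ} (i : ℤ) {x : FreeMod k m n} (hx : InIdeal m n x) :
      InIdeal m n (freePart k i x)
  | d {m n : ℕ} {x : FreeMod k m n} (hx : InIdeal m n x) : InIdeal m n (freeD k x)
  | relabel {m m' n n' : ℕ} (e : Fin m ≃ Fin m') (f : Fin n ≃ Fin n') {x : FreeMod k m n}
      (hx : InIdeal m n x) : InIdeal m' n' (freeRelabel k e f x)
  | vcomp_left {m n p : ℕ} {x : FreeMod k n p} (hx : InIdeal n p x) (y : FreeMod k m n) :
      InIdeal m p (freeVcomp k m n p x y)
  | vcomp_right {m n p : ℕ} (x : FreeMod k n p) {y : FreeMod k m n} (hy : InIdeal m n y) :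
      InIdeal m p (freeVcomp k m n p x y)
  | hcomp_left {m n m' n' : ℕ} {x : FreeMod k m n} (hx : InIdeal m n x) (y : FreeMod k m' n') :
      InIdeal (m + m') (n + n') (freeHcomp k m n m' n' x y)
  | hcomp_right {m n m' n' : ℕ} (x : FreeMod k m n) {y : FreeMod k m' n'}
      (hy : InIdeal m' n' y) : InIdeal (m + m') (n + n') (freeHcomp k m n m' n' x y)

/-- The component of biarity `(m, n)` of the ideal. -/
def ideal (m n : ℕ) : Submodule k (FreeMod k m n) where
  carrier := {x | InIdeal k m n x}
  add_mem' := InIdeal.add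
  zero_mem' := InIdeal.zero
  smul_mem' := InIdeal.smul

/-- The component of biarity `(m, n)` of `M`. -/
abbrev MHom (m n : ℕ) : Type u := FreeMod k m n ⧸ ideal k m n

/-- The class of a graph in `M`. -/
def cls {m n : ℕ} (Γ : OGraph m n) : MHom k m n := (ideal k m n).mkQ (ofGraph k Γ)

/-- The part of degree `i`, spanned by the graphs with `i` product vertices. -/
def MDeg (m n : ℕ) (i : ℤ) : Submodule k (MHom k m n) :=
  Submodule.span k {x | ∃ Γ : OGraph m n, (Γ.degree : ℤ) = i ∧ x = cls k Γ}

theorem cls_mem {m n : ℕ} (Γ : OGraph m n) : cls k Γ ∈ MDeg k m n Γ.degree :=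
  Submodule.subset_span ⟨Γ, rfl, rfl⟩

/-- A bilinear map descends to quotients. -/
def bilinQ {A B C : Type u} [AddCommGroup A] [Module k A] [AddCommGroup B] [Module k B]
    [AddCommGroup C] [Module k C] (I : Submodule k A) (J : Submodule k B) (K : Submodule k C)
    (f : A →ₗ[k] B →ₗ[k] C) (hI : ∀ x ∈ I, ∀ y, f x y ∈ K) (hJ : ∀ x, ∀ y ∈ J, f x y ∈ K) :
    A ⧸ I →ₗ[k] B ⧸ J →ₗ[k] C ⧸ K :=
  I.liftQ
    { toFun := fun a => J.mapQ K (f a) (fun y hy => hJ a y hy)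
      map_add' := fun a b => by
        apply Submodule.linearMap_qext
        ext y
        simp
      map_smul' := fun c a => by
        apply Submodule.linearMap_qext
        ext y
        simp }
    (fun x hx => by
      rw [LinearMap.mem_ker]
      apply Submodule.linearMap_qext
      ext y
      simpa using hI x hx y)

/-- Decomposition of an element of `M` into its parts. -/
def MDecompose (m n : ℕ) : MHom k m n →ₗ[k] ⨁ i, MDeg k m n i :=
  (ideal k m n).liftQ
    (Finsupp.linearCombination k (fun Γ : OGraph m n =>
      DirectSum.lof k ℤ (fun i => MDeg k m n i) Γ.degree ⟨cls k Γ, cls_mem k Γ⟩))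
    (by
      have key : ∀ (x : FreeMod k m n) (i : ℤ),
          (((Finsupp.linearCombination k (fun Γ : OGraph m n =>
            DirectSum.lof k ℤ (fun i => MDeg k m n i) Γ.degree ⟨cls k Γ, cls_mem k Γ⟩) x) i :
            MDeg k m n i) : MHom k m n) = (ideal k m n).mkQ (freePart k i x) := by
        intro x i
        induction x using Finsupp.induction_linear with
        | zero => simp
        | add x y hx hy => simp only [map_add, DirectSum.add_apply, Submodule.coe_add, hx, hy]
        | single Γ c =>
          by_cases h : (Γ.degree : ℤ) = i
          · subst h
            simp [freePart, cls, DirectSum.lof_eq_of, DirectSum.smul_apply]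
          · simp [freePart, h, DirectSum.lof_eq_of, DirectSum.smul_apply,
              DirectSum.of_eq_of_ne _ _ _ (Ne.symm h)]
      intro x hx
      rw [LinearMap.mem_ker]
      refine DFinsupp.ext fun i => Subtype.ext ?_
      refine (key x i).trans ?_
      rw [Submodule.mkQ_apply, (Submodule.Quotient.mk_eq_zero _).2]
      · rfl
      · exact InIdeal.part i hx)

instance MDecomposition (m n : ℕ) : DirectSum.Decomposition (MDeg k m n) :=
  DirectSum.Decomposition.ofLinearMap (MDeg k m n) (MDecompose k m n)
    (by
      apply Submodule.linearMap_qext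
      ext Γ
      simp [MDecompose, cls, ofGraph])
    (by
      ext i ⟨x, hx⟩ : 2
      simp only [LinearMap.comp_apply, LinearMap.id_apply, DirectSum.coeLinearMap_lof]
      induction hx using Submodule.span_induction with
      | mem x h =>
        obtain ⟨Γ, rfl, rfl⟩ := h
        simp [MDecompose, cls, ofGraph]
      | zero => exact (map_zero _).trans (map_zero (DirectSum.lof k ℤ (fun i => MDeg k m n i) i)).symm
      | add x y hx hy h₁ h₂ =>
        rw [map_add, h₁, h₂, ← map_add]
        rfl
      | smul c x hx h =>
        rw [map_smul, h, ← map_smul]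
        rfl)

/-- The prop `M`. -/
def M : PropData.{u, u} k where
  hom := MHom k
  deg := MDeg k
  d m n := (ideal k m n).mapQ (ideal k m n) (freeD k) (fun _ h => InIdeal.d h)
  relabel e f := (ideal k _ _).mapQ (ideal k _ _) (freeRelabel k e f)
    (fun _ h => InIdeal.relabel e f h)
  one n := cls k (OGraph.one n)
  vcomp m n p := bilinQ k _ _ _ (freeVcomp k m n p) (fun _ h y => InIdeal.vcomp_left h y)
    (fun x _ h => InIdeal.vcomp_right x h)
  hcomp m n m' n' := bilinQ k _ _ _ (freeHcomp k m n m' n')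
    (fun _ h y => InIdeal.hcomp_left h y) (fun x _ h => InIdeal.hcomp_right x h)

end Free

/-! ### The Serre coalgebra of a cube -/

section Cube

variable (k : Type u) [CommRing k] (ι : Type) [Fintype ι] [LinearOrder ι]

/-- The chains on the cube whose coordinates are indexed by the finite totally ordered set `ι`, with
basis the tensors `⊗ x i` of cells of the interval. For `ι = Fin d` it is the standard `d`-cube. -/
abbrev CubeChain : Type u := (ι → Cell) →₀ k

/-- The differential of the chains on a cube, determined by `∂ [0,1] = [1] - [0]`. -/
def cubeD : CubeChain k ι →ₗ[k] CubeChain k ι :=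
  Finsupp.linearCombination k (fun x : ι → Cell => ∑ i ∈ Finset.univ.filter (fun i => x i = .I),
    ((-1 : ℤ) ^ (Finset.univ.filter (fun j => j < i ∧ x j = .I)).card) •
      (Finsupp.single (Function.update x i .one) (1 : k) -
        Finsupp.single (Function.update x i .zero) (1 : k)))

/-- The terms of the coproduct of a cell: `[0] ⊗ [0]`, `[1] ⊗ [1]`, and
`[0] ⊗ [0,1] + [0,1] ⊗ [1]`. -/
def Cell.comul : Cell → Finset (Cell × Cell)
  | .zero => {(.zero, .zero)}
  | .one => {(.one, .one)}
  | .I => {(.zero, .I), (.I, .one)}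

/-- The Serre coproduct
`Δ (⊗ x i) = ∑ ± (⊗ (x i)⁽¹⁾) ⊗ (⊗ (x i)⁽²⁾)`,
where the Koszul sign comes from moving `(x j)⁽¹⁾` past `(x i)⁽²⁾` for `i < j`. -/
def serre : CubeChain k ι →ₗ[k] CubeChain k ι ⊗[k] CubeChain k ι :=
  Finsupp.linearCombination k (fun x : ι → Cell =>
    ∑ t ∈ Fintype.piFinset (fun i => (x i).comul),
      ((-1 : ℤ) ^ (Finset.univ.filter (fun q : ι × ι =>
          q.1 < q.2 ∧ (t q.1).2 = .I ∧ (t q.2).1 = .I)).card) •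
        (Finsupp.single (fun i => (t i).1) (1 : k) ⊗ₜ[k]
          Finsupp.single (fun i => (t i).2) (1 : k)))

/-- The top cell `[0,1] ⊗ ⋯ ⊗ [0,1]`. -/
def topCell : CubeChain k ι := Finsupp.single (fun _ => Cell.I) 1

end Cube

section Characteristic

variable (k : Type u) [CommRing k] {m n : ℕ}

/-- Replacing every product vertex of a graph according to a cell of the cube. -/
def OGraph.cubeFace (Γ : OGraph m n) (x : Γ.Prods → Cell) : OGraph m n :=
  Γ.face (fun v => if h : Γ.IsProd v then x ⟨v, h⟩ else .I)

/-- The characteristic map of a graph with totally ordered vertices, from the chains on the cube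
with one coordinate for every product vertex. -/
def charMap (Γ : OGraph m n) : CubeChain k Γ.Prods →ₗ[k] (M k).hom m n :=
  Finsupp.linearCombination k (fun x => cls k (Γ.cubeFace x))

/-- The value `(ι_Γ ⊗ ι_Γ) (Δ [0,1]^d)` prescribed for the coproduct of `Γ`. -/
def graphComul (Γ : OGraph m n) : (M k).hom m n ⊗[k] (M k).hom m n :=
  TensorProduct.map (charMap k Γ) (charMap k Γ) (serre k Γ.Prods (topCell k Γ.Prods))

/-- The value prescribed for the counit of `Γ`. -/
def graphCounit (Γ : OGraph m n) : k := if Γ.degree = 0 then 1 else 0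

end Characteristic

end HopfProp

end

/-! The coalgebra structure of `M` is transported from cubes. The face of a graph Γ at a cell of its
cube has the intervals of that cell as its product vertices, and its characteristic map is ι_Γ
restricted to the corresponding face of the cube (`cubeFace_face`, `charQ_face`). Boundary and Serre
coproduct are natural for inclusions of faces (`cubeD_extend`, `serre_extend`). Hence formulas
prescribed on top cells hold on all cells: ι_Γ is a chain map (`Md_charQ`), and the coproduct
composed with ι_Γ is ι_Γ ⊗ ι_Γ after the Serre coproduct (`freeComul_freeChar`). Compatibility with
the differential, coassociativity and counitality then follow from the same facts for cubes
(`serre_cubeD`, `serre_coassoc`, `serre_counit_left`, `serre_counit_right`).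

Grafting and disjoint union list the vertices of one graph before those of the other, so the cube of
the composite is a product of cubes. The boundary obeys the Leibniz rule (`cubeD_append`), and the
Serre sign of a product is the product of the Serre signs times the Koszul sign of exchanging the
middle factors (`serreSign_append`). This yields `Md_join` and `comulQ_join` for both compositions
at once.

The coproduct is first defined on ordered graphs with values already in M ⊗ M, so only its vanishing
on the ideal is at stake. For a change of order, each interval of the top cell goes to exactly one
tensor factor, and the signs match pair by pair (`serreSign_comp_symm`). The relations between
graphs of degree zero hold because such graphs are grouplike. The graph for ε ∘ * has degree one and
vanishing class, and each term of its coproduct has this class as a factor. The kernel is closed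
under the operations that generate the ideal (`eq_zero_of_inIdeal`).

The laws of a prop are equalities of graphs up to canonical bijections of vertex sets, checked on
wiring functions; their signs come from comparing the orders of the vertices. Signs are written as
products of local factors ±1, and cubes are mostly indexed by all vertices, those that are not
products carrying an inert cell. Uniqueness holds because classes of graphs span `M`. -/

open scoped TensorProduct DirectSum

noncomputable section

namespace HopfProp

universe u v

/-! ### Graphs through their wiring functions -/

/-- Half-edges without dependent types. -/
def encode {V : Type} {n : ℕ} {K : V → ℕ} : Fin n ⊕ (Σ v, Fin (K v)) → Fin n ⊕ V × ℕ :=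
  Sum.map id (fun s => (s.1, (s.2 : ℕ)))

theorem encode_injective {V : Type} {n : ℕ} {K : V → ℕ} :
    Function.Injective (encode : Fin n ⊕ (Σ v, Fin (K v)) → Fin n ⊕ V × ℕ) := by
  refine Function.injective_id.sumMap ?_
  rintro ⟨v, i⟩ ⟨w, j⟩ h
  simp only [Prod.mk.injEq] at h
  obtain ⟨rfl, h⟩ := h
  rw [Fin.ext h]

@[simp] theorem encode_inl {V : Type} {n : ℕ} {K : V → ℕ} (i : Fin n) :
    encode (K := K) (Sum.inl i) = Sum.inl i := rfl

@[simp] theorem encode_inr {V : Type} {n : ℕ} {K : V → ℕ} (s : Σ v, Fin (K v)) :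
    encode (n := n) (Sum.inr s) = Sum.inr (s.1, (s.2 : ℕ)) := rfl

namespace Graph

variable {V W U X : Type} {m m' m'' n n' n'' p p' q : ℕ}

/-- The wiring of a graph as a function on numbered half-edges. -/
def next (x : Graph V m n) : Fin m ⊕ V × ℕ → Fin n ⊕ V × ℕ
  | .inl i => encode (x.wire (.inl i))
  | .inr (v, i) => if h : i < (x.kind v).outs then encode (x.wire (.inr ⟨v, ⟨i, h⟩⟩))
      -- A junk value makes `next` total. The offset 2 keeps it away from the numbers 0 and 1 that
      -- `faceShift` interchanges, so that the formula for `next` of a face needs no range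
      -- hypothesis.
      else .inr (v, i + 2)

/-- The type of `wire` depends on `kind`, so a direct comparison would involve heterogeneous
equality. Once the kinds agree, injectivity of `encode` moves the comparison to a type without
dependence. The laws for `Graph` below rest on this criterion. -/
theorem ext_next {x y : Graph V m n} (hk : ∀ v, x.kind v = y.kind v)
    (hn : ∀ a, x.next a = y.next a) : x = y := by
  obtain ⟨kx, wx, ax⟩ := x
  obtain ⟨ky, wy, ay⟩ := y
  obtain rfl : kx = ky := funext hk
  congr 1
  ext1 a
  apply encode_injective
  rcases a with i | ⟨v, i⟩
  · exact hn (.inl i)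
  · have := hn (.inr (v, i))
    simpa [next] using this

theorem next_reindex (e : V ≃ W) (x : Graph V m n) (a : Fin m ⊕ W × ℕ) :
    (x.reindex e).next a =
      Sum.map id (Prod.map e id) (x.next (Sum.map id (Prod.map e.symm id) a)) := by
  have key : ∀ s : Fin n ⊕ (Σ v, Fin (x.kind v).ins),
      encode (Sum.map id (Equiv.sigmaCongrLeft (β := fun v => Fin (x.kind v).ins) e.symm).symm s) =
        Sum.map id (Prod.map e id) (encode s) := by
    rintro (c | ⟨c, l⟩)
    · rfl
    · obtain ⟨c, rfl⟩ := e.symm.surjective c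
      have : (Equiv.sigmaCongrLeft (β := fun v => Fin (x.kind v).ins) e.symm).symm
          ⟨e.symm c, l⟩ = ⟨c, l⟩ := by
        rw [Equiv.symm_apply_eq]
        rfl
      simp [this]
  rcases a with i | ⟨v, i⟩
  · exact key _
  · by_cases hi : i < (x.kind (e.symm v)).outs
    · have hi' : i < ((x.reindex e).kind v).outs := hi
      simp only [next, hi, hi', Sum.map_inr, Prod.map, dif_pos, id]
      exact key _
    · have hi' : ¬ i < ((x.reindex e).kind v).outs := hi
      simp [next, hi, hi']

theorem next_relabel (e : Fin m ≃ Fin m') (f : Fin n ≃ Fin n') (x : Graph V m n)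
    (a : Fin m' ⊕ V × ℕ) :
    (x.relabel e f).next a = Sum.map f id (x.next (Sum.map e.symm id a)) := by
  have key : ∀ s : Fin n ⊕ (Σ v, Fin (x.kind v).ins),
      encode (Sum.map f id s) = Sum.map f id (encode s) := by
    rintro (c | ⟨c, l⟩) <;> rfl
  rcases a with i | ⟨v, i⟩
  · exact key _
  · by_cases hi : i < (x.kind v).outs
    · have hi' : i < ((x.relabel e f).kind v).outs := hi
      simp only [next, hi, hi', Sum.map_inr, dif_pos, id]
      exact key _
    · have hi' : ¬ i < ((x.relabel e f).kind v).outs := hi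
      simp [next, hi, hi']

theorem next_one (i : Fin n) : (Graph.one n).next (.inl i) = .inl i := rfl

theorem next_inr_of_not_lt (x : Graph V m n) {v : V} {i : ℕ} (hi : ¬ i < (x.kind v).outs) :
    x.next (.inr (v, i)) = .inr (v, i + 2) := dif_neg hi

theorem next_inr_of_lt (x : Graph V m n) {v : V} {i : ℕ} (hi : i < (x.kind v).outs) :
    x.next (.inr (v, i)) = encode (x.wire (.inr ⟨v, ⟨i, hi⟩⟩)) := dif_pos hi

theorem encode_graft_left (x : Graph V n p) (y : Graph W m n)
    (s : Fin p ⊕ (Σ v, Fin (x.kind v).ins)) :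
    encode (Equiv.sumCongr (Equiv.refl (Fin p)) (Equiv.sumSigmaDistrib
        (fun v => Fin (Sum.elim x.kind y.kind v).ins)).symm (Equiv.sumAssoc _ _ _ (.inl s))) =
      Sum.map id (Prod.map Sum.inl id) (encode s) := by
  rcases s with d | ⟨d, l⟩ <;> rfl

/-- The wiring of a grafting, on a half-edge which the upper graph sends to `s`. -/
theorem encode_graft (x : Graph V n p) (y : Graph W m n) (s : Fin n ⊕ (Σ v, Fin (y.kind v).ins)) :
    encode (Equiv.sumCongr (Equiv.refl (Fin p)) (Equiv.sumSigmaDistrib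
        (fun v => Fin (Sum.elim x.kind y.kind v).ins)).symm
      (Equiv.sumAssoc _ _ _ (Equiv.sumCongr x.wire (Equiv.refl _) ((Equiv.sumAssoc _ _ _).symm
        (Equiv.sumCongr (Equiv.refl (Fin n)) (Equiv.sumComm _ _)
          (Equiv.sumAssoc _ _ _ (.inl s))))))) =
      Sum.elim (fun c => Sum.map id (Prod.map Sum.inl id) (x.next (.inl c)))
        (fun s => .inr (.inr s.1, s.2)) (encode s) := by
  rcases s with c | ⟨c, l⟩
  · exact encode_graft_left x y (x.wire (.inl c))
  · rfl

/-- An edge first runs through `y`. If it leaves `y` at the output `c`, it continues in `x` from the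
input `c`; otherwise it has ended at a vertex of `y`. -/
theorem next_vcomp_inl (x : Graph V n p) (y : Graph W m n) (i : Fin m) :
    (x.vcomp y).next (.inl i) =
      Sum.elim (fun c => Sum.map id (Prod.map Sum.inl id) (x.next (.inl c)))
        (fun s => .inr (.inr s.1, s.2)) (y.next (.inl i)) :=
  encode_graft x y _

theorem next_vcomp_inr_inr (x : Graph V n p) (y : Graph W m n) (w : W) (i : ℕ) :
    (x.vcomp y).next (.inr (.inr w, i)) =
      Sum.elim (fun c => Sum.map id (Prod.map Sum.inl id) (x.next (.inl c)))
        (fun s => .inr (.inr s.1, s.2)) (y.next (.inr (w, i))) := by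
  by_cases hi : i < (y.kind w).outs
  · rw [next_inr_of_lt y hi, next_inr_of_lt (x.vcomp y) hi]
    exact encode_graft x y _
  · rw [next_inr_of_not_lt y hi, next_inr_of_not_lt (x.vcomp y) hi]
    rfl

theorem next_vcomp_inr_inl (x : Graph V n p) (y : Graph W m n) (v : V) (i : ℕ) :
    (x.vcomp y).next (.inr (.inl v, i)) =
      Sum.map id (Prod.map Sum.inl id) (x.next (.inr (v, i))) := by
  by_cases hi : i < (x.kind v).outs
  · rw [next_inr_of_lt x hi, next_inr_of_lt (x.vcomp y) hi]
    exact encode_graft_left x y _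
  · rw [next_inr_of_not_lt x hi, next_inr_of_not_lt (x.vcomp y) hi]
    rfl

theorem next_hcomp_castAdd (x : Graph V m n) (y : Graph W m' n') (i : Fin m) :
    (x.hcomp y).next (.inl (Fin.castAdd m' i)) =
      Sum.map (Fin.castAdd n') (Prod.map Sum.inl id) (x.next (.inl i)) := by
  dsimp only [next, hcomp]
  rcases hx : x.wire (.inl i) with d | ⟨d, l⟩ <;> simp [hx, Equiv.sumSigmaDistrib]

theorem next_hcomp_natAdd (x : Graph V m n) (y : Graph W m' n') (i : Fin m') :
    (x.hcomp y).next (.inl (Fin.natAdd m i)) =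
      Sum.map (Fin.natAdd n) (Prod.map Sum.inr id) (y.next (.inl i)) := by
  dsimp only [next, hcomp]
  rcases hx : y.wire (.inl i) with d | ⟨d, l⟩ <;> simp [hx, Equiv.sumSigmaDistrib]

theorem next_hcomp_inl (x : Graph V m n) (y : Graph W m' n') (v : V) (i : ℕ) :
    (x.hcomp y).next (.inr (.inl v, i)) =
      Sum.map (Fin.castAdd n') (Prod.map Sum.inl id) (x.next (.inr (v, i))) := by
  have key : ∀ s : Fin n ⊕ (Σ v, Fin (x.kind v).ins),
      encode (Equiv.sumCongr finSumFinEquiv (Equiv.sumSigmaDistrib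
          (fun v => Fin (Sum.elim x.kind y.kind v).ins)).symm
        (Equiv.sumSumSumComm (Fin n) _ (Fin n') _ (.inl s))) =
      Sum.map (Fin.castAdd n') (Prod.map Sum.inl id) (encode s) := by
    rintro (d | ⟨d, l⟩) <;> rfl
  by_cases hi : i < (x.kind v).outs
  · rw [next_inr_of_lt x hi, next_inr_of_lt (x.hcomp y) hi]
    exact key _
  · rw [next_inr_of_not_lt x hi, next_inr_of_not_lt (x.hcomp y) hi]
    rfl

theorem next_hcomp_inr (x : Graph V m n) (y : Graph W m' n') (v : W) (i : ℕ) :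
    (x.hcomp y).next (.inr (.inr v, i)) =
      Sum.map (Fin.natAdd n) (Prod.map Sum.inr id) (y.next (.inr (v, i))) := by
  have key : ∀ s : Fin n' ⊕ (Σ v, Fin (y.kind v).ins),
      encode (Equiv.sumCongr finSumFinEquiv (Equiv.sumSigmaDistrib
          (fun v => Fin (Sum.elim x.kind y.kind v).ins)).symm
        (Equiv.sumSumSumComm (Fin n) _ (Fin n') _ (.inr s))) =
      Sum.map (Fin.natAdd n) (Prod.map Sum.inr id) (encode s) := by
    rintro (d | ⟨d, l⟩) <;> rfl
  by_cases hi : i < (y.kind v).outs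
  · rw [next_inr_of_lt y hi, next_inr_of_lt (x.hcomp y) hi]
    exact key _
  · rw [next_inr_of_not_lt y hi, next_inr_of_not_lt (x.hcomp y) hi]
    rfl

/-- The renumbering of the inputs of a vertex in `Graph.face`. -/
def faceShift (c : Cell) (g : Gen) (j : ℕ) : ℕ :=
  if c = .zero ∧ g = .product ∧ j < 2 then 1 - j else j

theorem faceShift_val (c : Cell) (g : Gen) (i : Fin g.ins) :
    ((g.faceIns c i : Fin _) : ℕ) = faceShift c g i := by
  have hi := i.2
  obtain ⟨i, _⟩ := i
  cases c <;> cases g <;> simp [Gen.faceIns, faceShift]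
  simp only [Gen.ins] at hi
  interval_cases i <;> rfl

theorem outs_face (c : Cell) (g : Gen) : (g.face c).outs = g.outs := by
  cases c <;> cases g <;> rfl

theorem next_face (c : V → Cell) (x : Graph V m n) (a : Fin m ⊕ V × ℕ) :
    (x.face c).next a =
      Sum.map id (fun s => (s.1, faceShift (c s.1) (x.kind s.1) s.2)) (x.next a) := by
  have key : ∀ s : Fin n ⊕ (Σ v, Fin (x.kind v).ins),
      encode (Sum.map id (Equiv.sigmaCongrRight (fun v => (x.kind v).faceIns (c v))) s) =
        Sum.map id (fun s => (s.1, faceShift (c s.1) (x.kind s.1) s.2)) (encode s) := by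
    rintro (d | ⟨d, l⟩)
    · rfl
    · simp [faceShift_val]
  rcases a with i | ⟨v, i⟩
  · exact key _
  · by_cases hi : i < (x.kind v).outs
    · have hi' : i < ((x.face c).kind v).outs := by rwa [face, outs_face]
      rw [next_inr_of_lt _ hi, next_inr_of_lt _ hi']
      exact key _
    · have hi' : ¬ i < ((x.face c).kind v).outs := by rwa [face, outs_face]
      simp [next_inr_of_not_lt _ hi, next_inr_of_not_lt _ hi', faceShift]

/-! ### Identities between graphs -/

theorem reindex_refl (x : Graph V m n) : x.reindex (Equiv.refl V) = x :=
  ext_next (fun _ => rfl) (fun a => by simp [next_reindex])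

theorem reindex_reindex (e : V ≃ W) (f : W ≃ U) (x : Graph V m n) :
    (x.reindex e).reindex f = x.reindex (e.trans f) := by
  refine ext_next (fun _ => rfl) (fun a => ?_)
  simp only [next_reindex, Sum.map_map, Prod.map_comp_map]
  rfl

theorem relabel_refl (x : Graph V m n) :
    x.relabel (Equiv.refl (Fin m)) (Equiv.refl (Fin n)) = x :=
  ext_next (fun _ => rfl) (fun a => by simp [next_relabel])

theorem relabel_relabel (e : Fin m ≃ Fin m') (e' : Fin m' ≃ Fin m'') (f : Fin n ≃ Fin n')
    (f' : Fin n' ≃ Fin n'') (x : Graph V m n) :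
    (x.relabel e f).relabel e' f' = x.relabel (e.trans e') (f.trans f') := by
  refine ext_next (fun _ => rfl) (fun a => ?_)
  simp only [next_relabel, Sum.map_map]
  rfl

theorem relabel_reindex (g : V ≃ W) (e : Fin m ≃ Fin m') (f : Fin n ≃ Fin n')
    (x : Graph V m n) : (x.reindex g).relabel e f = (x.relabel e f).reindex g := by
  refine ext_next (fun _ => rfl) (fun a => ?_)
  simp only [next_relabel, next_reindex, Sum.map_map]
  rfl

theorem vcomp_reindex (e : V ≃ W) (f : U ≃ X) (x : Graph V n p) (y : Graph U m n) :
    (x.reindex e).vcomp (y.reindex f) = (x.vcomp y).reindex (Equiv.sumCongr e f) := by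
  refine ext_next ?_ ?_
  · rintro (v | v) <;> rfl
  · rintro (i | ⟨v | v, i⟩)
    · simp only [next_reindex, next_vcomp_inl, Sum.map_inl, id]
      rcases y.next (.inl i) with a | a
      · rcases h : x.next (.inl a) with b | ⟨b, j⟩ <;> simp [h]
      · simp
    · simp only [next_reindex, next_vcomp_inr_inl, Sum.map_inr, Prod.map, Equiv.sumCongr_symm,
        Equiv.sumCongr_apply, Sum.map_inl, id]
      rcases x.next (.inr (e.symm v, i)) with b | ⟨b, j⟩ <;> simp
    · simp only [next_reindex, next_vcomp_inr_inr, Sum.map_inr, Prod.map, Equiv.sumCongr_symm,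
        Equiv.sumCongr_apply, id]
      rcases y.next (.inr (f.symm v, i)) with a | a
      · rcases h : x.next (.inl a) with b | ⟨b, j⟩ <;> simp [h]
      · simp

theorem hcomp_reindex (e : V ≃ W) (f : U ≃ X) (x : Graph V m n) (y : Graph U m' n') :
    (x.reindex e).hcomp (y.reindex f) = (x.hcomp y).reindex (Equiv.sumCongr e f) := by
  refine ext_next ?_ ?_
  · rintro (v | v) <;> rfl
  · rintro (i | ⟨v | v, i⟩)
    · induction i using Fin.addCases with
      | left i =>
        simp only [next_reindex, next_hcomp_castAdd, Sum.map_inl, id]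
        rcases x.next (.inl i) with a | ⟨a, j⟩ <;> simp
      | right i =>
        simp only [next_reindex, next_hcomp_natAdd, Sum.map_inl, id]
        rcases y.next (.inl i) with a | ⟨a, j⟩ <;> simp
    · simp only [next_reindex, next_hcomp_inl, Sum.map_inr, Prod.map, Equiv.sumCongr_symm,
        Equiv.sumCongr_apply, Sum.map_inl, id]
      rcases x.next (.inr (e.symm v, i)) with b | ⟨b, j⟩ <;> simp
    · simp only [next_reindex, next_hcomp_inr, Sum.map_inr, Prod.map, Equiv.sumCongr_symm,
        Equiv.sumCongr_apply, id]
      rcases y.next (.inr (f.symm v, i)) with a | ⟨a, j⟩ <;> simp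

/-- On unordered vertex sets the laws of a prop hold without signs, up to the canonical bijection of
vertex sets. Signs appear only when numberings of the vertices are compared. -/
theorem vcomp_assoc (x : Graph V p q) (y : Graph W n p) (z : Graph U m n) :
    x.vcomp (y.vcomp z) = ((x.vcomp y).vcomp z).reindex (Equiv.sumAssoc V W U) := by
  refine ext_next ?_ ?_
  · rintro (v | v | v) <;> rfl
  · rintro (i | ⟨v | v | v, i⟩)
    · simp only [next_reindex, next_vcomp_inl, Sum.map_inl, id]
      rcases z.next (.inl i) with a | a
      · rcases h : y.next (.inl a) with b | b
        · rcases h' : x.next (.inl b) with c | ⟨c, j⟩ <;> simp [h, h']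
        · simp [h]
      · simp
    · simp only [next_reindex, next_vcomp_inr_inl, Sum.map_inr, Prod.map,
        Equiv.sumAssoc_symm_apply_inl, id]
      rcases x.next (.inr (v, i)) with b | ⟨b, j⟩ <;> simp
    · simp only [next_reindex, next_vcomp_inr_inl, next_vcomp_inr_inr, Sum.map_inr, Prod.map,
        Equiv.sumAssoc_symm_apply_inr_inl, id]
      rcases y.next (.inr (v, i)) with b | b
      · rcases h' : x.next (.inl b) with c | ⟨c, j⟩ <;> simp [h']
      · simp
    · simp only [next_reindex, next_vcomp_inr_inr, Sum.map_inr, Prod.map,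
        Equiv.sumAssoc_symm_apply_inr_inr, id]
      rcases z.next (.inr (v, i)) with a | a
      · rcases h : y.next (.inl a) with b | b
        · rcases h' : x.next (.inl b) with c | ⟨c, j⟩ <;> simp [next_vcomp_inl, h, h']
        · simp [next_vcomp_inl, h]
      · simp

theorem one_vcomp (x : Graph V m n) :
    (Graph.one n).vcomp x = x.reindex (Equiv.emptySum (Fin 0) V).symm := by
  refine ext_next ?_ ?_
  · rintro (v | v)
    · exact v.elim0
    · rfl
  · rintro (i | ⟨v | v, i⟩)
    · simp only [next_reindex, next_vcomp_inl, Sum.map_inl, id]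
      rcases x.next (.inl i) with a | ⟨a, j⟩ <;> simp [next_one]
    · exact v.elim0
    · simp only [next_reindex, next_vcomp_inr_inr, Sum.map_inr, Prod.map, Equiv.symm_symm, id,
        Equiv.emptySum_apply_inr]
      rcases x.next (.inr (v, i)) with a | ⟨a, j⟩ <;> simp [next_one]

theorem vcomp_one (x : Graph V m n) :
    x.vcomp (Graph.one m) = x.reindex (Equiv.sumEmpty V (Fin 0)).symm := by
  refine ext_next ?_ ?_
  · rintro (v | v)
    · rfl
    · exact v.elim0
  · rintro (i | ⟨v | v, i⟩)
    · simp only [next_reindex, next_vcomp_inl, Sum.map_inl, id, next_one, Sum.elim_inl]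
      rcases x.next (.inl i) with a | ⟨a, j⟩ <;> simp
    · simp only [next_reindex, next_vcomp_inr_inl, Sum.map_inr, Prod.map, Equiv.symm_symm, id,
        Equiv.sumEmpty_apply_inl]
      rcases x.next (.inr (v, i)) with a | ⟨a, j⟩ <;> simp
    · exact v.elim0

theorem vcomp_relabel (e : Fin m ≃ Fin m') (f : Fin n ≃ Fin n') (g : Fin p ≃ Fin p')
    (x : Graph V n p) (y : Graph W m n) :
    (x.relabel f g).vcomp (y.relabel e f) = (x.vcomp y).relabel e g := by
  refine ext_next ?_ ?_
  · rintro (v | v) <;> rfl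
  · rintro (i | ⟨v | v, i⟩)
    · simp only [next_relabel, next_vcomp_inl, Sum.map_inl]
      rcases y.next (.inl (e.symm i)) with a | a
      · rcases h : x.next (.inl a) with b | ⟨b, j⟩ <;> simp [h]
      · simp
    · simp only [next_relabel, next_vcomp_inr_inl, Sum.map_inr, id]
      rcases x.next (.inr (v, i)) with b | ⟨b, j⟩ <;> simp
    · simp only [next_relabel, next_vcomp_inr_inr, Sum.map_inr, id]
      rcases y.next (.inr (v, i)) with a | a
      · rcases h : x.next (.inl a) with b | ⟨b, j⟩ <;> simp [h]
      · simp

theorem hcomp_assoc (x : Graph V m n) (y : Graph W m' n') (z : Graph U m'' n'') :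
    x.hcomp (y.hcomp z) = (((x.hcomp y).hcomp z).relabel (finCongr (add_assoc m m' m''))
      (finCongr (add_assoc n n' n''))).reindex (Equiv.sumAssoc V W U) := by
  have h₁ : ∀ i : Fin n, finCongr (add_assoc n n' n'') (Fin.castAdd n'' (Fin.castAdd n' i)) =
    Fin.castAdd (n' + n'') i := fun i => Fin.ext (by simp)
  have h₂ : ∀ i : Fin n', finCongr (add_assoc n n' n'') (Fin.castAdd n'' (Fin.natAdd n i)) =
    Fin.natAdd n (Fin.castAdd n'' i) := fun i => Fin.ext (by simp)
  have h₃ : ∀ i : Fin n'', finCongr (add_assoc n n' n'') (Fin.natAdd (n + n') i) =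
    Fin.natAdd n (Fin.natAdd n' i) := fun i => Fin.ext (by simp [add_assoc])
  have k₁ : ∀ i : Fin m, (finCongr (add_assoc m m' m'')).symm (Fin.castAdd (m' + m'') i) =
    Fin.castAdd m'' (Fin.castAdd m' i) := fun i => Fin.ext (by simp)
  have k₂ : ∀ i : Fin m', (finCongr (add_assoc m m' m'')).symm (Fin.natAdd m (Fin.castAdd m'' i)) =
    Fin.castAdd m'' (Fin.natAdd m i) := fun i => Fin.ext (by simp)
  have k₃ : ∀ i : Fin m'', (finCongr (add_assoc m m' m'')).symm (Fin.natAdd m (Fin.natAdd m' i)) =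
    Fin.natAdd (m + m') i := fun i => Fin.ext (by simp [add_assoc])
  refine ext_next ?_ ?_
  · rintro (v | v | v) <;> rfl
  · rintro (i | ⟨v | v | v, i⟩)
    · induction i using Fin.addCases with
      | left i =>
        simp only [next_reindex, next_relabel, next_hcomp_castAdd, Sum.map_inl, id, k₁]
        rcases x.next (.inl i) with a | ⟨a, j⟩ <;> simp only [Sum.map_inl, Sum.map_inr, h₁] <;> rfl
      | right i =>
        induction i using Fin.addCases with
        | left i =>
          simp only [next_reindex, next_relabel, next_hcomp_castAdd, next_hcomp_natAdd,
            Sum.map_inl, id, k₂]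
          rcases y.next (.inl i) with a | ⟨a, j⟩ <;> simp only [Sum.map_inl, Sum.map_inr, h₂] <;> rfl
        | right i =>
          simp only [next_reindex, next_relabel, next_hcomp_natAdd, Sum.map_inl, id, k₃]
          rcases z.next (.inl i) with a | ⟨a, j⟩ <;> simp only [Sum.map_inl, Sum.map_inr, h₃] <;> rfl
    · simp only [next_reindex, next_relabel, next_hcomp_inl, Sum.map_inr, Prod.map, id,
        Equiv.sumAssoc_symm_apply_inl]
      rcases x.next (.inr (v, i)) with a | ⟨a, j⟩ <;> simp only [Sum.map_inl, Sum.map_inr, h₁] <;> rfl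
    · simp only [next_reindex, next_relabel, next_hcomp_inl, next_hcomp_inr, Sum.map_inr, Prod.map,
        id, Equiv.sumAssoc_symm_apply_inr_inl]
      rcases y.next (.inr (v, i)) with a | ⟨a, j⟩ <;> simp only [Sum.map_inl, Sum.map_inr, h₂] <;> rfl
    · simp only [next_reindex, next_relabel, next_hcomp_inr, Sum.map_inr, Prod.map,
        id, Equiv.sumAssoc_symm_apply_inr_inr]
      rcases z.next (.inr (v, i)) with a | ⟨a, j⟩ <;> simp only [Sum.map_inl, Sum.map_inr, h₃] <;> rfl

theorem one_hcomp (x : Graph V m n) :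
    ((Graph.one 0).hcomp x).relabel (finCongr (zero_add m)) (finCongr (zero_add n)) =
      x.reindex (Equiv.emptySum (Fin 0) V).symm := by
  have h : ∀ i : Fin n, finCongr (zero_add n) (Fin.natAdd 0 i) = i := fun i => Fin.ext (by simp)
  have k : ∀ i : Fin m, (finCongr (zero_add m)).symm i = Fin.natAdd 0 i :=
    fun i => Fin.ext (by simp)
  refine ext_next ?_ ?_
  · rintro (v | v)
    · exact v.elim0
    · rfl
  · rintro (i | ⟨v | v, i⟩)
    · simp only [next_reindex, next_relabel, Sum.map_inl, k, next_hcomp_natAdd, id]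
      rcases x.next (.inl i) with a | ⟨a, j⟩ <;> simp only [Sum.map_inl, Sum.map_inr, h] <;> rfl
    · exact v.elim0
    · simp only [next_reindex, next_relabel, Sum.map_inr, next_hcomp_inr, id, Prod.map,
        Equiv.symm_symm, Equiv.emptySum_apply_inr]
      rcases x.next (.inr (v, i)) with a | ⟨a, j⟩ <;> simp only [Sum.map_inl, Sum.map_inr, h] <;> rfl

theorem hcomp_one (x : Graph V m n) :
    (x.hcomp (Graph.one 0)).relabel (finCongr (add_zero m)) (finCongr (add_zero n)) =
      x.reindex (Equiv.sumEmpty V (Fin 0)).symm := by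
  have h : ∀ i : Fin n, finCongr (add_zero n) (Fin.castAdd 0 i) = i := fun i => Fin.ext (by simp)
  have k : ∀ i : Fin m, (finCongr (add_zero m)).symm i = Fin.castAdd 0 i :=
    fun i => Fin.ext (by simp)
  refine ext_next ?_ ?_
  · rintro (v | v)
    · rfl
    · exact v.elim0
  · rintro (i | ⟨v | v, i⟩)
    · simp only [next_reindex, next_relabel, Sum.map_inl, k, next_hcomp_castAdd, id]
      rcases x.next (.inl i) with a | ⟨a, j⟩ <;> simp only [Sum.map_inl, Sum.map_inr, h] <;> rfl
    · simp only [next_reindex, next_relabel, Sum.map_inr, next_hcomp_inl, id, Prod.map,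
        Equiv.symm_symm, Equiv.sumEmpty_apply_inl]
      rcases x.next (.inr (v, i)) with a | ⟨a, j⟩ <;> simp only [Sum.map_inl, Sum.map_inr, h] <;> rfl
    · exact v.elim0

@[simp] theorem blockSum_castAdd (e : Fin m ≃ Fin m') (f : Fin n ≃ Fin n') (i : Fin m) :
    blockSum e f (Fin.castAdd n i) = Fin.castAdd n' (e i) := by simp [blockSum]

@[simp] theorem blockSum_natAdd (e : Fin m ≃ Fin m') (f : Fin n ≃ Fin n') (i : Fin n) :
    blockSum e f (Fin.natAdd m i) = Fin.natAdd m' (f i) := by simp [blockSum]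

theorem blockSum_symm (e : Fin m ≃ Fin m') (f : Fin n ≃ Fin n') :
    (blockSum e f).symm = blockSum e.symm f.symm := rfl

theorem hcomp_relabel {m₁ m₁' n₁ n₁' m₂ m₂' n₂ n₂' : ℕ} (e₁ : Fin m₁ ≃ Fin m₁')
    (f₁ : Fin n₁ ≃ Fin n₁') (e₂ : Fin m₂ ≃ Fin m₂') (f₂ : Fin n₂ ≃ Fin n₂')
    (x : Graph V m₁ n₁) (y : Graph W m₂ n₂) :
    (x.relabel e₁ f₁).hcomp (y.relabel e₂ f₂) =
      (x.hcomp y).relabel (blockSum e₁ e₂) (blockSum f₁ f₂) := by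
  refine ext_next ?_ ?_
  · rintro (v | v) <;> rfl
  · rintro (i | ⟨v | v, i⟩)
    · induction i using Fin.addCases with
      | left i =>
        simp only [next_relabel, next_hcomp_castAdd, Sum.map_inl, blockSum_symm, blockSum_castAdd]
        rcases x.next (.inl (e₁.symm i)) with a | ⟨a, j⟩ <;> simp
      | right i =>
        simp only [next_relabel, next_hcomp_natAdd, Sum.map_inl, blockSum_symm, blockSum_natAdd]
        rcases y.next (.inl (e₂.symm i)) with a | ⟨a, j⟩ <;> simp
    · simp only [next_relabel, next_hcomp_inl, Sum.map_inr, id]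
      rcases x.next (.inr (v, i)) with a | ⟨a, j⟩ <;> simp
    · simp only [next_relabel, next_hcomp_inr, Sum.map_inr, id]
      rcases y.next (.inr (v, i)) with a | ⟨a, j⟩ <;> simp

theorem hcomp_comm (x : Graph V m n) (y : Graph W m' n') :
    (x.hcomp y).relabel (finAddFlip : Fin (m + m') ≃ Fin (m' + m))
      (finAddFlip : Fin (n + n') ≃ Fin (n' + n)) =
      (y.hcomp x).reindex (Equiv.sumComm W V) := by
  have hs : ∀ {a b : ℕ}, (finAddFlip : Fin (a + b) ≃ Fin (b + a)).symm = finAddFlip := by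
    intro a b
    refine Equiv.ext fun i => ?_
    rw [Equiv.symm_apply_eq]
    induction i using Fin.addCases <;> simp
  refine ext_next ?_ ?_
  · rintro (v | v) <;> rfl
  · rintro (i | ⟨v | v, i⟩)
    · induction i using Fin.addCases with
      | left i =>
        simp only [next_reindex, next_relabel, next_hcomp_castAdd, next_hcomp_natAdd, Sum.map_inl,
          hs, finAddFlip_apply_castAdd, id]
        rcases y.next (.inl i) with a | ⟨a, j⟩ <;> simp
      | right i =>
        simp only [next_reindex, next_relabel, next_hcomp_castAdd, next_hcomp_natAdd, Sum.map_inl,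
          hs, finAddFlip_apply_natAdd, id]
        rcases x.next (.inl i) with a | ⟨a, j⟩ <;> simp
    · simp only [next_reindex, next_relabel, next_hcomp_inl, next_hcomp_inr, Sum.map_inr, id,
        Prod.map, Equiv.sumComm_symm, Equiv.sumComm_apply, Sum.swap_inl]
      rcases x.next (.inr (v, i)) with a | ⟨a, j⟩ <;> simp
    · simp only [next_reindex, next_relabel, next_hcomp_inl, next_hcomp_inr, Sum.map_inr, id,
        Prod.map, Equiv.sumComm_symm, Equiv.sumComm_apply, Sum.swap_inr]
      rcases y.next (.inr (v, i)) with a | ⟨a, j⟩ <;> simp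

theorem one_hcomp_one (m n : ℕ) :
    (Graph.one m).hcomp (Graph.one n) =
      (Graph.one (m + n)).reindex (Equiv.emptySum (Fin 0) (Fin 0)).symm := by
  refine ext_next ?_ ?_
  · rintro (v | v) <;> exact v.elim0
  · rintro (i | ⟨v | v, i⟩)
    · simp only [next_reindex, Sum.map_inl, next_one, id]
      induction i using Fin.addCases with
      | left i => rw [next_hcomp_castAdd]; rfl
      | right i => rw [next_hcomp_natAdd]; rfl
    · exact v.elim0
    · exact v.elim0

theorem interchange (x : Graph V n p) (x' : Graph W n' p') (y : Graph U m n)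
    (y' : Graph X m' n') :
    (x.hcomp x').vcomp (y.hcomp y') =
      ((x.vcomp y).hcomp (x'.vcomp y')).reindex (Equiv.sumSumSumComm V U W X) := by
  refine ext_next ?_ ?_
  · rintro ((v | v) | (v | v)) <;> rfl
  · rintro (i | ⟨(v | v) | (v | v), i⟩)
    · induction i using Fin.addCases with
      | left i =>
        simp only [next_reindex, next_vcomp_inl, next_hcomp_castAdd, Sum.map_inl, id]
        rcases y.next (.inl i) with a | ⟨a, j⟩
        · rcases h : x.next (.inl a) with b | ⟨b, j⟩ <;> simp [next_hcomp_castAdd, h]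
        · simp
      | right i =>
        simp only [next_reindex, next_vcomp_inl, next_hcomp_natAdd, Sum.map_inl, id]
        rcases y'.next (.inl i) with a | ⟨a, j⟩
        · rcases h : x'.next (.inl a) with b | ⟨b, j⟩ <;> simp [next_hcomp_natAdd, h]
        · simp
    · rw [next_vcomp_inr_inl, next_hcomp_inl, next_reindex]
      change _ = Sum.map _ _ (Graph.next _ (Sum.inr (Sum.inl (Sum.inl v), i)))
      rw [next_hcomp_inl, next_vcomp_inr_inl]
      rcases x.next (.inr (v, i)) with a | ⟨a, j⟩ <;> simp
    · rw [next_vcomp_inr_inl, next_hcomp_inr, next_reindex]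
      change _ = Sum.map _ _ (Graph.next _ (Sum.inr (Sum.inr (Sum.inl v), i)))
      rw [next_hcomp_inr, next_vcomp_inr_inl]
      rcases x'.next (.inr (v, i)) with a | ⟨a, j⟩ <;> simp
    · rw [next_vcomp_inr_inr, next_hcomp_inl, next_reindex]
      change _ = Sum.map _ _ (Graph.next _ (Sum.inr (Sum.inl (Sum.inr v), i)))
      rw [next_hcomp_inl, next_vcomp_inr_inr]
      rcases y.next (.inr (v, i)) with a | ⟨a, j⟩
      · rcases h : x.next (.inl a) with b | ⟨b, j⟩ <;> simp [next_hcomp_castAdd, h]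
      · simp
    · rw [next_vcomp_inr_inr, next_hcomp_inr, next_reindex]
      change _ = Sum.map _ _ (Graph.next _ (Sum.inr (Sum.inr (Sum.inr v), i)))
      rw [next_hcomp_inr, next_vcomp_inr_inr]
      rcases y'.next (.inr (v, i)) with a | ⟨a, j⟩
      · rcases h : x'.next (.inl a) with b | ⟨b, j⟩ <;> simp [next_hcomp_natAdd, h]
      · simp

theorem face_I (x : Graph V m n) : x.face (fun _ => .I) = x := by
  refine ext_next (fun v => ?_) (fun a => ?_)
  · change (x.kind v).face .I = _
    cases x.kind v <;> rfl
  · rw [next_face]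
    rcases x.next a with b | ⟨b, j⟩ <;> simp [faceShift]

/-- Only product vertices react to their cell, so cells at the other vertices may be filled in
arbitrarily. -/
theorem face_congr (x : Graph V m n) {c c' : V → Cell}
    (h : ∀ v, x.kind v = .product → c v = c' v) : x.face c = x.face c' := by
  refine ext_next (fun v => ?_) (fun a => ?_)
  · change (x.kind v).face (c v) = (x.kind v).face (c' v)
    have := h v
    cases hk : x.kind v with
    | product => rw [this hk]
    | _ => cases c v <;> cases c' v <;> rfl
  · rw [next_face, next_face]
    rcases x.next a with b | ⟨b, j⟩
    · rfl
    · by_cases hb : x.kind b = .product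
      · simp [h b hb]
      · simp [faceShift, hb]

/-- A replaced product is a `dproduct` and ignores later cells, while a product kept by `c` still
sees `c'`. -/
theorem face_face (x : Graph V m n) (c c' : V → Cell) :
    (x.face c).face c' = x.face (fun v => if c v = .I then c' v else c v) := by
  refine ext_next (fun v => ?_) (fun a => ?_)
  · change ((x.kind v).face (c v)).face (c' v) = (x.kind v).face (if c v = .I then c' v else c v)
    cases x.kind v <;> cases c v <;> cases c' v <;> rfl
  · rw [next_face, next_face, next_face]
    rcases x.next a with b | ⟨b, j⟩
    · rfl
    · simp only [Sum.map_inr]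
      congr 2
      change faceShift (c' b) ((x.kind b).face (c b)) _ = _
      cases x.kind b <;> cases c b <;> cases c' b <;> simp [faceShift, Gen.face]

theorem face_relabel (e : Fin m ≃ Fin m') (f : Fin n ≃ Fin n') (x : Graph V m n)
    (c : V → Cell) : (x.relabel e f).face c = (x.face c).relabel e f := by
  refine ext_next (fun v => rfl) (fun a => ?_)
  simp only [next_face, next_relabel, Sum.map_map]
  rfl

theorem face_reindex (e : V ≃ W) (x : Graph V m n) (c : W → Cell) :
    (x.reindex e).face c = (x.face (c ∘ e)).reindex e := by
  refine ext_next (fun v => ?_) (fun a => ?_)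
  · simp [face, reindex]
  simp only [next_face, next_reindex, Sum.map_map]
  congr 1
  ext s
  · rfl
  · simp [reindex]

theorem face_vcomp (x : Graph V n p) (y : Graph W m n) (c : V → Cell) (c' : W → Cell) :
    (x.vcomp y).face (Sum.elim c c') = (x.face c).vcomp (y.face c') := by
  refine ext_next ?_ ?_
  · rintro (v | v) <;> rfl
  · rintro (i | ⟨v | v, i⟩)
    · simp only [next_face, next_vcomp_inl]
      rcases y.next (.inl i) with a | ⟨a, j⟩
      · rcases h : x.next (.inl a) with b | ⟨b, j⟩ <;> simp [h, vcomp]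
      · simp [vcomp]
    · simp only [next_face, next_vcomp_inr_inl]
      rcases x.next (.inr (v, i)) with b | ⟨b, j⟩ <;> simp [vcomp]
    · simp only [next_face, next_vcomp_inr_inr]
      rcases y.next (.inr (v, i)) with a | ⟨a, j⟩
      · rcases h : x.next (.inl a) with b | ⟨b, j⟩ <;> simp [h, vcomp]
      · simp [vcomp]

theorem face_hcomp (x : Graph V m n) (y : Graph W m' n') (c : V → Cell) (c' : W → Cell) :
    (x.hcomp y).face (Sum.elim c c') = (x.face c).hcomp (y.face c') := by
  refine ext_next ?_ ?_
  · rintro (v | v) <;> rfl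
  · rintro (i | ⟨v | v, i⟩)
    · induction i using Fin.addCases with
      | left i =>
        simp only [next_face, next_hcomp_castAdd]
        rcases x.next (.inl i) with a | ⟨a, j⟩ <;> simp [hcomp]
      | right i =>
        simp only [next_face, next_hcomp_natAdd]
        rcases y.next (.inl i) with a | ⟨a, j⟩ <;> simp [hcomp]
    · simp only [next_face, next_hcomp_inl]
      rcases x.next (.inr (v, i)) with b | ⟨b, j⟩ <;> simp [hcomp]
    · simp only [next_face, next_hcomp_inr]
      rcases y.next (.inr (v, i)) with b | ⟨b, j⟩ <;> simp [hcomp]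

end Graph

/-! ### Signs as products -/

section Products

variable {ι κ M : Type*} [Fintype ι] [Fintype κ] [CommMonoid M]

/-- As products of local factors, signs can be compared factor by factor instead of by counting
inversions. -/
theorem neg_one_pow_card_filter (P : ι → Prop) [DecidablePred P] :
    (-1 : ℤ) ^ (Finset.univ.filter P).card = ∏ i, if P i then -1 else 1 := by
  rw [Finset.prod_ite, Finset.prod_const, Finset.prod_const_one, mul_one]

theorem prod_eq_prod_mul_of_eq_off [DecidableEq ι] {F G : ι → M} (i : ι) (c : M)
    (h : ∀ j, j ≠ i → F j = G j) (hi : F i = G i * c) : ∏ j, F j = (∏ j, G j) * c := by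
  rw [← Finset.prod_erase_mul _ _ (Finset.mem_univ i), hi, ← mul_assoc,
    ← Finset.prod_erase_mul Finset.univ G (Finset.mem_univ i)]
  congr 2
  exact Finset.prod_congr rfl fun j hj => h j (Finset.ne_of_mem_erase hj)

/-- A change of order can move the factor of a pair from `(p, q)` to `(q, p)`, so only the
contributions of unordered pairs can be compared. -/
theorem prod_prod_eq_of_symm [LinearOrder ι] {F G : ι → ι → M} (hd : ∀ p, F p p = G p p)
    (h : ∀ p q, p < q → F p q * F q p = G p q * G q p) :
    ∏ p, ∏ q, F p q = ∏ p, ∏ q, G p q := by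
  have key : ∀ F : ι → ι → M, ∏ p, ∏ q, F p q =
      ∏ p, ∏ q, if p < q then F p q * F q p else if p = q then F p p else 1 := by
    intro F
    have h₁ : ∀ p q, F p q = ((if p < q then F p q else 1) * (if p = q then F p p else 1)) *
        (if q < p then F p q else 1) := by
      intro p q
      rcases lt_trichotomy p q with h | h | h
      · simp [h, h.ne, h.not_gt]
      · subst h
        simp
      · simp [h, h.ne', h.not_gt]
    have h₂ : ∏ p, ∏ q, (if q < p then F p q else 1) =
        ∏ p, ∏ q, (if p < q then F q p else 1) := Finset.prod_comm
    calc ∏ p, ∏ q, F p q = (∏ p, ∏ q, ((if p < q then F p q else 1) *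
          (if p = q then F p p else 1))) * ∏ p, ∏ q, (if q < p then F p q else 1) := by
          simp only [← Finset.prod_mul_distrib]
          exact Finset.prod_congr rfl fun p _ => Finset.prod_congr rfl fun q _ => h₁ p q
      _ = _ := by
          rw [h₂]
          simp only [← Finset.prod_mul_distrib]
          refine Finset.prod_congr rfl fun p _ => Finset.prod_congr rfl fun q _ => ?_
          by_cases h : p < q
          · simp [h, h.ne]
          · simp [h]
  rw [key F, key G]
  refine Finset.prod_congr rfl fun p _ => Finset.prod_congr rfl fun q _ => ?_
  split_ifs with h₁ h₂
  · exact h p q h₁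
  · exact hd p
  · rfl

end Products

section Tmul

variable {k A B : Type*} [CommRing k] [AddCommGroup A] [Module k A] [AddCommGroup B] [Module k B]

theorem zsmul_tmul (r : ℤ) (a : A) (b : B) : (r • a) ⊗ₜ[k] b = r • (a ⊗ₜ[k] b) :=
  map_zsmul ((TensorProduct.mk k A B).flip b) r a

theorem tmul_zsmul (r : ℤ) (a : A) (b : B) : a ⊗ₜ[k] (r • b) = r • (a ⊗ₜ[k] b) :=
  map_zsmul (TensorProduct.mk k A B a) r b

end Tmul

/-- Telescoping through `h`. In `serre_cubeD` the three families have [1] ⊗ [1], [0] ⊗ [0] and, in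
the middle, [0] ⊗ [1] at the coordinate in question. -/
theorem sum_zsmul_sub_sum {σ A : Type*} [AddCommGroup A] (S : Finset σ) {ε : ℤ} {a b c : σ → ℤ}
    (f g h : σ → A) (ha : ∀ s ∈ S, a s = ε * c s) (hb : ∀ s ∈ S, b s = ε * c s) :
    ε • (∑ s ∈ S, c s • f s - ∑ s ∈ S, c s • g s) =
      ∑ s ∈ S, (a s • (f s - h s) + b s • (h s - g s)) := by
  rw [← Finset.sum_sub_distrib, Finset.smul_sum]
  refine Finset.sum_congr rfl fun s hs => ?_
  rw [ha s hs, hb s hs, ← smul_sub, smul_smul, ← smul_add]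
  congr 1
  abel

/-! ### The cellular chains of a cube -/

section Cubes

variable (k : Type u) [CommRing k] {ι : Type} [Fintype ι] [LinearOrder ι]
variable {κ : Type} [Fintype κ] [LinearOrder κ]

/-- The cube chain given by a cell. -/
abbrev cell (x : ι → Cell) : CubeChain k ι := Finsupp.single x 1

/-- The Koszul sign of the face at `i`. -/
def faceSign (x : ι → Cell) (i : ι) : ℤ := ∏ j, if j < i ∧ x j = .I then -1 else 1

/-- The parity of the dimension of a cell. -/
def cellSign (x : ι → Cell) : ℤ := ∏ j, if x j = .I then -1 else 1

/-- The Koszul sign of a term of the Serre coproduct. -/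
def serreSign (t : ι → Cell × Cell) : ℤ :=
  ∏ p, ∏ q, if p < q ∧ (t p).2 = .I ∧ (t q).1 = .I then -1 else 1

/-- The tensor of a family of pairs of cells. -/
def cellPair (t : ι → Cell × Cell) : CubeChain k ι ⊗[k] CubeChain k ι :=
  cell k (fun i => (t i).1) ⊗ₜ[k] cell k (fun i => (t i).2)

/-- The terms of the Serre coproduct. -/
def serreTerms (x : ι → Cell) : Finset (ι → Cell × Cell) := Fintype.piFinset fun i => (x i).comul

theorem mem_serreTerms {x : ι → Cell} {t : ι → Cell × Cell} :
    t ∈ serreTerms x ↔ ∀ i, t i ∈ (x i).comul := Fintype.mem_piFinset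

theorem cubeD_cell (x : ι → Cell) : cubeD k ι (cell k x) = ∑ i, if x i = .I then
    faceSign x i • (cell k (Function.update x i .one) - cell k (Function.update x i .zero))
    else 0 := by
  rw [cubeD, Finsupp.linearCombination_single, one_smul, Finset.sum_filter]
  simp only [neg_one_pow_card_filter]
  rfl

theorem serre_cell (x : ι → Cell) :
    serre k ι (cell k x) = ∑ t ∈ serreTerms x, serreSign t • cellPair k t := by
  rw [serre, Finsupp.linearCombination_single, one_smul]
  simp only [neg_one_pow_card_filter, Fintype.prod_prod_type]
  rfl

theorem Cell.mem_comul_iff {a b c : Cell} : (a, b) ∈ c.comul ↔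
    (c = .zero ∧ a = .zero ∧ b = .zero) ∨ (c = .one ∧ a = .one ∧ b = .one) ∨
      (c = .I ∧ a = .zero ∧ b = .I) ∨ (c = .I ∧ a = .I ∧ b = .one) := by
  cases a <;> cases b <;> cases c <;> decide

variable {k} in
theorem cubeChain_ext {A : Type*} [AddCommMonoid A] [Module k A] {f g : CubeChain k ι →ₗ[k] A}
    (h : ∀ x, f (cell k x) = g (cell k x)) : f = g :=
  Finsupp.lhom_ext' fun x => LinearMap.ext_ring (h x)

/-- Collapsing the interval at `i` removes one interval in front of exactly the coordinates after
`i`. -/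
theorem faceSign_update {x : ι → Cell} {i : ι} (hx : x i = .I) {b : Cell} (hb : b ≠ .I) (j : ι) :
    faceSign x j = faceSign (Function.update x i b) j * (if i < j then -1 else 1) := by
  refine prod_eq_prod_mul_of_eq_off i _ (fun l hl => ?_) ?_
  · simp [hl]
  · simp [hx, hb]

/-- Faces at two different coordinates, taken in either order, give the same cell with opposite
signs: the earlier interval counts in the sign of the later face only as long as it has not been
collapsed. -/
theorem cubeD_cubeD (c : CubeChain k ι) : cubeD k ι (cubeD k ι c) = 0 := by
  suffices h : cubeD k ι ∘ₗ cubeD k ι = 0 from LinearMap.congr_fun h c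
  refine cubeChain_ext fun x => ?_
  rw [LinearMap.comp_apply, LinearMap.zero_apply, cubeD_cell, map_sum]
  have h₁ : ∀ i b, b ≠ Cell.I → x i = .I → cubeD k ι (cell k (Function.update x i b)) =
      ∑ j, if i ≠ j ∧ x j = .I then (faceSign x j * (if i < j then -1 else 1)) •
        (cell k (Function.update (Function.update x i b) j .one) -
          cell k (Function.update (Function.update x i b) j .zero)) else 0 := by
    intro i b hb hi
    rw [cubeD_cell]
    refine Finset.sum_congr rfl fun j _ => ?_
    by_cases hij : i = j
    · subst hij
      simp [hb]
    · have : (Function.update x i b) j = x j := Function.update_of_ne (Ne.symm hij) _ _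
      have hs := faceSign_update hi hb j
      have h2 : faceSign x j * (if i < j then -1 else 1) = faceSign (Function.update x i b) j := by
        rw [hs, mul_assoc]
        split_ifs <;> simp
      simp only [this, h2, ne_eq, hij, not_false_eq_true, true_and]
  have h₂ : ∀ i, cubeD k ι (if x i = .I then faceSign x i • (cell k (Function.update x i .one) -
        cell k (Function.update x i .zero)) else 0) =
      ∑ j, if i ≠ j ∧ x i = .I ∧ x j = .I then
        (faceSign x i * (faceSign x j * (if i < j then -1 else 1))) •
        ((cell k (Function.update (Function.update x i .one) j .one) -
          cell k (Function.update (Function.update x i .one) j .zero)) -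
        (cell k (Function.update (Function.update x i .zero) j .one) -
          cell k (Function.update (Function.update x i .zero) j .zero))) else 0 := by
    intro i
    by_cases hi : x i = .I
    · rw [if_pos hi, map_zsmul, map_sub, h₁ i _ (by simp) hi, h₁ i _ (by simp) hi,
        ← Finset.sum_sub_distrib, Finset.smul_sum]
      refine Finset.sum_congr rfl fun j _ => ?_
      simp only [hi, true_and]
      split_ifs <;> simp only [mul_smul, smul_sub, smul_zero, sub_zero]
    · simp [hi]
  simp only [h₂]
  rw [← Fintype.sum_prod_type']
  -- Exchanging the two coordinates cancels the terms in pairs; the fixed pairs `(i, i)` contribute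
  -- zero.
  refine Finset.sum_involution (fun a _ => a.swap) ?_ ?_ ?_ ?_
  · rintro ⟨i, j⟩ -
    simp only [Prod.swap]
    by_cases h : i ≠ j ∧ x i = .I ∧ x j = .I
    · have h' : j ≠ i ∧ x j = .I ∧ x i = .I := ⟨h.1.symm, h.2.2, h.2.1⟩
      rw [if_pos h, if_pos h']
      simp only [Function.update_comm h.1.symm]
      have hs : faceSign x j * (faceSign x i * (if j < i then -1 else 1)) =
          -(faceSign x i * (faceSign x j * (if i < j then -1 else 1))) := by
        rcases lt_or_gt_of_ne h.1 with hl | hl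
        · simp [hl, hl.not_gt]; ring
        · simp [hl, hl.not_gt]; ring
      rw [hs, neg_smul, ← sub_eq_add_neg, sub_eq_zero]
      congr 1
      abel
    · have h' : ¬ (j ≠ i ∧ x j = .I ∧ x i = .I) := fun h' => h ⟨h'.1.symm, h'.2.2, h'.2.1⟩
      rw [if_neg h, if_neg h', add_zero]
  · rintro ⟨i, j⟩ - hne heq
    simp only [Prod.swap, Prod.mk.injEq] at heq
    apply hne
    simp [heq.1]
  · simp
  · simp

/-! ### The Serre coproduct is a chain map -/

/-- Terms over [0] have the entry `(.zero, .zero)` at `i`, so overwriting it loses no information.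
Thus the coproducts of a cell and of both its faces at `i` can be summed over one index set. -/
theorem sum_serreTerms_update {A : Type*} [AddCommMonoid A] {x y : ι → Cell} {i : ι}
    (hxy : ∀ j, j ≠ i → x j = y j) (hx : x i = .zero) {b : Cell × Cell} (hb : b ∈ (y i).comul)
    (f : (ι → Cell × Cell) → A) :
    ∑ s ∈ serreTerms x, f (Function.update s i b) = ∑ t ∈ (serreTerms y).filter (· i = b), f t := by
  refine Finset.sum_nbij' (fun s => Function.update s i b)
    (fun t => Function.update t i (.zero, .zero)) ?_ ?_ ?_ ?_ ?_
  · intro s hs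
    rw [mem_serreTerms] at hs
    rw [Finset.mem_filter, mem_serreTerms]
    refine ⟨fun j => ?_, by simp⟩
    by_cases hj : j = i
    · subst hj
      simpa using hb
    · simpa [hj, hxy j hj] using hs j
  · intro t ht
    rw [Finset.mem_filter, mem_serreTerms] at ht
    rw [mem_serreTerms]
    intro j
    by_cases hj : j = i
    · subst hj
      simp [hx, Cell.comul]
    · simpa [hj, hxy j hj] using ht.1 j
  · intro s hs
    rw [mem_serreTerms] at hs
    have : s i = (.zero, .zero) := by simpa [hx, Cell.comul] using hs i
    simp [← this]
  · intro t ht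
    rw [Finset.mem_filter] at ht
    simp [← ht.2]
  · intro s _
    rfl

/-- The new interval is in the first factor and meets the second-factor intervals before `i`. In the
companion lemma it is in the second factor and meets the first-factor intervals after `i`. -/
theorem serreSign_update_left {s : ι → Cell × Cell} {i : ι} (hs : s i = (.zero, .zero)) :
    serreSign (Function.update s i (.I, .one)) =
      serreSign s * ∏ p, if p < i ∧ (s p).2 = .I then -1 else 1 := by
  unfold serreSign
  rw [← Finset.prod_mul_distrib]
  refine Finset.prod_congr rfl fun p _ => prod_eq_prod_mul_of_eq_off i _ (fun q hq => ?_) ?_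
  · by_cases hp : p = i
    · subst hp; simp [hq, hs]
    · simp [hq, hp]
  · by_cases hp : p = i
    · subst hp; simp
    · simp [hs, hp]

theorem serreSign_update_right {s : ι → Cell × Cell} {i : ι} (hs : s i = (.zero, .zero)) :
    serreSign (Function.update s i (.zero, .I)) =
      serreSign s * ∏ q, if i < q ∧ (s q).1 = .I then -1 else 1 := by
  unfold serreSign
  refine prod_eq_prod_mul_of_eq_off i _ (fun p hp => Finset.prod_congr rfl fun q _ => ?_) ?_
  · by_cases hq : q = i
    · subst hq; simp [hs, hp]
    · simp [hq, hp]
  · rw [← Finset.prod_mul_distrib]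
    refine Finset.prod_congr rfl fun q _ => ?_
    by_cases hq : q = i
    · subst hq; simp
    · simp [hs, hq]

theorem serreSign_update_one {s : ι → Cell × Cell} {i : ι} (hs : s i = (.zero, .zero)) :
    serreSign (Function.update s i (.one, .one)) = serreSign s := by
  unfold serreSign
  refine Finset.prod_congr rfl fun p _ => Finset.prod_congr rfl fun q _ => ?_
  by_cases hp : p = i <;> by_cases hq : q = i <;> simp [hs, hp, hq]

/-- The terms of the Serre coproduct of the faces of `x` at `i`, and their signs. -/
theorem serreSign_face {x : ι → Cell} {s : ι → Cell × Cell} {i : ι} (hx : x i = .I)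
    (hs : s ∈ serreTerms (Function.update x i .zero)) :
    serreSign (Function.update s i (.I, .one)) *
        faceSign (fun j => (Function.update s i (.I, .one) j).1) i = faceSign x i * serreSign s ∧
    serreSign (Function.update s i (.zero, .I)) *
        (cellSign (fun j => (Function.update s i (.zero, .I) j).1) *
          faceSign (fun j => (Function.update s i (.zero, .I) j).2) i) =
      faceSign x i * serreSign s := by
  rw [mem_serreTerms] at hs
  have hi : s i = (.zero, .zero) := by simpa [Cell.comul] using hs i
  -- Away from `i`, a term sends the interval of `x` to one of the two factors, or there is no
  -- interval at all.
  have hj : ∀ j, j ≠ i → (s j).1 = .I ∧ (s j).2 = .one ∧ x j = .I ∨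
      (s j).1 = .zero ∧ (s j).2 = .I ∧ x j = .I ∨
      (s j).1 ≠ .I ∧ (s j).2 ≠ .I ∧ x j ≠ .I := by
    intro j hj
    have := hs j
    rw [Function.update_of_ne hj, ← Prod.mk.eta (p := s j), Cell.mem_comul_iff] at this
    rcases this with h | h | h | h <;> simp [h]
  rw [serreSign_update_left hi, serreSign_update_right hi, mul_comm (faceSign x i), mul_assoc,
    mul_assoc]
  unfold faceSign cellSign
  constructor
  · congr 1
    rw [← Finset.prod_mul_distrib]
    refine Finset.prod_congr rfl fun j _ => ?_
    by_cases hji : j < i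
    · rcases hj j hji.ne with h | h | h <;> simp [hji, hji.ne, h]
    · simp [hji]
  -- First-factor intervals after `i` occur both in the Serre sign and in `cellSign` and cancel.
  -- Those before `i`, together with the second-factor intervals before `i`, make up `faceSign x i`.
  · congr 1
    rw [← Finset.prod_mul_distrib, ← Finset.prod_mul_distrib]
    refine Finset.prod_congr rfl fun j _ => ?_
    rcases lt_trichotomy j i with hji | hji | hji
    · rcases hj j hji.ne with h | h | h <;> simp [hji, hji.ne, hji.not_gt, h]
    · subst hji; simp
    · rcases hj j hji.ne' with h | h | h <;> simp [hji, hji.ne', hji.not_gt, h]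

/-- The sign involution of the chains of a cube. -/
def cubeSign : CubeChain k ι →ₗ[k] CubeChain k ι :=
  Finsupp.linearCombination k (fun x => cellSign x • cell k x)

theorem cubeSign_cell (x : ι → Cell) : cubeSign k (cell k x) = cellSign x • cell k x := by
  rw [cubeSign, Finsupp.linearCombination_single, one_smul]

/-- The differential of the tensor square of the chains of a cube. -/
def cubeD₂ : CubeChain k ι ⊗[k] CubeChain k ι →ₗ[k] CubeChain k ι ⊗[k] CubeChain k ι :=
  TensorProduct.map (cubeD k ι) LinearMap.id + TensorProduct.map (cubeSign k) (cubeD k ι)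

theorem cubeD₂_cellPair (t : ι → Cell × Cell) : cubeD₂ k (cellPair k t) =
    ∑ i, ((if (t i).1 = .I then faceSign (fun j => (t j).1) i •
        (cellPair k (Function.update t i (.one, (t i).2)) -
          cellPair k (Function.update t i (.zero, (t i).2))) else 0) +
      (if (t i).2 = .I then (cellSign (fun j => (t j).1) * faceSign (fun j => (t j).2) i) •
        (cellPair k (Function.update t i ((t i).1, .one)) -
          cellPair k (Function.update t i ((t i).1, .zero))) else 0)) := by
  have h₁ : ∀ i a, cellPair k (Function.update t i (a, (t i).2)) =
      cell k (Function.update (fun j => (t j).1) i a) ⊗ₜ[k] cell k (fun j => (t j).2) := by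
    intro i a
    unfold cellPair
    congr 2 <;> funext j <;> by_cases hj : j = i
    · subst hj; simp
    · simp [hj]
    · subst hj; simp
    · simp [hj]
  have h₂ : ∀ i a, cellPair k (Function.update t i ((t i).1, a)) =
      cell k (fun j => (t j).1) ⊗ₜ[k] cell k (Function.update (fun j => (t j).2) i a) := by
    intro i a
    unfold cellPair
    congr 2 <;> funext j <;> by_cases hj : j = i
    · subst hj; simp
    · simp [hj]
    · subst hj; simp
    · simp [hj]
  rw [Finset.sum_add_distrib, cubeD₂, LinearMap.add_apply]
  congr 1
  · rw [cellPair, TensorProduct.map_tmul, cubeD_cell, TensorProduct.sum_tmul]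
    refine Finset.sum_congr rfl fun i _ => ?_
    rw [h₁, h₁]
    split_ifs
    · rw [zsmul_tmul, TensorProduct.sub_tmul, LinearMap.id_apply]
    · simp
  · rw [cellPair, TensorProduct.map_tmul, cubeD_cell, TensorProduct.tmul_sum, cubeSign_cell]
    refine Finset.sum_congr rfl fun i _ => ?_
    rw [h₂, h₂]
    split_ifs
    · rw [zsmul_tmul, tmul_zsmul, TensorProduct.tmul_sub, mul_smul]
    · simp

/-- Both sides are sums over coordinates, and they agree for each coordinate separately. There the
identity is that of the interval: [1] ⊗ [1] − [0] ⊗ [0] is the boundary of [0] ⊗ [0,1] + [0,1] ⊗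
[1]. -/
theorem serre_cubeD (c : CubeChain k ι) :
    serre k ι (cubeD k ι c) = cubeD₂ k (serre k ι c) := by
  suffices h : serre k ι ∘ₗ cubeD k ι = cubeD₂ k ∘ₗ serre k ι from LinearMap.congr_fun h c
  refine cubeChain_ext fun x => ?_
  rw [LinearMap.comp_apply, LinearMap.comp_apply, serre_cell, cubeD_cell, map_sum, map_sum]
  simp only [map_zsmul, cubeD₂_cellPair, Finset.smul_sum]
  rw [Finset.sum_comm]
  refine Finset.sum_congr rfl fun i _ => ?_
  by_cases hi : x i = .I
  · rw [if_pos hi, map_zsmul, map_sub, serre_cell, serre_cell]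
    have hone : ∑ t ∈ serreTerms (Function.update x i .one), serreSign t • cellPair k t =
        ∑ s ∈ serreTerms (Function.update x i .zero),
          serreSign s • cellPair k (Function.update s i (.one, .one)) := by
      have := sum_serreTerms_update (x := Function.update x i .zero)
        (y := Function.update x i .one) (i := i) (b := (.one, .one))
        (fun j hj => by simp [hj]) (by simp) (by simp [Cell.comul])
        (fun t => serreSign t • cellPair k t)
      rw [Finset.filter_true_of_mem] at this
      · rw [← this]
        refine Finset.sum_congr rfl fun s hs => ?_
        rw [mem_serreTerms] at hs
        rw [serreSign_update_one]
        simpa [Cell.comul] using hs i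
      · intro t ht
        simpa [Cell.comul] using mem_serreTerms.1 ht i
    -- A term over an interval has `(.I, .one)` or `(.zero, .I)` at `i`; both kinds are indexed by
    -- the terms over the face [0].
    have hI : ∀ f : (ι → Cell × Cell) → CubeChain k ι ⊗[k] CubeChain k ι,
        ∑ t ∈ serreTerms x, f t = ∑ s ∈ serreTerms (Function.update x i .zero),
          (f (Function.update s i (.I, .one)) + f (Function.update s i (.zero, .I))) := by
      intro f
      have h₁ := sum_serreTerms_update (x := Function.update x i .zero)
        (y := x) (i := i) (b := (.I, .one))
        (fun j hj => by simp [hj]) (by simp) (by simp [hi, Cell.comul]) f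
      have h₂ := sum_serreTerms_update (x := Function.update x i .zero)
        (y := x) (i := i) (b := (.zero, .I))
        (fun j hj => by simp [hj]) (by simp) (by simp [hi, Cell.comul]) f
      rw [Finset.sum_add_distrib, h₁, h₂,
        ← Finset.sum_filter_add_sum_filter_not (serreTerms x) (· i = (.I, .one))]
      congr 1
      refine Finset.sum_congr ?_ fun _ _ => rfl
      ext t
      simp only [Finset.mem_filter]
      refine and_congr_right fun ht => ?_
      have := mem_serreTerms.1 ht i
      simp only [hi, Cell.comul, Finset.mem_insert, Finset.mem_singleton] at this
      rcases this with h | h <;> simp [h]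
    rw [hone, hI]
    refine (sum_zsmul_sub_sum _ _ _ (fun s => cellPair k (Function.update s i (.zero, .one)))
      (fun s hs => (serreSign_face hi hs).1) (fun s hs => (serreSign_face hi hs).2)).trans
      (Finset.sum_congr rfl fun s hs => ?_)
    have hsi : s i = (.zero, .zero) := by simpa [Cell.comul] using mem_serreTerms.1 hs i
    have hs0 : Function.update s i (.zero, .zero) = s := by simp [← hsi]
    simp only [Function.update_self, if_true, Function.update_idem, reduceCtorEq, if_false,
      zero_add, add_zero, smul_smul, hs0]
  · rw [if_neg hi, map_zero]
    symm
    -- Where `x` has no interval, neither tensor factor has one, so the tensor boundary has no face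
    -- at `i`.
    refine Finset.sum_eq_zero fun t ht => ?_
    have := mem_serreTerms.1 ht i
    rw [← Prod.mk.eta (p := t i), Cell.mem_comul_iff] at this
    rcases this with h | h | h | h
    · simp [h]
    · simp [h]
    · exact absurd h.1 hi
    · exact absurd h.1 hi

end Cubes

section Cubes

variable (k : Type u) [CommRing k] {ι : Type} [Fintype ι] [LinearOrder ι]
variable {κ : Type} [Fintype κ] [LinearOrder κ]

/-! ### The Serre coproduct is coassociative and counital -/

theorem serre_cell_cast (x : ι → Cell) :
    serre k ι (cell k x) = ∑ t ∈ serreTerms x, (serreSign t : k) • cellPair k t := by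
  rw [serre_cell]
  exact Finset.sum_congr rfl fun t _ => (Int.cast_smul_eq_zsmul k _ _).symm

/-- The cell `c` with `(a, b)` a term of the coproduct of `c`. -/
def Cell.join (a b : Cell) : Cell := if a = b then a else .I

/-- At most one of `c`, `d`, `b` is an interval. Hence a merged cell is recovered by `Cell.join`,
and it is an interval exactly if one of its two parts is. -/
theorem Cell.comul_assoc_cases {x a b c d : Cell} (h₁ : (a, b) ∈ x.comul) (h₂ : (c, d) ∈ a.comul) :
    (c, Cell.join d b) ∈ x.comul ∧ (d, b) ∈ (Cell.join d b).comul ∧ Cell.join c d = a ∧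
      (a = .I ↔ c = .I ∨ d = .I) ∧ (Cell.join d b = .I ↔ d = .I ∨ b = .I) ∧
      ¬ (c = .I ∧ d = .I) ∧ ¬ (c = .I ∧ b = .I) ∧ ¬ (d = .I ∧ b = .I) := by
  rw [Cell.mem_comul_iff] at h₁ h₂
  rcases h₁ with ⟨rfl, rfl, rfl⟩ | ⟨rfl, rfl, rfl⟩ | ⟨rfl, rfl, rfl⟩ | ⟨rfl, rfl, rfl⟩ <;>
    rcases h₂ with ⟨h, rfl, rfl⟩ | ⟨h, rfl, rfl⟩ | ⟨h, rfl, rfl⟩ | ⟨h, rfl, rfl⟩ <;>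
    first
    | exact absurd h (by decide)
    | decide

theorem Cell.comul_assoc_cases' {x a b c d : Cell} (h₁ : (a, b) ∈ x.comul)
    (h₂ : (c, d) ∈ b.comul) :
    (Cell.join a c, d) ∈ x.comul ∧ (a, c) ∈ (Cell.join a c).comul ∧ Cell.join c d = b := by
  rw [Cell.mem_comul_iff] at h₁ h₂
  rcases h₁ with ⟨rfl, rfl, rfl⟩ | ⟨rfl, rfl, rfl⟩ | ⟨rfl, rfl, rfl⟩ | ⟨rfl, rfl, rfl⟩ <;>
    rcases h₂ with ⟨h, rfl, rfl⟩ | ⟨h, rfl, rfl⟩ | ⟨h, rfl, rfl⟩ | ⟨h, rfl, rfl⟩ <;>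
    first
    | exact absurd h (by decide)
    | decide

/-- Both sides run over families of triples of cells, bracketed differently. Either sign counts, for
`p < q`, an interval at `p` in a later tensor factor against an interval at `q` in an earlier one.
-/
theorem serre_coassoc (c : CubeChain k ι) :
    TensorProduct.assoc k _ _ _ (LinearMap.rTensor _ (serre k ι) (serre k ι c)) =
      LinearMap.lTensor _ (serre k ι) (serre k ι c) := by
  have h : (TensorProduct.assoc k _ _ _).toLinearMap ∘ₗ LinearMap.rTensor _ (serre k ι) ∘ₗ
      serre k ι = LinearMap.lTensor _ (serre k ι) ∘ₗ serre k ι := ?_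
  · exact LinearMap.congr_fun h c
  refine cubeChain_ext fun x => ?_
  simp only [LinearMap.comp_apply, LinearEquiv.coe_coe]
  have hl : (TensorProduct.assoc k _ _ _)
      ((LinearMap.rTensor _ (serre k ι)) (serre k ι (cell k x))) =
      ∑ t ∈ serreTerms x, ∑ u ∈ serreTerms (fun i => (t i).1),
        ((serreSign t * serreSign u : ℤ) : k) • (cell k (fun i => (u i).1) ⊗ₜ[k]
          (cell k (fun i => (u i).2) ⊗ₜ[k] cell k (fun i => (t i).2))) := by
    rw [serre_cell_cast, map_sum, map_sum]
    refine Finset.sum_congr rfl fun t _ => ?_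
    rw [map_smul, map_smul, cellPair, LinearMap.rTensor_tmul, serre_cell_cast,
      TensorProduct.sum_tmul, map_sum, Finset.smul_sum]
    refine Finset.sum_congr rfl fun u _ => ?_
    rw [← TensorProduct.smul_tmul', map_smul, cellPair, TensorProduct.assoc_tmul, Int.cast_mul,
      mul_smul]
  have hr : (LinearMap.lTensor _ (serre k ι)) (serre k ι (cell k x)) =
      ∑ t ∈ serreTerms x, ∑ u ∈ serreTerms (fun i => (t i).2),
        ((serreSign t * serreSign u : ℤ) : k) • (cell k (fun i => (t i).1) ⊗ₜ[k]
          (cell k (fun i => (u i).1) ⊗ₜ[k] cell k (fun i => (u i).2))) := by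
    rw [serre_cell_cast, map_sum]
    refine Finset.sum_congr rfl fun t _ => ?_
    rw [map_smul, cellPair, LinearMap.lTensor_tmul, serre_cell_cast, TensorProduct.tmul_sum,
      Finset.smul_sum]
    refine Finset.sum_congr rfl fun u _ => ?_
    rw [TensorProduct.tmul_smul, cellPair, Int.cast_mul, mul_smul]
  rw [hl, hr, Finset.sum_sigma', Finset.sum_sigma']
  refine Finset.sum_nbij'
    (fun a => ⟨fun i => ((a.2 i).1, Cell.join (a.2 i).2 (a.1 i).2),
      fun i => ((a.2 i).2, (a.1 i).2)⟩)
    (fun a => ⟨fun i => (Cell.join (a.1 i).1 (a.2 i).1, (a.2 i).2),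
      fun i => ((a.1 i).1, (a.2 i).1)⟩) ?_ ?_ ?_ ?_ ?_
  · rintro ⟨t, u⟩ h
    simp only [Finset.mem_sigma, mem_serreTerms] at h ⊢
    exact ⟨fun i => (Cell.comul_assoc_cases (h.1 i) (h.2 i)).1,
      fun i => (Cell.comul_assoc_cases (h.1 i) (h.2 i)).2.1⟩
  · rintro ⟨t, u⟩ h
    simp only [Finset.mem_sigma, mem_serreTerms] at h ⊢
    exact ⟨fun i => (Cell.comul_assoc_cases' (h.1 i) (h.2 i)).1,
      fun i => (Cell.comul_assoc_cases' (h.1 i) (h.2 i)).2.1⟩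
  · rintro ⟨t, u⟩ h
    simp only [Finset.mem_sigma, mem_serreTerms] at h
    have := fun i => (Cell.comul_assoc_cases (h.1 i) (h.2 i)).2.2.1
    simp only [this]
  · rintro ⟨t, u⟩ h
    simp only [Finset.mem_sigma, mem_serreTerms] at h
    have := fun i => (Cell.comul_assoc_cases' (h.1 i) (h.2 i)).2.2
    simp only [this]
  · rintro ⟨t, u⟩ h
    simp only [Finset.mem_sigma, mem_serreTerms] at h
    dsimp only
    congr 2
    unfold serreSign
    simp only [← Finset.prod_mul_distrib]
    refine Finset.prod_congr rfl fun p _ => Finset.prod_congr rfl fun q _ => ?_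
    have hp := (Cell.comul_assoc_cases (h.1 p) (h.2 p)).2.2.2
    have hq := (Cell.comul_assoc_cases (h.1 q) (h.2 q)).2.2.2
    by_cases hpq : p < q
    · simp only [hpq, true_and, hp.2.1, hq.1]
      by_cases h₁ : (u p).2 = .I <;> by_cases h₂ : (t p).2 = .I <;>
        by_cases h₃ : (u q).1 = .I <;> by_cases h₄ : (u q).2 = .I <;> simp_all
    · simp [hpq]

/-- The counit of the chains of a cube. -/
def cubeCounit : CubeChain k ι →ₗ[k] k :=
  Finsupp.linearCombination k (fun x => if ∃ i, x i = Cell.I then 0 else 1)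

theorem cubeCounit_cell (x : ι → Cell) :
    cubeCounit k (cell k x) = if ∃ i, x i = Cell.I then 0 else 1 := by
  rw [cubeCounit, Finsupp.linearCombination_single, one_smul]

theorem serre_counit_left (c : CubeChain k ι) :
    TensorProduct.lid k _ (LinearMap.rTensor _ (cubeCounit k) (serre k ι c)) = c := by
  have h : (TensorProduct.lid k _).toLinearMap ∘ₗ LinearMap.rTensor _ (cubeCounit k) ∘ₗ
      serre k ι = LinearMap.id := ?_
  · exact LinearMap.congr_fun h c
  refine cubeChain_ext fun x => ?_
  simp only [LinearMap.comp_apply, LinearEquiv.coe_coe, LinearMap.id_apply]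
  rw [serre_cell, map_sum, map_sum]
  -- The one term without an interval in the first factor puts every interval into the second. Its
  -- sign is trivial, as a Serre sign needs first-factor intervals.
  rw [Finset.sum_eq_single (fun i => if x i = .I then (.zero, .I) else (x i, x i))]
  · rw [map_zsmul, map_zsmul, cellPair, LinearMap.rTensor_tmul, cubeCounit_cell, if_neg,
      TensorProduct.lid_tmul, one_smul, serreSign, Finset.prod_eq_one, one_smul]
    · congr 1
      funext i
      by_cases hi : x i = .I <;> simp [hi]
    · intro p _
      refine Finset.prod_eq_one fun q _ => if_neg ?_
      rintro ⟨_, _, h⟩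
      by_cases hi : x q = .I <;> simp [hi] at h
    · rintro ⟨q, h⟩
      by_cases hi : x q = .I <;> simp [hi] at h
  · intro t ht hne
    rw [map_zsmul, map_zsmul, cellPair, LinearMap.rTensor_tmul, cubeCounit_cell, if_pos,
      TensorProduct.lid_tmul, zero_smul, smul_zero]
    by_contra hI
    refine hne (funext fun i => ?_)
    have := mem_serreTerms.1 ht i
    rw [← Prod.mk.eta (p := t i), Cell.mem_comul_iff] at this
    rcases this with h | h | h | h
    · rw [← Prod.mk.eta (p := t i)]; simp [h]
    · rw [← Prod.mk.eta (p := t i)]; simp [h]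
    · rw [← Prod.mk.eta (p := t i)]; simp [h]
    · exact absurd ⟨i, h.2.1⟩ hI
  · intro h
    refine absurd (mem_serreTerms.2 fun i => ?_) h
    cases hi : x i <;> simp [Cell.comul]

theorem serre_counit_right (c : CubeChain k ι) :
    TensorProduct.rid k _ (LinearMap.lTensor _ (cubeCounit k) (serre k ι c)) = c := by
  have h : (TensorProduct.rid k _).toLinearMap ∘ₗ LinearMap.lTensor _ (cubeCounit k) ∘ₗ
      serre k ι = LinearMap.id := ?_
  · exact LinearMap.congr_fun h c
  refine cubeChain_ext fun x => ?_
  simp only [LinearMap.comp_apply, LinearEquiv.coe_coe, LinearMap.id_apply]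
  rw [serre_cell, map_sum, map_sum]
  -- Mirror image: all intervals stay in the first factor, leaving the vertex [1] in the second.
  rw [Finset.sum_eq_single (fun i => if x i = .I then (.I, .one) else (x i, x i))]
  · rw [map_zsmul, map_zsmul, cellPair, LinearMap.lTensor_tmul, cubeCounit_cell, if_neg,
      TensorProduct.rid_tmul, one_smul, serreSign, Finset.prod_eq_one, one_smul]
    · congr 1
      funext i
      by_cases hi : x i = .I <;> simp [hi]
    · intro p _
      refine Finset.prod_eq_one fun q _ => if_neg ?_
      rintro ⟨_, h, _⟩
      by_cases hi : x p = .I <;> simp [hi] at h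
    · rintro ⟨q, h⟩
      by_cases hi : x q = .I <;> simp [hi] at h
  · intro t ht hne
    rw [map_zsmul, map_zsmul, cellPair, LinearMap.lTensor_tmul, cubeCounit_cell, if_pos,
      TensorProduct.rid_tmul, zero_smul, smul_zero]
    by_contra hI
    refine hne (funext fun i => ?_)
    have := mem_serreTerms.1 ht i
    rw [← Prod.mk.eta (p := t i), Cell.mem_comul_iff] at this
    rcases this with h | h | h | h
    · rw [← Prod.mk.eta (p := t i)]; simp [h]
    · rw [← Prod.mk.eta (p := t i)]; simp [h]
    · exact absurd ⟨i, h.2.2⟩ hI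
    · rw [← Prod.mk.eta (p := t i)]; simp [h]
  · intro h
    refine absurd (mem_serreTerms.2 fun i => ?_) h
    cases hi : x i <;> simp [Cell.comul]

/-! ### Faces of cubes -/

theorem lmapDomain_cell (f : (ι → Cell) → (κ → Cell)) (x : ι → Cell) :
    Finsupp.lmapDomain k k f (cell k x) = cell k (f x) := Finsupp.mapDomain_single

section Extend

variable {f : ι → κ} {z : κ → Cell}

theorem update_extend (hf : Function.Injective f) (x : ι → Cell) (i : ι) (b : Cell) :
    Function.update (Function.extend f x z) (f i) b =
      Function.extend f (Function.update x i b) z := by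
  funext j
  by_cases hj : ∃ a, f a = j
  · obtain ⟨a, rfl⟩ := hj
    rw [hf.extend_apply]
    by_cases ha : a = i
    · subst ha; simp
    · rw [Function.update_of_ne (hf.ne ha), Function.update_of_ne ha, hf.extend_apply]
  · rw [Function.extend_apply' _ _ _ hj, Function.update_of_ne, Function.extend_apply' _ _ _ hj]
    rintro rfl
    exact hj ⟨i, rfl⟩

theorem faceSign_extend (hf : StrictMono f) (hz : ∀ j, j ∉ Set.range f → z j ≠ .I)
    (x : ι → Cell) (i : ι) : faceSign (Function.extend f x z) (f i) = faceSign x i := by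
  symm
  refine Fintype.prod_of_injective f hf.injective _ _ (fun j hj => ?_) (fun j => ?_)
  · rw [Function.extend_apply' _ _ _ hj]
    simp [hz j hj]
  · simp only [hf.injective.extend_apply, hf.lt_iff_lt]

/-- Cells of the small cube are placed in a face of the large one. Outside the range sit vertices of
the interval, which contribute neither faces nor signs, and strict monotonicity preserves the order
on which the signs depend. -/
theorem cubeD_extend (hf : StrictMono f) (hz : ∀ j, j ∉ Set.range f → z j ≠ .I)
    (x : ι → Cell) : cubeD k κ (cell k (Function.extend f x z)) =
      Finsupp.lmapDomain k k (fun x => Function.extend f x z) (cubeD k ι (cell k x)) := by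
  rw [cubeD_cell, cubeD_cell, map_sum]
  symm
  refine Fintype.sum_of_injective f hf.injective _ _ (fun j hj => ?_) (fun j => ?_)
  · rw [Function.extend_apply' _ _ _ hj, if_neg (hz j hj)]
  · rw [hf.injective.extend_apply, faceSign_extend hf hz, update_extend hf.injective,
      update_extend hf.injective]
    split_ifs
    · rw [map_zsmul, map_sub, lmapDomain_cell, lmapDomain_cell]
    · rw [map_zero]

theorem serreSign_extend (hf : StrictMono f) (hz : ∀ j, j ∉ Set.range f → z j ≠ .I)
    (t : ι → Cell × Cell) :
    serreSign (Function.extend f t (fun j => (z j, z j))) = serreSign t := by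
  symm
  refine Fintype.prod_of_injective f hf.injective _ _ (fun j hj => ?_) (fun i => ?_)
  · rw [Function.extend_apply' _ _ _ hj]
    simp [hz j hj]
  · refine Fintype.prod_of_injective f hf.injective _ _ (fun j hj => ?_) (fun j => ?_)
    · rw [Function.extend_apply' _ _ _ hj]
      simp [hz j hj]
    · simp only [hf.injective.extend_apply, hf.lt_iff_lt]

theorem cellPair_extend (hf : Function.Injective f) (t : ι → Cell × Cell) :
    cellPair k (Function.extend f t (fun j => (z j, z j))) =
      TensorProduct.map (Finsupp.lmapDomain k k (fun x => Function.extend f x z))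
        (Finsupp.lmapDomain k k (fun x => Function.extend f x z)) (cellPair k t) := by
  unfold cellPair
  rw [TensorProduct.map_tmul, Finsupp.lmapDomain_apply, Finsupp.lmapDomain_apply,
    Finsupp.mapDomain_single, Finsupp.mapDomain_single]
  congr 2 <;> funext j <;> by_cases hj : ∃ a, f a = j
  · obtain ⟨a, rfl⟩ := hj
    rw [hf.extend_apply, hf.extend_apply]
  · rw [Function.extend_apply' _ _ _ hj, Function.extend_apply' _ _ _ hj]
  · obtain ⟨a, rfl⟩ := hj
    rw [hf.extend_apply, hf.extend_apply]
  · rw [Function.extend_apply' _ _ _ hj, Function.extend_apply' _ _ _ hj]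

/-- A vertex of the interval has only the diagonal term in its coproduct, so terms extend uniquely
from the small cube to the large one, with unchanged sign. -/
theorem serre_extend (hf : StrictMono f) (hz : ∀ j, j ∉ Set.range f → z j ≠ .I)
    (x : ι → Cell) : serre k κ (cell k (Function.extend f x z)) =
      TensorProduct.map (Finsupp.lmapDomain k k (fun x => Function.extend f x z))
        (Finsupp.lmapDomain k k (fun x => Function.extend f x z)) (serre k ι (cell k x)) := by
  rw [serre_cell, serre_cell, map_sum]
  symm
  have hzz : ∀ j, j ∉ Set.range f → (z j).comul = {(z j, z j)} := by
    intro j hj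
    have := hz j hj
    cases h : z j with
    | I => exact absurd h this
    | _ => rfl
  refine Finset.sum_nbij' (fun t => Function.extend f t (fun j => (z j, z j))) (fun t => t ∘ f)
    ?_ ?_ ?_ ?_ ?_
  · intro t ht
    rw [mem_serreTerms] at ht ⊢
    intro j
    by_cases hj : ∃ a, f a = j
    · obtain ⟨a, rfl⟩ := hj
      rw [hf.injective.extend_apply, hf.injective.extend_apply]
      exact ht a
    · rw [Function.extend_apply' _ _ _ hj, Function.extend_apply' _ _ _ hj, hzz j hj]
      simp
  · intro t ht
    rw [mem_serreTerms] at ht ⊢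
    intro i
    simpa [hf.injective.extend_apply] using ht (f i)
  · intro t _
    funext i
    simp [hf.injective.extend_apply]
  · intro t ht
    rw [mem_serreTerms] at ht
    funext j
    by_cases hj : ∃ a, f a = j
    · obtain ⟨a, rfl⟩ := hj
      rw [hf.injective.extend_apply]
      rfl
    · have := ht j
      rw [Function.extend_apply' _ _ _ hj, hzz j hj, Finset.mem_singleton] at this
      rw [Function.extend_apply' _ _ _ hj, this]
  · intro t _
    rw [serreSign_extend hf hz, cellPair_extend k hf.injective, map_zsmul]

end Extend

/-! ### Products of cubes -/

/-- The dimension of a cell. -/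
def cellDim (x : ι → Cell) : ℕ := (Finset.univ.filter (x · = .I)).card

theorem cellSign_eq (x : ι → Cell) : cellSign x = (-1) ^ cellDim x :=
  (neg_one_pow_card_filter _).symm

section Append

variable {a b : ℕ}

theorem castAdd_lt_castAdd (i j : Fin a) : Fin.castAdd b i < Fin.castAdd b j ↔ i < j := Iff.rfl

theorem castAdd_lt_natAdd (i : Fin a) (j : Fin b) : Fin.castAdd b i < Fin.natAdd a j :=
  Fin.lt_def.2 (by simp; omega)

theorem faceSign_append_left (x : Fin a → Cell) (y : Fin b → Cell) (i : Fin a) :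
    faceSign (Fin.append x y) (Fin.castAdd b i) = faceSign x i := by
  unfold faceSign
  rw [Fin.prod_univ_add, Finset.prod_eq_one (f := fun j : Fin b => _), mul_one]
  · simp [castAdd_lt_castAdd]
  · intro j _
    refine if_neg fun h => ?_
    have := Fin.lt_def.1 h.1
    simp at this
    omega

theorem faceSign_append_right (x : Fin a → Cell) (y : Fin b → Cell) (i : Fin b) :
    faceSign (Fin.append x y) (Fin.natAdd a i) = cellSign x * faceSign y i := by
  unfold faceSign cellSign
  rw [Fin.prod_univ_add]
  congr 1
  · refine Finset.prod_congr rfl fun j _ => ?_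
    have : Fin.castAdd b j < Fin.natAdd a i := castAdd_lt_natAdd _ _
    simp [this]
  · simp

/-- Every interval of the second block is preceded by all intervals of the first, whence the factor
`cellSign x` of the Leibniz rule. -/
theorem cubeD_append (x : Fin a → Cell) (y : Fin b → Cell) :
    cubeD k (Fin (a + b)) (cell k (Fin.append x y)) =
      Finsupp.lmapDomain k k (fun x' => Fin.append x' y) (cubeD k (Fin a) (cell k x)) +
      cellSign x • Finsupp.lmapDomain k k (fun y' => Fin.append x y')
        (cubeD k (Fin b) (cell k y)) := by
  have hl : ∀ (i : Fin a) c, Function.update (Fin.append x y) (Fin.castAdd b i) c =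
      Fin.append (Function.update x i c) y := by
    intro i c
    funext j
    induction j using Fin.addCases with
    | left j =>
      by_cases hj : j = i
      · subst hj; simp
      · rw [Function.update_of_ne (fun h => hj (Fin.castAdd_injective _ _ h))]
        simp [hj]
    | right j =>
      rw [Function.update_of_ne (castAdd_lt_natAdd _ _).ne']
      simp
  have hr : ∀ (i : Fin b) c, Function.update (Fin.append x y) (Fin.natAdd a i) c =
      Fin.append x (Function.update y i c) := by
    intro i c
    funext j
    induction j using Fin.addCases with
    | left j =>
      rw [Function.update_of_ne (castAdd_lt_natAdd _ _).ne]
      simp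
    | right j =>
      by_cases hj : j = i
      · subst hj; simp
      · rw [Function.update_of_ne (fun h => hj (Fin.natAdd_injective _ _ h))]
        simp [hj]
  rw [cubeD_cell, cubeD_cell, cubeD_cell, Fin.sum_univ_add, map_sum, map_sum, Finset.smul_sum]
  congr 1
  · refine Finset.sum_congr rfl fun i _ => ?_
    rw [hl, hl, faceSign_append_left, Fin.append_left]
    split_ifs
    · rw [map_zsmul, map_sub, lmapDomain_cell, lmapDomain_cell]
    · rw [map_zero]
  · refine Finset.sum_congr rfl fun i _ => ?_
    rw [hr, hr, faceSign_append_right, Fin.append_right]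
    split_ifs
    · rw [map_zsmul, map_sub, lmapDomain_cell, lmapDomain_cell, mul_smul]
    · rw [map_zero, smul_zero]

/-- Pairs inside a block give the two Serre signs. Pairs across the blocks are always in increasing
order, so each second-factor interval of `t` meets each first-factor interval of `u`: the Koszul
sign of the middle exchange. -/
theorem serreSign_append (t : Fin a → Cell × Cell) (u : Fin b → Cell × Cell) :
    serreSign (Fin.append t u) = serreSign t * serreSign u *
      (-1) ^ (cellDim (fun i => (t i).2) * cellDim (fun i => (u i).1)) := by
  have h : (-1 : ℤ) ^ (cellDim (fun i => (t i).2) * cellDim (fun i => (u i).1)) =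
      ∏ p, ∏ q, if (t p).2 = .I ∧ (u q).1 = .I then -1 else 1 := by
    rw [mul_comm, pow_mul, ← cellSign_eq]
    have : ∀ p, (∏ q, if (t p).2 = .I ∧ (u q).1 = .I then (-1 : ℤ) else 1) =
        if (t p).2 = .I then cellSign (fun i => (u i).1) else 1 := by
      intro p
      by_cases hp : (t p).2 = .I <;> simp [hp, cellSign]
    simp only [this]
    rw [Finset.prod_ite, Finset.prod_const, Finset.prod_const_one, mul_one]
    rfl
  rw [h]
  unfold serreSign
  rw [Fin.prod_univ_add]
  have h₁ : ∀ p, (∏ q, if Fin.castAdd b p < q ∧ (Fin.append t u (Fin.castAdd b p)).2 = .I ∧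
      (Fin.append t u q).1 = .I then (-1 : ℤ) else 1) =
      (∏ q, if p < q ∧ (t p).2 = .I ∧ (t q).1 = .I then -1 else 1) *
        ∏ q, if (t p).2 = .I ∧ (u q).1 = .I then -1 else 1 := by
    intro p
    rw [Fin.prod_univ_add]
    congr 1
    · simp [castAdd_lt_castAdd]
    · refine Finset.prod_congr rfl fun q _ => ?_
      have : Fin.castAdd b p < Fin.natAdd a q := castAdd_lt_natAdd _ _
      simp [this]
  have h₂ : ∀ p, (∏ q, if Fin.natAdd a p < q ∧ (Fin.append t u (Fin.natAdd a p)).2 = .I ∧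
      (Fin.append t u q).1 = .I then (-1 : ℤ) else 1) =
      ∏ q, if p < q ∧ (u p).2 = .I ∧ (u q).1 = .I then -1 else 1 := by
    intro p
    rw [Fin.prod_univ_add, Finset.prod_eq_one (f := fun j : Fin a => _), one_mul]
    · simp
    · intro q _
      have : ¬ Fin.natAdd a p < Fin.castAdd b q := (castAdd_lt_natAdd _ _).not_gt
      simp [this]
  simp only [h₁, h₂, Finset.prod_mul_distrib]
  ring

theorem sum_serreTerms_append {A : Type*} [AddCommMonoid A] (x : Fin a → Cell) (y : Fin b → Cell)
    (f : (Fin (a + b) → Cell × Cell) → A) :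
    ∑ t ∈ serreTerms (Fin.append x y), f t =
      ∑ t ∈ serreTerms x, ∑ u ∈ serreTerms y, f (Fin.append t u) := by
  rw [← Finset.sum_product']
  symm
  refine Finset.sum_nbij' (fun q => Fin.append q.1 q.2)
    (fun t => (fun i => t (Fin.castAdd b i), fun i => t (Fin.natAdd a i))) ?_ ?_ ?_ ?_ ?_
  · rintro ⟨t, u⟩ h
    simp only [Finset.mem_product, mem_serreTerms] at h ⊢
    intro i
    induction i using Fin.addCases with
    | left i => simpa using h.1 i
    | right i => simpa using h.2 i
  · intro t h
    simp only [Finset.mem_product, mem_serreTerms] at h ⊢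
    exact ⟨fun i => by simpa using h (Fin.castAdd b i), fun i => by simpa using h (Fin.natAdd a i)⟩
  · rintro ⟨t, u⟩ _
    simp
  · intro t _
    funext i
    induction i using Fin.addCases <;> simp
  · intro q _
    rfl

end Append

/-! ### Changes of order -/

/-- The sign of the permutation of the intervals in a cell. -/
def permSign (e : ι ≃ κ) (x : ι → Cell) : ℤ :=
  ∏ p, ∏ q, if (p < q ∧ e q < e p) ∧ x p = .I ∧ x q = .I then -1 else 1

/-- Each interval of `x` lies in exactly one factor. An inverted pair within one factor is counted
by the permutation sign of that factor, and an inverted pair from different factors by the change of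
the Serre sign. -/
theorem serreSign_comp_symm (e : ι ≃ κ) {x : ι → Cell} {t : ι → Cell × Cell}
    (ht : t ∈ serreTerms x) :
    serreSign (t ∘ e.symm) * (permSign e (fun i => (t i).1) * permSign e (fun i => (t i).2)) =
      permSign e x * serreSign t := by
  have h : serreSign (t ∘ e.symm) =
      ∏ p, ∏ q, if e p < e q ∧ (t p).2 = .I ∧ (t q).1 = .I then -1 else 1 := by
    unfold serreSign
    rw [← e.prod_comp]
    refine Finset.prod_congr rfl fun p _ => ?_
    rw [← e.prod_comp]
    simp
  rw [h]
  unfold serreSign permSign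
  simp only [← Finset.prod_mul_distrib]
  have hc : ∀ j, (t j).1 = .I ∧ (t j).2 ≠ .I ∧ x j = .I ∨
      (t j).1 ≠ .I ∧ (t j).2 = .I ∧ x j = .I ∨
      (t j).1 ≠ .I ∧ (t j).2 ≠ .I ∧ x j ≠ .I := by
    intro j
    have := mem_serreTerms.1 ht j
    rw [← Prod.mk.eta (p := t j), Cell.mem_comul_iff] at this
    rcases this with h | h | h | h <;> simp [h]
  refine prod_prod_eq_of_symm (fun p => by simp) (fun p q hpq => ?_)
  have hne : e p ≠ e q := e.injective.ne hpq.ne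
  rcases lt_or_gt_of_ne hne with he | he <;>
    rcases hc p with h₁ | h₁ | h₁ <;> rcases hc q with h₂ | h₂ | h₂ <;>
    simp [hpq, hpq.not_gt, he, he.not_gt, h₁, h₂]

end Cubes

/-! ### Degrees and faces of ordered graphs -/

namespace OGraph

variable {m m' n n' p : ℕ}

/-- The cell of the cube on all vertices that corresponds to the graph itself. -/
def top (Γ : OGraph m n) : Fin Γ.N → Cell := fun v => if Γ.IsProd v then .I else .zero

theorem top_eq_I {Γ : OGraph m n} {v : Fin Γ.N} : Γ.top v = .I ↔ Γ.IsProd v := by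
  unfold top
  split_ifs with h
  · exact iff_of_true rfl h
  · exact iff_of_false (by simp) h

/-- A cell of the cube on all vertices which is an interval at product vertices only. -/
def Valid (Γ : OGraph m n) (c : Fin Γ.N → Cell) : Prop := ∀ v, c v = .I → Γ.IsProd v

theorem valid_top (Γ : OGraph m n) : Γ.Valid Γ.top := fun _ => top_eq_I.1

theorem face_congr (Γ : OGraph m n) {c c' : Fin Γ.N → Cell}
    (h : ∀ v, Γ.IsProd v → c v = c' v) : Γ.face c = Γ.face c' := by
  unfold face
  rw [Graph.face_congr Γ.graph h]

theorem face_eq_self (Γ : OGraph m n) {c : Fin Γ.N → Cell} (h : ∀ v, Γ.IsProd v → c v = .I) :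
    Γ.face c = Γ := by
  rw [Γ.face_congr (c' := fun _ => .I) h, face, Graph.face_I]

theorem face_top (Γ : OGraph m n) : Γ.face Γ.top = Γ := Γ.face_eq_self fun _ => top_eq_I.2

theorem isProd_face {Γ : OGraph m n} {c : Fin Γ.N → Cell} {v : Fin Γ.N} :
    (Γ.face c).IsProd v ↔ c v = .I ∧ Γ.IsProd v := by
  change (Γ.graph.kind v).face (c v) = .product ↔ c v = .I ∧ Γ.graph.kind v = .product
  cases c v <;> cases Γ.graph.kind v <;> simp [Gen.face]

theorem degree_eq (Γ : OGraph m n) : Γ.degree = cellDim Γ.top := by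
  unfold degree cellDim
  rw [Fintype.card_subtype]
  congr 1
  ext v
  simp [top_eq_I]

theorem degree_face {Γ : OGraph m n} {c : Fin Γ.N → Cell} (h : Γ.Valid c) :
    (Γ.face c).degree = cellDim c :=
  (Fintype.card_congr ((Equiv.refl (Fin Γ.N)).subtypeEquiv fun v =>
    isProd_face.trans ⟨fun h => h.1, fun h' => ⟨h', h v h'⟩⟩)).trans (Fintype.card_subtype _)

/-- Cells at vertices that are not products are ignored, so the filling `z` is free. It will be
chosen so that no new intervals appear. -/
theorem cubeFace_eq (Γ : OGraph m n) (x : Γ.Prods → Cell) (z : Fin Γ.N → Cell) :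
    Γ.cubeFace x = Γ.face (Function.extend Subtype.val x z) := by
  refine Γ.face_congr fun v hv => ?_
  rw [dif_pos hv]
  exact (Subtype.val_injective.extend_apply x z ⟨v, hv⟩).symm

/-- The inclusion of the product vertices of a face. -/
def faceVal (Γ : OGraph m n) (c : Fin Γ.N → Cell) : (Γ.face c).Prods → Fin Γ.N := Subtype.val

theorem faceVal_strictMono (Γ : OGraph m n) (c : Fin Γ.N → Cell) : StrictMono (Γ.faceVal c) :=
  Subtype.strictMono_coe _

theorem isProd_faceVal (Γ : OGraph m n) (c : Fin Γ.N → Cell) (a : (Γ.face c).Prods) :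
    c (Γ.faceVal c a) = .I :=
  (isProd_face.1 a.2).1

/-- The product vertices of a face are product vertices at which `c` is an interval, so `x` refines
`c` there. Faces of a face graph thus correspond to cells in a face of the cube. -/
theorem cubeFace_face (Γ : OGraph m n) (c : Fin Γ.N → Cell) (x : (Γ.face c).Prods → Cell) :
    (Γ.face c).cubeFace x = Γ.face (Function.extend (Γ.faceVal c) x c) := by
  refine ((Γ.face c).cubeFace_eq x c).trans (congrArg (OGraph.mk Γ.N)
    ((Graph.face_face Γ.graph c _).trans (congrArg (fun c => Γ.graph.face c) ?_)))
  funext v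
  split_ifs with h
  · rfl
  · rw [Function.extend_apply']
    rintro ⟨a, rfl⟩
    exact h (Γ.isProd_faceVal c a)

theorem extend_top {Γ : OGraph m n} (c : Fin Γ.N → Cell) :
    Function.extend (Γ.faceVal c) (fun _ => Cell.I) c = c := by
  funext v
  by_cases hv : ∃ a, Γ.faceVal c a = v
  · obtain ⟨a, rfl⟩ := hv
    rw [(Γ.faceVal_strictMono c).injective.extend_apply, Γ.isProd_faceVal c]
  · rw [Function.extend_apply' _ _ _ hv]

theorem Valid.ne_I {Γ : OGraph m n} {c : Fin Γ.N → Cell} (h : Γ.Valid c) (v : Fin Γ.N)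
    (hv : v ∉ Set.range (Γ.faceVal c)) : c v ≠ .I :=
  fun hc => hv ⟨⟨v, isProd_face.2 ⟨hc, h v hc⟩⟩, rfl⟩

theorem top_ne_I {Γ : OGraph m n} (v : Fin Γ.N)
    (hv : v ∉ Set.range (Subtype.val : Γ.Prods → _)) : Γ.top v ≠ .I :=
  fun hc => hv ⟨⟨v, top_eq_I.1 hc⟩, rfl⟩

theorem valid_extend (Γ : OGraph m n) (x : Γ.Prods → Cell) :
    Γ.Valid (Function.extend Subtype.val x Γ.top) := by
  intro v hv
  by_cases h : ∃ a : Γ.Prods, a.1 = v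
  · obtain ⟨a, rfl⟩ := h
    exact a.2
  · rw [Function.extend_apply' _ _ _ h] at hv
    exact top_eq_I.1 hv

theorem degree_cubeFace (Γ : OGraph m n) (x : Γ.Prods → Cell) :
    (Γ.cubeFace x).degree = cellDim x := by
  rw [cubeFace_eq Γ x Γ.top, degree_face (Γ.valid_extend x)]
  unfold cellDim
  rw [Finset.card_filter, Finset.card_filter]
  symm
  refine Fintype.sum_of_injective Subtype.val Subtype.val_injective _ _ (fun v hv => ?_)
    (fun v => ?_)
  · have := top_ne_I v hv
    rw [Function.extend_apply' _ _ _ hv, if_neg this]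
  · rw [Subtype.val_injective.extend_apply]

theorem cubeFace_top (Γ : OGraph m n) : Γ.cubeFace (fun _ => .I) = Γ := by
  rw [cubeFace]
  exact Γ.face_eq_self fun v hv => dif_pos hv

theorem cubeFace_relabel (e : Fin m ≃ Fin m') (f : Fin n ≃ Fin n') (Γ : OGraph m n)
    (x : Γ.Prods → Cell) : (Γ.relabel e f).cubeFace x = (Γ.cubeFace x).relabel e f := by
  change OGraph.mk _ _ = OGraph.mk _ _
  rw [OGraph.mk.injEq]
  exact ⟨rfl, heq_of_eq (Graph.face_relabel e f Γ.graph _)⟩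

theorem reorderSign_eq (Γ : OGraph m n) {N' : ℕ} (e : Fin Γ.N ≃ Fin N') :
    Γ.reorderSign e = permSign e Γ.top := by
  unfold reorderSign permSign
  rw [neg_one_pow_card_filter, Fintype.prod_prod_type]
  refine Fintype.prod_of_injective Subtype.val Subtype.val_injective _ _ (fun v hv => ?_)
    (fun v => ?_)
  · simp [top_ne_I v hv]
  · refine Fintype.prod_of_injective Subtype.val Subtype.val_injective _ _ (fun w hw => ?_)
      (fun w => ?_)
    · simp [top_ne_I w hw]
    · simp [top_eq_I.2 v.2, top_eq_I.2 w.2]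

theorem degree_reorder (Γ : OGraph m n) {N' : ℕ} (e : Fin Γ.N ≃ Fin N') :
    (Γ.reorder e).degree = Γ.degree :=
  Fintype.card_congr (e.symm.subtypeEquiv fun _ => Iff.rfl)

theorem face_reorder (Γ : OGraph m n) {N' : ℕ} (e : Fin Γ.N ≃ Fin N') (c : Fin Γ.N → Cell) :
    (Γ.reorder e).face (c ∘ e.symm) = (Γ.face c).reorder e := by
  refine congrArg (OGraph.mk N') ((Graph.face_reindex e Γ.graph (c ∘ e.symm)).trans ?_)
  congr 2
  funext v
  simp

end OGraph

/-! ### Joining two graphs -/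

section Join

variable {a b c d m n : ℕ}

/-- A way to join two graphs into one, with the union of their vertices as vertices. -/
structure Joining (a b c d m n : ℕ) where
  graph : ∀ (x : OGraph a b) (y : OGraph c d), Graph (Fin x.N ⊕ Fin y.N) m n
  kind_eq : ∀ x y, (graph x y).kind = Sum.elim x.graph.kind y.graph.kind
  face_eq : ∀ (x : OGraph a b) (y : OGraph c d) (s : Fin x.N → Cell) (t : Fin y.N → Cell),
    (graph x y).face (Sum.elim s t) = graph (x.face s) (y.face t)

/-- The joined graph, the vertices of `x` coming first. -/
def Joining.join (J : Joining a b c d m n) (x : OGraph a b) (y : OGraph c d) : OGraph m n :=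
  ⟨x.N + y.N, (J.graph x y).reindex finSumFinEquiv⟩

/-- Grafting. -/
def vJoining (m n p : ℕ) : Joining n p m n m p where
  graph x y := x.graph.vcomp y.graph
  kind_eq _ _ := rfl
  face_eq x y := Graph.face_vcomp x.graph y.graph

/-- Disjoint union. -/
def hJoining (m n m' n' : ℕ) : Joining m n m' n' (m + m') (n + n') where
  graph x y := x.graph.hcomp y.graph
  kind_eq _ _ := rfl
  face_eq x y := Graph.face_hcomp x.graph y.graph

namespace Joining

variable (J : Joining a b c d m n) (x : OGraph a b) (y : OGraph c d)

theorem face_join (s : Fin x.N → Cell) (t : Fin y.N → Cell) :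
    (J.join x y).face (Fin.append s t) = J.join (x.face s) (y.face t) := by
  change OGraph.mk (x.N + y.N) (((J.graph x y).reindex finSumFinEquiv).face _) =
    OGraph.mk (x.N + y.N) ((J.graph (x.face s) (y.face t)).reindex finSumFinEquiv)
  rw [Graph.face_reindex, ← J.face_eq]
  congr 3
  funext v
  rcases v with v | v <;> simp

theorem isProd_join_castAdd (v : Fin x.N) :
    (J.join x y).IsProd (Fin.castAdd y.N v) ↔ x.IsProd v := by
  change (J.graph x y).kind (finSumFinEquiv.symm _) = _ ↔ _
  rw [finSumFinEquiv_symm_apply_castAdd, J.kind_eq]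
  rfl

theorem isProd_join_natAdd (v : Fin y.N) :
    (J.join x y).IsProd (Fin.natAdd x.N v) ↔ y.IsProd v := by
  change (J.graph x y).kind (finSumFinEquiv.symm _) = _ ↔ _
  rw [finSumFinEquiv_symm_apply_natAdd, J.kind_eq]
  rfl

theorem top_join : (J.join x y).top = Fin.append x.top y.top := by
  funext v
  change (if _ then _ else _) = _
  induction v using Fin.addCases with
  | left v => simp only [isProd_join_castAdd, Fin.append_left]; rfl
  | right v => simp only [isProd_join_natAdd, Fin.append_right]; rfl

theorem degree_join : (J.join x y).degree = x.degree + y.degree := by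
  rw [OGraph.degree_eq, OGraph.degree_eq, OGraph.degree_eq, J.top_join]
  unfold cellDim
  simp only [Finset.card_filter]
  refine (Fin.sum_univ_add _).trans ?_
  simp

end Joining

end Join

/-! ### Operations on `M` -/

section Operations

variable (k : Type u) [CommRing k] {m m' m'' n n' n'' p p' q : ℕ}

/-- The differential of `M`. -/
def Md (m n : ℕ) : MHom k m n →ₗ[k] MHom k m n :=
  (ideal k m n).mapQ (ideal k m n) (freeD k) (fun _ h => InIdeal.d h)

/-- The relabellings of `M`. -/
def Mrelabel (e : Fin m ≃ Fin m') (f : Fin n ≃ Fin n') : MHom k m n →ₗ[k] MHom k m' n' :=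
  (ideal k _ _).mapQ (ideal k _ _) (freeRelabel k e f) (fun _ h => InIdeal.relabel e f h)

/-- The vertical composition of `M`. -/
def Mvcomp (m n p : ℕ) : MHom k n p →ₗ[k] MHom k m n →ₗ[k] MHom k m p :=
  bilinQ k _ _ _ (freeVcomp k m n p) (fun _ h y => InIdeal.vcomp_left h y)
    (fun x _ h => InIdeal.vcomp_right x h)

/-- The horizontal composition of `M`. -/
def Mhcomp (m n m' n' : ℕ) :
    MHom k m n →ₗ[k] MHom k m' n' →ₗ[k] MHom k (m + m') (n + n') :=
  bilinQ k _ _ _ (freeHcomp k m n m' n') (fun _ h y => InIdeal.hcomp_left h y)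
    (fun x _ h => InIdeal.hcomp_right x h)

theorem Md_mkQ (x : FreeMod k m n) :
    Md k m n ((ideal k m n).mkQ x) = (ideal k m n).mkQ (freeD k x) := rfl

theorem Mrelabel_cls (e : Fin m ≃ Fin m') (f : Fin n ≃ Fin n') (Γ : OGraph m n) :
    Mrelabel k e f (cls k Γ) = cls k (Γ.relabel e f) := by
  change (ideal k m' n').mkQ (freeRelabel k e f (ofGraph k Γ)) = _
  simp [freeRelabel, cls, ofGraph]

theorem freeVcomp_ofGraph (x : OGraph n p) (y : OGraph m n) :
    freeVcomp k m n p (ofGraph k x) (ofGraph k y) = ofGraph k (x.vcomp y) := by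
  simp [freeVcomp, ofGraph]

theorem freeHcomp_ofGraph (x : OGraph m n) (y : OGraph m' n') :
    freeHcomp k m n m' n' (ofGraph k x) (ofGraph k y) = ofGraph k (x.hcomp y) := by
  simp [freeHcomp, ofGraph]

theorem Mvcomp_cls (x : OGraph n p) (y : OGraph m n) :
    Mvcomp k m n p (cls k x) (cls k y) = cls k (x.vcomp y) := by
  change (ideal k m p).mkQ (freeVcomp k m n p (ofGraph k x) (ofGraph k y)) = _
  rw [freeVcomp_ofGraph]
  rfl

theorem Mhcomp_cls (x : OGraph m n) (y : OGraph m' n') :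
    Mhcomp k m n m' n' (cls k x) (cls k y) = cls k (x.hcomp y) := by
  change (ideal k _ _).mkQ (freeHcomp k m n m' n' (ofGraph k x) (ofGraph k y)) = _
  rw [freeHcomp_ofGraph]
  rfl

variable {k}

theorem freeMod_ext {A : Type*} [AddCommMonoid A] [Module k A] {f g : FreeMod k m n →ₗ[k] A}
    (h : ∀ Γ, f (ofGraph k Γ) = g (ofGraph k Γ)) : f = g :=
  Finsupp.lhom_ext' fun Γ => LinearMap.ext_ring (h Γ)

theorem MHom_ext {A : Type*} [AddCommMonoid A] [Module k A] {f g : MHom k m n →ₗ[k] A}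
    (h : ∀ Γ, f (cls k Γ) = g (cls k Γ)) : f = g :=
  LinearMap.ext fun x => by
    obtain ⟨x, rfl⟩ := (ideal k m n).mkQ_surjective x
    exact LinearMap.congr_fun
      (freeMod_ext (f := f ∘ₗ (ideal k m n).mkQ) (g := g ∘ₗ (ideal k m n).mkQ) h) x

theorem MHom_induction {P : MHom k m n → Prop} (x : MHom k m n) (hc : ∀ Γ, P (cls k Γ))
    (hz : P 0) (ha : ∀ x y, P x → P y → P (x + y)) (hs : ∀ (c : k) x, P x → P (c • x)) : P x := by
  obtain ⟨x, rfl⟩ := (ideal k m n).mkQ_surjective x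
  induction x using Finsupp.induction_linear with
  | zero => simpa using hz
  | add x y hx hy => rw [map_add]; exact ha _ _ hx hy
  | single Γ c =>
    have : (Finsupp.single Γ c : FreeMod k m n) = c • ofGraph k Γ := by simp [ofGraph]
    rw [this, map_smul]
    exact hs c _ (hc Γ)

theorem MDeg_induction {P : MHom k m n → Prop} {i : ℤ} {x : MHom k m n} (hx : x ∈ MDeg k m n i)
    (hc : ∀ Γ : OGraph m n, (Γ.degree : ℤ) = i → P (cls k Γ))
    (hz : P 0) (ha : ∀ x y, P x → P y → P (x + y)) (hs : ∀ (c : k) x, P x → P (c • x)) : P x := by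
  induction hx using Submodule.span_induction with
  | mem x h =>
    obtain ⟨Γ, h, rfl⟩ := h
    exact hc Γ h
  | zero => exact hz
  | add x y _ _ hx hy => exact ha x y hx hy
  | smul c x _ hx => exact hs c x hx

variable (k)

theorem cls_mem' {Γ : OGraph m n} {i : ℤ} (h : (Γ.degree : ℤ) = i) : cls k Γ ∈ MDeg k m n i :=
  h ▸ cls_mem k Γ

/-! ### Characteristic maps -/

/-- The characteristic map with values in the module generated by graphs. -/
def freeChar (Γ : OGraph m n) : CubeChain k Γ.Prods →ₗ[k] FreeMod k m n :=
  Finsupp.linearCombination k (fun x => ofGraph k (Γ.cubeFace x))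

/-- The characteristic map. -/
def charQ (Γ : OGraph m n) : CubeChain k Γ.Prods →ₗ[k] MHom k m n :=
  Finsupp.linearCombination k (fun x => cls k (Γ.cubeFace x))

/-- The faces of a graph, with all vertices as coordinates. -/
def faceQ (Γ : OGraph m n) : CubeChain k (Fin Γ.N) →ₗ[k] MHom k m n :=
  Finsupp.linearCombination k (fun x => cls k (Γ.face x))

theorem freeChar_cell (Γ : OGraph m n) (x : Γ.Prods → Cell) :
    freeChar k Γ (cell k x) = ofGraph k (Γ.cubeFace x) := by
  rw [freeChar, Finsupp.linearCombination_single, one_smul]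

theorem charQ_cell (Γ : OGraph m n) (x : Γ.Prods → Cell) :
    charQ k Γ (cell k x) = cls k (Γ.cubeFace x) := by
  rw [charQ, Finsupp.linearCombination_single, one_smul]

theorem faceQ_cell (Γ : OGraph m n) (x : Fin Γ.N → Cell) :
    faceQ k Γ (cell k x) = cls k (Γ.face x) := by
  rw [faceQ, Finsupp.linearCombination_single, one_smul]

theorem mkQ_freeChar (Γ : OGraph m n) (c : CubeChain k Γ.Prods) :
    (ideal k m n).mkQ (freeChar k Γ c) = charQ k Γ c := by
  have h : (ideal k m n).mkQ ∘ₗ freeChar k Γ = charQ k Γ :=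
    cubeChain_ext fun x => by rw [LinearMap.comp_apply, freeChar_cell, charQ_cell]; rfl
  exact LinearMap.congr_fun h c

/-- The type of product vertices changes with the graph. With all vertices as coordinates,
reordering and joining act on index sets of the form `Fin N`. -/
theorem charQ_eq (Γ : OGraph m n) : charQ k Γ = faceQ k Γ ∘ₗ
    Finsupp.lmapDomain k k (fun x => Function.extend Subtype.val x Γ.top) :=
  cubeChain_ext fun x => by
    rw [LinearMap.comp_apply, lmapDomain_cell, charQ_cell, faceQ_cell, Γ.cubeFace_eq x Γ.top]

theorem charQ_face (Γ : OGraph m n) (c : Fin Γ.N → Cell) : charQ k (Γ.face c) = faceQ k Γ ∘ₗ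
    Finsupp.lmapDomain k k (fun x => Function.extend (Γ.faceVal c) x c) :=
  cubeChain_ext fun x => by
    rw [LinearMap.comp_apply, lmapDomain_cell, charQ_cell, faceQ_cell, Γ.cubeFace_face]

/-- All coordinates of the top cell are intervals, so its face signs count all preceding product
vertices, as the derivation does. -/
theorem freeD_ofGraph (Γ : OGraph m n) :
    freeD k (ofGraph k Γ) = freeChar k Γ (cubeD k Γ.Prods (cell k (fun _ => Cell.I))) := by
  rw [freeD, ofGraph, Finsupp.linearCombination_single, one_smul, cubeD_cell, map_sum]
  refine Finset.sum_congr rfl fun v _ => ?_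
  -- The instance is kept arbitrary so that the identity matches whichever one the boundary of the
  -- cube carries.
  have hf : ∀ (_ : DecidableEq Γ.Prods) b,
      Γ.cubeFace (Function.update (fun _ => Cell.I) v b) = Γ.face₁ v b := by
    intro _ b
    refine Γ.face_congr fun w hw => ?_
    rw [dif_pos hw]
    by_cases h : w = v.1
    · subst h; simp
    · rw [Function.update_of_ne h, Function.update_of_ne (fun h' => h (congrArg Subtype.val h'))]
  rw [if_pos rfl, map_zsmul, map_sub, freeChar_cell, freeChar_cell, hf, hf, faceSign,
    neg_one_pow_card_filter]
  simp

theorem Md_cls (Γ : OGraph m n) :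
    Md k m n (cls k Γ) = charQ k Γ (cubeD k Γ.Prods (cell k (fun _ => Cell.I))) := by
  rw [cls, Md_mkQ, freeD_ofGraph, mkQ_freeChar]

theorem Md_cls_face (Γ : OGraph m n) {c : Fin Γ.N → Cell} (h : Γ.Valid c) :
    Md k m n (cls k (Γ.face c)) = faceQ k Γ (cubeD k _ (cell k c)) := by
  rw [Md_cls, charQ_face, LinearMap.comp_apply,
    ← cubeD_extend k (Γ.faceVal_strictMono c) h.ne_I, OGraph.extend_top]

theorem Md_cls' (Γ : OGraph m n) :
    Md k m n (cls k Γ) = faceQ k Γ (cubeD k _ (cell k Γ.top)) := by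
  conv_lhs => rw [← Γ.face_top]
  exact Md_cls_face k Γ Γ.valid_top

/-- The differential of a graph is prescribed by its top cell only. Every other cell of the cube is
the top cell of a face graph, and the boundary is natural for the inclusion of that face. -/
theorem Md_charQ (Γ : OGraph m n) (c : CubeChain k Γ.Prods) :
    Md k m n (charQ k Γ c) = charQ k Γ (cubeD k _ c) := by
  have h : Md k m n ∘ₗ charQ k Γ = charQ k Γ ∘ₗ cubeD k _ := ?_
  · exact LinearMap.congr_fun h c
  refine cubeChain_ext fun x => ?_
  rw [LinearMap.comp_apply, LinearMap.comp_apply, charQ_cell, Γ.cubeFace_eq x Γ.top,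
    Md_cls_face k Γ (Γ.valid_extend x),
    cubeD_extend k (Subtype.strictMono_coe _) OGraph.top_ne_I, charQ_eq, LinearMap.comp_apply]

theorem Md_Md (x : MHom k m n) : Md k m n (Md k m n x) = 0 := by
  have h : Md k m n ∘ₗ Md k m n = 0 := MHom_ext fun Γ => by
    rw [LinearMap.comp_apply, Md_cls, Md_charQ, cubeD_cubeD, map_zero, LinearMap.zero_apply]
  exact LinearMap.congr_fun h x

theorem charQ_relabel (e : Fin m ≃ Fin m') (f : Fin n ≃ Fin n') (Γ : OGraph m n) :
    charQ k (Γ.relabel e f) = Mrelabel k e f ∘ₗ charQ k Γ :=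
  cubeChain_ext fun x => by
    refine (charQ_cell k (Γ.relabel e f) x).trans
      ((congrArg (cls k) (Γ.cubeFace_relabel e f x)).trans ?_)
    rw [← Mrelabel_cls]
    exact congrArg (Mrelabel k e f) (charQ_cell k Γ x).symm

theorem Md_relabel (e : Fin m ≃ Fin m') (f : Fin n ≃ Fin n') (x : MHom k m n) :
    Md k m' n' (Mrelabel k e f x) = Mrelabel k e f (Md k m n x) := by
  have h : Md k m' n' ∘ₗ Mrelabel k e f = Mrelabel k e f ∘ₗ Md k m n := MHom_ext fun Γ => by
    rw [LinearMap.comp_apply, LinearMap.comp_apply, Mrelabel_cls, Md_cls, Md_cls, charQ_relabel]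
    rfl
  exact LinearMap.congr_fun h x

/-! ### Changing the order of the vertices -/

variable {k} in
theorem cls_eq_of_rel {x y : FreeMod k m n} (h : Rel k m n (x - y)) :
    (ideal k m n).mkQ x = (ideal k m n).mkQ y :=
  (Submodule.Quotient.eq _).2 (InIdeal.rel h)

theorem cls_reorder (Γ : OGraph m n) {N' : ℕ} (e : Fin Γ.N ≃ Fin N') :
    cls k (Γ.reorder e) = Γ.reorderSign e • cls k Γ :=
  (cls_eq_of_rel (Rel.reorder Γ e)).trans (map_zsmul _ _ _)

section Listing

variable {V : Type} [Fintype V]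

/-- The sign by which two total orders of the vertices of a graph differ. -/
def listingSign (x : Graph V m n) {N N' : ℕ} (a : V ≃ Fin N) (b : V ≃ Fin N') : ℤ :=
  ∏ v, ∏ w, if (a v < a w ∧ b w < b v) ∧ x.kind v = .product ∧ x.kind w = .product
    then -1 else 1

/-- The two orders differ by the permutation `a.symm.trans b`. Its sign is rewritten as a product
over `V`, which splits into blocks when `V` is a disjoint union. -/
theorem cls_reindex (x : Graph V m n) {N N' : ℕ} (a : V ≃ Fin N) (b : V ≃ Fin N') :
    cls k ⟨N', x.reindex b⟩ = listingSign x a b • cls k ⟨N, x.reindex a⟩ := by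
  have h := cls_reorder k ⟨N, x.reindex a⟩ (a.symm.trans b)
  have h₁ : OGraph.reorder ⟨N, x.reindex a⟩ (a.symm.trans b) = ⟨N', x.reindex b⟩ := by
    change OGraph.mk N' ((x.reindex a).reindex _) = _
    rw [Graph.reindex_reindex]
    congr 2
    ext v
    simp
  rw [h₁, OGraph.reorderSign_eq] at h
  rw [h]
  congr 1
  unfold permSign listingSign
  rw [← a.prod_comp]
  refine Finset.prod_congr rfl fun v _ => ?_
  rw [← a.prod_comp]
  refine Finset.prod_congr rfl fun w _ => ?_
  have hk : ∀ v, OGraph.top ⟨N, x.reindex a⟩ (a v) = .I ↔ x.kind v = .product := by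
    intro v
    rw [OGraph.top_eq_I]
    change x.kind (a.symm (a v)) = _ ↔ _
    rw [Equiv.symm_apply_apply]
  simp only [hk, Equiv.trans_apply, Equiv.symm_apply_apply]

theorem cls_reindex_of_lt (x : Graph V m n) {N N' : ℕ} (a : V ≃ Fin N) (b : V ≃ Fin N')
    (h : ∀ v w, a v < a w → b v < b w) :
    cls k ⟨N', x.reindex b⟩ = cls k ⟨N, x.reindex a⟩ := by
  rw [cls_reindex k x a b, listingSign, Finset.prod_eq_one, one_smul]
  intro v _
  refine Finset.prod_eq_one fun w _ => if_neg ?_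
  rintro ⟨⟨h₁, h₂⟩, _⟩
  exact (h v w h₁).not_gt h₂

end Listing

end Operations

/-! ### The laws of a prop for `M` -/

section Laws

variable (k : Type u) [CommRing k] {m m' m'' n n' n'' p p' q : ℕ}

theorem cellDim_update {ι : Type} [Fintype ι] [LinearOrder ι] {x : ι → Cell} {i : ι}
    (hx : x i = .I) {b : Cell} (hb : b ≠ .I) : cellDim (Function.update x i b) + 1 = cellDim x := by
  unfold cellDim
  have : Finset.univ.filter (Function.update x i b · = .I) =
      (Finset.univ.filter (x · = .I)).erase i := by
    ext j
    by_cases hj : j = i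
    · subst hj; simp [hb]
    · simp [hj]
  rw [this, Finset.card_erase_add_one]
  simpa using hx

theorem charQ_mem (Γ : OGraph m n) (x : Γ.Prods → Cell) :
    charQ k Γ (cell k x) ∈ MDeg k m n (cellDim x) := by
  rw [charQ_cell]
  exact cls_mem' k (by rw [Γ.degree_cubeFace])

theorem cellDim_I (Γ : OGraph m n) : cellDim (fun _ : Γ.Prods => Cell.I) = Γ.degree := by
  rw [← Γ.degree_cubeFace, Γ.cubeFace_top]

theorem Md_mem {i : ℤ} {x : MHom k m n} (hx : x ∈ MDeg k m n i) :
    Md k m n x ∈ MDeg k m n (i - 1) := by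
  refine MDeg_induction (P := fun x => Md k m n x ∈ MDeg k m n (i - 1)) hx (fun Γ h => ?_)
    (by rw [map_zero]; exact zero_mem _)
    (fun x y hx hy => by rw [map_add]; exact add_mem hx hy)
    (fun c x hx => by rw [map_smul]; exact Submodule.smul_mem _ c hx)
  · rw [Md_cls, cubeD_cell, map_sum]
    refine Submodule.sum_mem _ fun v _ => ?_
    have key : ∀ x : Γ.Prods → Cell, cellDim x + 1 = Γ.degree →
        charQ k Γ (cell k x) ∈ MDeg k m n (i - 1) := by
      intro x hx
      have h₃ : i - 1 = (cellDim x : ℤ) := by omega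
      rw [h₃]
      exact charQ_mem k Γ x
    have key' : ∀ b, b ≠ Cell.I → cellDim (Function.update (fun _ => Cell.I) v b) + 1 = Γ.degree :=
      fun b hb => (cellDim_update rfl hb).trans (cellDim_I Γ)
    rw [if_pos rfl, map_zsmul, map_sub]
    exact zsmul_mem (sub_mem (key _ (key' _ (by simp))) (key _ (key' _ (by simp)))) _

theorem Mrelabel_mem (e : Fin m ≃ Fin m') (f : Fin n ≃ Fin n') {i : ℤ} {x : MHom k m n}
    (hx : x ∈ MDeg k m n i) : Mrelabel k e f x ∈ MDeg k m' n' i := by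
  refine MDeg_induction (P := fun x => Mrelabel k e f x ∈ MDeg k m' n' i) hx (fun Γ h => ?_)
    (by rw [map_zero]; exact zero_mem _)
    (fun x y hx hy => by rw [map_add]; exact add_mem hx hy)
    (fun c x hx => by rw [map_smul]; exact Submodule.smul_mem _ c hx)
  rw [Mrelabel_cls]
  exact cls_mem' k h

theorem units_smul_eq {A : Type*} [AddCommGroup A] (d : ℕ) (x : A) :
    ((d : ℤ).negOnePow : ℤˣ) • x = (-1 : ℤ) ^ d • x := by
  rw [Units.smul_def, Int.coe_negOnePow_natCast]

section Join

variable {k} {a b c d : ℕ} {J : Joining a b c d m n}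
  {B : MHom k a b →ₗ[k] MHom k c d →ₗ[k] MHom k m n}

theorem join_mem (hB : ∀ x y, B (cls k x) (cls k y) = cls k (J.join x y)) {i j : ℤ}
    {x : MHom k a b} (hx : x ∈ MDeg k a b i) {y : MHom k c d} (hy : y ∈ MDeg k c d j) :
    B x y ∈ MDeg k m n (i + j) := by
  refine MDeg_induction (P := fun x => B x y ∈ MDeg k m n (i + j)) hx (fun Γ h => ?_)
    (by rw [map_zero, LinearMap.zero_apply]; exact zero_mem _)
    (fun x y hx hy => by rw [map_add, LinearMap.add_apply]; exact add_mem hx hy)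
    (fun c x hx => by rw [map_smul, LinearMap.smul_apply]; exact Submodule.smul_mem _ c hx)
  refine MDeg_induction (P := fun y => B (cls k Γ) y ∈ MDeg k m n (i + j)) hy (fun Γ' h' => ?_)
    (by rw [map_zero]; exact zero_mem _)
    (fun x y hx hy => by rw [map_add]; exact add_mem hx hy)
    (fun c x hx => by rw [map_smul]; exact Submodule.smul_mem _ c hx)
  rw [hB]
  refine cls_mem' k ?_
  rw [J.degree_join, Nat.cast_add, h, h']

/-- The faces of a joined graph, with the vertices of both graphs as coordinates. -/
def joinFaceQ (k : Type u) [CommRing k] (J : Joining a b c d m n) (x : OGraph a b)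
    (y : OGraph c d) : CubeChain k (Fin (x.N + y.N)) →ₗ[k] MHom k m n :=
  faceQ k (J.join x y)

theorem joinFaceQ_append (hB : ∀ x y, B (cls k x) (cls k y) = cls k (J.join x y))
    (x : OGraph a b) (y : OGraph c d) (s : Fin x.N → Cell) (t : Fin y.N → Cell) :
    joinFaceQ k J x y (cell k (Fin.append s t)) =
      B (faceQ k x (cell k s)) (faceQ k y (cell k t)) := by
  rw [faceQ_cell, faceQ_cell, hB, ← J.face_join]
  exact faceQ_cell k (J.join x y) _

/-- The cube of a join is the product of the two cubes, the vertices of `x` coming first. This is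
`cubeD_append`, with faces in one block read as `B` with the other argument fixed. -/
theorem Md_join_cls (hB : ∀ x y, B (cls k x) (cls k y) = cls k (J.join x y))
    (x : OGraph a b) (y : OGraph c d) : Md k m n (B (cls k x) (cls k y)) =
      B (Md k a b (cls k x)) (cls k y) + (-1 : ℤ) ^ x.degree • B (cls k x) (Md k c d (cls k y)) := by
  have hd : Md k m n (B (cls k x) (cls k y)) =
      joinFaceQ k J x y (cubeD k _ (cell k (Fin.append x.top y.top))) := by
    rw [hB, Md_cls', J.top_join]
    rfl
  rw [hd, Md_cls' k x, Md_cls' k y, x.degree_eq, ← cellSign_eq, cubeD_append, map_add, map_zsmul]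
  congr 1
  · have h : joinFaceQ k J x y ∘ₗ Finsupp.lmapDomain k k (fun s => Fin.append s y.top) =
        B.flip (cls k y) ∘ₗ faceQ k x := cubeChain_ext fun s => by
      rw [LinearMap.comp_apply, LinearMap.comp_apply, lmapDomain_cell, LinearMap.flip_apply,
        joinFaceQ_append hB, faceQ_cell k y, y.face_top]
    exact LinearMap.congr_fun h _
  · congr 1
    have h : joinFaceQ k J x y ∘ₗ Finsupp.lmapDomain k k (fun t => Fin.append x.top t) =
        B (cls k x) ∘ₗ faceQ k y := cubeChain_ext fun t => by
      rw [LinearMap.comp_apply, LinearMap.comp_apply, lmapDomain_cell, joinFaceQ_append hB,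
        faceQ_cell k x, x.face_top]
    exact LinearMap.congr_fun h _

theorem Md_join (hB : ∀ x y, B (cls k x) (cls k y) = cls k (J.join x y)) {i : ℤ}
    {x : MHom k a b} (hx : x ∈ MDeg k a b i) (y : MHom k c d) :
    Md k m n (B x y) = B (Md k a b x) y + i.negOnePow • B x (Md k c d y) := by
  refine MDeg_induction (P := fun x => Md k m n (B x y) = B (Md k a b x) y +
    i.negOnePow • B x (Md k c d y)) hx (fun Γ h => ?_) (by simp)
    (fun x y hx hy => by simp only [map_add, LinearMap.add_apply, hx, hy, smul_add]; abel)
    (fun c x hx => by simp only [map_smul, LinearMap.smul_apply, hx, smul_add, smul_comm c])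
  subst h
  induction y using MHom_induction with
  | hc Γ' => rw [Md_join_cls hB, units_smul_eq]
  | hz => simp
  | ha x y hx hy => simp only [map_add, hx, hy, smul_add]; abel
  | hs c x hx => simp only [map_smul, hx, smul_add, smul_comm c]

end Join

theorem Mvcomp_join (x : OGraph n p) (y : OGraph m n) :
    Mvcomp k m n p (cls k x) (cls k y) = cls k ((vJoining m n p).join x y) := Mvcomp_cls k x y

theorem Mhcomp_join (x : OGraph m n) (y : OGraph m' n') :
    Mhcomp k m n m' n' (cls k x) (cls k y) = cls k ((hJoining m n m' n').join x y) :=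
  Mhcomp_cls k x y

/-! ### Laws for graphs -/

/-- A graph with a total order of its vertices, given by a numbering. -/
def Graph.listed {V : Type} {N : ℕ} (a : V ≃ Fin N) (x : Graph V m n) : OGraph m n :=
  ⟨N, x.reindex a⟩

section Listed

variable {V W U X : Type} {N₁ N₂ N₃ N₄ : ℕ}

theorem OGraph.eq_listed (Γ : OGraph m n) : Γ = Γ.graph.listed (Equiv.refl _) := by
  rw [Graph.listed, Graph.reindex_refl]

theorem Graph.listed_reindex (e : W ≃ V) (a : V ≃ Fin N₁) (x : Graph W m n) :
    (x.reindex e).listed a = x.listed (e.trans a) := by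
  rw [listed, reindex_reindex, listed]

theorem Graph.listed_relabel (e : Fin m ≃ Fin m') (f : Fin n ≃ Fin n') (a : V ≃ Fin N₁)
    (x : Graph V m n) : (x.listed a).relabel e f = (x.relabel e f).listed a :=
  congrArg (OGraph.mk N₁) (relabel_reindex a e f x)

/-- The numbering of a disjoint union in which the first part comes first. -/
def sumList (a : V ≃ Fin N₁) (b : W ≃ Fin N₂) : V ⊕ W ≃ Fin (N₁ + N₂) :=
  (Equiv.sumCongr a b).trans finSumFinEquiv

theorem Graph.listed_vcomp (a : V ≃ Fin N₁) (b : W ≃ Fin N₂) (x : Graph V n p)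
    (y : Graph W m n) : (x.listed a).vcomp (y.listed b) = (x.vcomp y).listed (sumList a b) :=
  congrArg (OGraph.mk (N₁ + N₂)) (by
    refine (congrArg (reindex finSumFinEquiv) (vcomp_reindex a b x y)).trans ?_
    rw [reindex_reindex]
    rfl)

theorem Graph.listed_hcomp (a : V ≃ Fin N₁) (b : W ≃ Fin N₂) (x : Graph V m n)
    (y : Graph W m' n') : (x.listed a).hcomp (y.listed b) = (x.hcomp y).listed (sumList a b) :=
  congrArg (OGraph.mk (N₁ + N₂)) (by
    refine (congrArg (reindex finSumFinEquiv) (hcomp_reindex a b x y)).trans ?_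
    rw [reindex_reindex]
    rfl)

theorem sumList_inl_lt_inl (a : V ≃ Fin N₁) (b : W ≃ Fin N₂) (v w : V) :
    sumList a b (.inl v) < sumList a b (.inl w) ↔ a v < a w := by
  simp [sumList, castAdd_lt_castAdd]

theorem sumList_inr_lt_inr (a : V ≃ Fin N₁) (b : W ≃ Fin N₂) (v w : W) :
    sumList a b (.inr v) < sumList a b (.inr w) ↔ b v < b w := by
  simp [sumList]

theorem sumList_inl_lt_inr (a : V ≃ Fin N₁) (b : W ≃ Fin N₂) (v : V) (w : W) :
    sumList a b (.inl v) < sumList a b (.inr w) ↔ True := by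
  simp [sumList, castAdd_lt_natAdd]

theorem sumList_inr_lt_inl (a : V ≃ Fin N₁) (b : W ≃ Fin N₂) (v : V) (w : W) :
    sumList a b (.inr w) < sumList a b (.inl v) ↔ False := by
  simp [sumList, (castAdd_lt_natAdd _ _).le]

theorem OGraph.one_eq_listed (n : ℕ) :
    OGraph.one n = (Graph.one n).listed (Equiv.refl _) := (OGraph.one n).eq_listed

/-- The sign of exchanging two blocks of vertices: one factor −1 for each pair of products, hence
the product of the degrees as exponent. -/
theorem prod_prod_ite_and {P : V → Prop} {Q : W → Prop} [Fintype V] [Fintype W]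
    [DecidablePred P] [DecidablePred Q] :
    ∏ v, ∏ w, (if P v ∧ Q w then (-1 : ℤ) else 1) =
      (-1) ^ (Fintype.card {v // P v} * Fintype.card {w // Q w}) := by
  rw [mul_comm, pow_mul, Fintype.card_subtype, Fintype.card_subtype, neg_one_pow_card_filter Q,
    ← Finset.prod_const, Finset.prod_filter]
  refine Finset.prod_congr rfl fun v _ => ?_
  by_cases hv : P v <;> simp [hv]

theorem Graph.degree_listed [Fintype V] (a : V ≃ Fin N₁) (x : Graph V m n) :
    (x.listed a).degree = Fintype.card {v // x.kind v = .product} :=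
  Fintype.card_congr (a.symm.subtypeEquiv fun _ => Iff.rfl)

theorem cls_listed [Fintype V] (a : V ≃ Fin N₁) (b : V ≃ Fin N₂) (x : Graph V m n) :
    cls k (x.listed b) = listingSign x a b • cls k (x.listed a) := cls_reindex k x a b

theorem cls_listed_of_lt [Fintype V] (a : V ≃ Fin N₁) (b : V ≃ Fin N₂) (x : Graph V m n)
    (h : ∀ v w, a v < a w → b v < b w) : cls k (x.listed b) = cls k (x.listed a) :=
  cls_reindex_of_lt k x a b h

theorem lt_and_gt_iff {N : ℕ} (a b : Fin N) : (a < b ∧ b < a) ↔ False :=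
  iff_of_false (fun h => h.1.asymm h.2) id

/-- Both bracketings list the vertices of `x`, `y`, `z` in this order, so there is no sign. -/
theorem OGraph.cls_vcomp_assoc (x : OGraph p q) (y : OGraph n p) (z : OGraph m n) :
    cls k ((x.vcomp y).vcomp z) = cls k (x.vcomp (y.vcomp z)) := by
  rw [x.eq_listed, y.eq_listed, z.eq_listed]
  simp only [Graph.listed_vcomp, Graph.vcomp_assoc, Graph.listed_reindex]
  refine cls_listed_of_lt k _ _ _ ?_
  rintro ((v | v) | v) ((w | w) | w) <;>
    simp [sumList_inl_lt_inl, sumList_inr_lt_inr, sumList_inl_lt_inr, sumList_inr_lt_inl]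

theorem OGraph.cls_one_vcomp (x : OGraph m n) : cls k ((OGraph.one n).vcomp x) = cls k x := by
  rw [OGraph.one_eq_listed, x.eq_listed]
  simp only [Graph.listed_vcomp, Graph.one_vcomp, Graph.listed_reindex]
  refine cls_listed_of_lt k _ _ _ fun v w h => ?_
  simpa [sumList_inr_lt_inr] using h

theorem OGraph.cls_vcomp_one (x : OGraph m n) : cls k (x.vcomp (OGraph.one m)) = cls k x := by
  rw [OGraph.one_eq_listed, x.eq_listed]
  simp only [Graph.listed_vcomp, Graph.vcomp_one, Graph.listed_reindex]
  exact cls_listed_of_lt k _ _ _ fun v w h =>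
    (sumList_inl_lt_inl (Equiv.refl _) (Equiv.refl (Fin 0)) v w).2 h

theorem OGraph.vcomp_relabel (e : Fin m ≃ Fin m') (f : Fin n ≃ Fin n') (g : Fin p ≃ Fin p')
    (x : OGraph n p) (y : OGraph m n) :
    (x.relabel f g).vcomp (y.relabel e f) = (x.vcomp y).relabel e g := by
  rw [x.eq_listed, y.eq_listed]
  simp only [Graph.listed_vcomp, Graph.listed_relabel, Graph.vcomp_relabel]

theorem OGraph.cls_hcomp_assoc (x : OGraph m n) (y : OGraph m' n') (z : OGraph m'' n'') :
    cls k (((x.hcomp y).hcomp z).relabel (finCongr (add_assoc m m' m''))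
      (finCongr (add_assoc n n' n''))) = cls k (x.hcomp (y.hcomp z)) := by
  rw [x.eq_listed, y.eq_listed, z.eq_listed]
  simp only [Graph.listed_hcomp, Graph.listed_relabel, Graph.hcomp_assoc, Graph.listed_reindex]
  refine cls_listed_of_lt k _ _ _ ?_
  rintro ((v | v) | v) ((w | w) | w) <;>
    simp [sumList_inl_lt_inl, sumList_inr_lt_inr, sumList_inl_lt_inr, sumList_inr_lt_inl]

theorem OGraph.cls_one_hcomp (x : OGraph m n) :
    cls k (((OGraph.one 0).hcomp x).relabel (finCongr (zero_add m)) (finCongr (zero_add n))) =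
      cls k x := by
  rw [OGraph.one_eq_listed, x.eq_listed]
  simp only [Graph.listed_hcomp, Graph.listed_relabel, Graph.one_hcomp, Graph.listed_reindex]
  refine cls_listed_of_lt k _ _ _ fun v w h => ?_
  simpa [sumList_inr_lt_inr] using h

theorem OGraph.cls_hcomp_one (x : OGraph m n) :
    cls k ((x.hcomp (OGraph.one 0)).relabel (finCongr (add_zero m)) (finCongr (add_zero n))) =
      cls k x := by
  rw [OGraph.one_eq_listed, x.eq_listed]
  simp only [Graph.listed_hcomp, Graph.listed_relabel, Graph.hcomp_one, Graph.listed_reindex]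
  exact cls_listed_of_lt k _ _ _ fun v w h =>
    (sumList_inl_lt_inl (Equiv.refl _) (Equiv.refl (Fin 0)) v w).2 h

theorem OGraph.hcomp_relabel {m₁ m₁' n₁ n₁' m₂ m₂' n₂ n₂' : ℕ} (e₁ : Fin m₁ ≃ Fin m₁')
    (f₁ : Fin n₁ ≃ Fin n₁') (e₂ : Fin m₂ ≃ Fin m₂') (f₂ : Fin n₂ ≃ Fin n₂')
    (x : OGraph m₁ n₁) (y : OGraph m₂ n₂) :
    (x.relabel e₁ f₁).hcomp (y.relabel e₂ f₂) =
      (x.hcomp y).relabel (blockSum e₁ e₂) (blockSum f₁ f₂) := by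
  rw [x.eq_listed, y.eq_listed]
  simp only [Graph.listed_hcomp, Graph.listed_relabel, Graph.hcomp_relabel]

/-- The two numberings differ by exchanging the block of `x` with the block of `y`, so all
inversions are between the two. -/
theorem OGraph.cls_hcomp_comm (x : OGraph m n) (y : OGraph m' n') :
    cls k ((x.hcomp y).relabel (finAddFlip : Fin (m + m') ≃ Fin (m' + m))
      (finAddFlip : Fin (n + n') ≃ Fin (n' + n))) =
      (-1 : ℤ) ^ (x.degree * y.degree) • cls k (y.hcomp x) := by
  rw [x.eq_listed, y.eq_listed]
  simp only [Graph.listed_hcomp, Graph.listed_relabel, Graph.hcomp_comm, Graph.listed_reindex]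
  rw [cls_listed k (sumList (Equiv.refl _) (Equiv.refl _)), Graph.degree_listed,
    Graph.degree_listed, mul_comm, ← prod_prod_ite_and]
  congr 1
  unfold listingSign
  simp [Fintype.prod_sum_type, sumList_inl_lt_inl, sumList_inr_lt_inr, sumList_inl_lt_inr,
    sumList_inr_lt_inl, lt_and_gt_iff, Graph.hcomp]

theorem OGraph.cls_one_hcomp_one (m n : ℕ) :
    cls k ((OGraph.one m).hcomp (OGraph.one n)) = cls k (OGraph.one (m + n)) := by
  simp only [OGraph.one_eq_listed, Graph.listed_hcomp, Graph.one_hcomp_one, Graph.listed_reindex]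
  exact cls_listed_of_lt k _ _ _ fun v => v.elim0

/-- The orders are `x, x', y, y'` and `x, y, x', y'`; only the blocks of `x'` and `y` change places.
-/
theorem OGraph.cls_interchange (x : OGraph n p) (x' : OGraph n' p') (y : OGraph m n)
    (y' : OGraph m' n') : cls k ((x.hcomp x').vcomp (y.hcomp y')) =
      (-1 : ℤ) ^ (x'.degree * y.degree) • cls k ((x.vcomp y).hcomp (x'.vcomp y')) := by
  rw [x.eq_listed, y.eq_listed, x'.eq_listed, y'.eq_listed]
  simp only [Graph.listed_hcomp, Graph.listed_vcomp, Graph.interchange, Graph.listed_reindex]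
  rw [cls_listed k (sumList (sumList (Equiv.refl _) (Equiv.refl _))
    (sumList (Equiv.refl _) (Equiv.refl _))), Graph.degree_listed,
    Graph.degree_listed, mul_comm, ← prod_prod_ite_and]
  congr 1
  unfold listingSign
  simp [Fintype.prod_sum_type, sumList_inl_lt_inl, sumList_inr_lt_inr, sumList_inl_lt_inr,
    sumList_inr_lt_inl, lt_and_gt_iff, Graph.hcomp, Graph.vcomp]

end Listed

/-! ### `M` is a prop -/

theorem Mrelabel_refl (x : MHom k m n) :
    Mrelabel k (Equiv.refl (Fin m)) (Equiv.refl (Fin n)) x = x := by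
  have h : Mrelabel k (Equiv.refl (Fin m)) (Equiv.refl (Fin n)) = LinearMap.id :=
    MHom_ext fun Γ => by
      rw [Mrelabel_cls, OGraph.relabel, Graph.relabel_refl]
      rfl
  exact LinearMap.congr_fun h x

theorem Mrelabel_trans (e : Fin m ≃ Fin m') (e' : Fin m' ≃ Fin m'') (f : Fin n ≃ Fin n')
    (f' : Fin n' ≃ Fin n'') (x : MHom k m n) :
    Mrelabel k (e.trans e') (f.trans f') x = Mrelabel k e' f' (Mrelabel k e f x) := by
  have h : Mrelabel k (e.trans e') (f.trans f') = Mrelabel k e' f' ∘ₗ Mrelabel k e f :=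
    MHom_ext fun Γ => by
      rw [LinearMap.comp_apply, Mrelabel_cls, Mrelabel_cls, Mrelabel_cls, OGraph.relabel,
        ← Graph.relabel_relabel]
      rfl
  exact LinearMap.congr_fun h x

theorem degree_one (n : ℕ) : (OGraph.one n).degree = 0 :=
  Fintype.card_eq_zero_iff.2 ⟨fun v => v.1.elim0⟩

theorem Md_one (n : ℕ) : Md k n n (cls k (OGraph.one n)) = 0 := by
  rw [Md_cls, cubeD_cell, Finset.sum_eq_zero (fun v _ => v.1.elim0), map_zero]

/-- By multilinearity the law is checked on classes of graphs; the other laws of `M` are obtained in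
the same way. -/
theorem Mvcomp_assoc (x : MHom k p q) (y : MHom k n p) (z : MHom k m n) :
    Mvcomp k m n q (Mvcomp k n p q x y) z = Mvcomp k m p q x (Mvcomp k m n p y z) := by
  induction x using MHom_induction with
  | hc Γ =>
    induction y using MHom_induction with
    | hc Γ' =>
      induction z using MHom_induction with
      | hc Γ'' => simp only [Mvcomp_cls, OGraph.cls_vcomp_assoc]
      | hz => simp
      | ha x y hx hy => simp only [map_add, hx, hy]
      | hs c x hx => simp only [map_smul, hx]
    | hz => simp
    | ha x y hx hy => simp only [map_add, LinearMap.add_apply, hx, hy]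
    | hs c x hx => simp only [map_smul, LinearMap.smul_apply, hx]
  | hz => simp
  | ha x y hx hy => simp only [map_add, LinearMap.add_apply, hx, hy]
  | hs c x hx => simp only [map_smul, LinearMap.smul_apply, hx]

theorem Mone_vcomp (x : MHom k m n) : Mvcomp k m n n (cls k (OGraph.one n)) x = x := by
  have h : Mvcomp k m n n (cls k (OGraph.one n)) = LinearMap.id := MHom_ext fun Γ => by
    rw [Mvcomp_cls, OGraph.cls_one_vcomp, LinearMap.id_apply]
  exact LinearMap.congr_fun h x

theorem Mvcomp_one (x : MHom k m n) : Mvcomp k m m n x (cls k (OGraph.one m)) = x := by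
  have h : (Mvcomp k m m n).flip (cls k (OGraph.one m)) = LinearMap.id := MHom_ext fun Γ => by
    rw [LinearMap.flip_apply, Mvcomp_cls, OGraph.cls_vcomp_one, LinearMap.id_apply]
  exact LinearMap.congr_fun h x

theorem Mvcomp_relabel (e : Fin m ≃ Fin m') (f : Fin n ≃ Fin n') (g : Fin p ≃ Fin p')
    (x : MHom k n p) (y : MHom k m n) :
    Mvcomp k m' n' p' (Mrelabel k f g x) (Mrelabel k e f y) =
      Mrelabel k e g (Mvcomp k m n p x y) := by
  induction x using MHom_induction with
  | hc Γ =>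
    induction y using MHom_induction with
    | hc Γ' => simp only [Mvcomp_cls, Mrelabel_cls, OGraph.vcomp_relabel]
    | hz => simp
    | ha x y hx hy => simp only [map_add, hx, hy]
    | hs c x hx => simp only [map_smul, hx]
  | hz => simp
  | ha x y hx hy => simp only [map_add, LinearMap.add_apply, hx, hy]
  | hs c x hx => simp only [map_smul, LinearMap.smul_apply, hx]

theorem Mhcomp_assoc (x : MHom k m n) (y : MHom k m' n') (z : MHom k m'' n'') :
    Mrelabel k (finCongr (add_assoc m m' m'')) (finCongr (add_assoc n n' n''))
      (Mhcomp k (m + m') (n + n') m'' n'' (Mhcomp k m n m' n' x y) z) =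
    Mhcomp k m n (m' + m'') (n' + n'') x (Mhcomp k m' n' m'' n'' y z) := by
  induction x using MHom_induction with
  | hc Γ =>
    induction y using MHom_induction with
    | hc Γ' =>
      induction z using MHom_induction with
      | hc Γ'' => simp only [Mhcomp_cls, Mrelabel_cls, OGraph.cls_hcomp_assoc]
      | hz => simp
      | ha x y hx hy => simp only [map_add, hx, hy]
      | hs c x hx => simp only [map_smul, hx]
    | hz => simp
    | ha x y hx hy => simp only [map_add, LinearMap.add_apply, hx, hy]
    | hs c x hx => simp only [map_smul, LinearMap.smul_apply, hx]
  | hz => simp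
  | ha x y hx hy => simp only [map_add, LinearMap.add_apply, hx, hy]
  | hs c x hx => simp only [map_smul, LinearMap.smul_apply, hx]

theorem Mone_hcomp (x : MHom k m n) : Mrelabel k (finCongr (zero_add m)) (finCongr (zero_add n))
    (Mhcomp k 0 0 m n (cls k (OGraph.one 0)) x) = x := by
  have h : Mrelabel k (finCongr (zero_add m)) (finCongr (zero_add n)) ∘ₗ
      Mhcomp k 0 0 m n (cls k (OGraph.one 0)) = LinearMap.id := MHom_ext fun Γ => by
    rw [LinearMap.comp_apply, Mhcomp_cls, Mrelabel_cls, OGraph.cls_one_hcomp, LinearMap.id_apply]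
  exact LinearMap.congr_fun h x

theorem Mhcomp_one (x : MHom k m n) : Mrelabel k (finCongr (add_zero m)) (finCongr (add_zero n))
    (Mhcomp k m n 0 0 x (cls k (OGraph.one 0))) = x := by
  have h : Mrelabel k (finCongr (add_zero m)) (finCongr (add_zero n)) ∘ₗ
      (Mhcomp k m n 0 0).flip (cls k (OGraph.one 0)) = LinearMap.id := MHom_ext fun Γ => by
    rw [LinearMap.comp_apply, LinearMap.flip_apply, Mhcomp_cls, Mrelabel_cls,
      OGraph.cls_hcomp_one, LinearMap.id_apply]
  exact LinearMap.congr_fun h x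

theorem Mhcomp_relabel {m₁ m₁' n₁ n₁' m₂ m₂' n₂ n₂' : ℕ} (e₁ : Fin m₁ ≃ Fin m₁')
    (f₁ : Fin n₁ ≃ Fin n₁') (e₂ : Fin m₂ ≃ Fin m₂') (f₂ : Fin n₂ ≃ Fin n₂')
    (x : MHom k m₁ n₁) (y : MHom k m₂ n₂) :
    Mhcomp k m₁' n₁' m₂' n₂' (Mrelabel k e₁ f₁ x) (Mrelabel k e₂ f₂ y) =
      Mrelabel k (blockSum e₁ e₂) (blockSum f₁ f₂) (Mhcomp k m₁ n₁ m₂ n₂ x y) := by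
  induction x using MHom_induction with
  | hc Γ =>
    induction y using MHom_induction with
    | hc Γ' => simp only [Mhcomp_cls, Mrelabel_cls, OGraph.hcomp_relabel]
    | hz => simp
    | ha x y hx hy => simp only [map_add, hx, hy]
    | hs c x hx => simp only [map_smul, hx]
  | hz => simp
  | ha x y hx hy => simp only [map_add, LinearMap.add_apply, hx, hy]
  | hs c x hx => simp only [map_smul, LinearMap.smul_apply, hx]

theorem Mhcomp_comm (i j : ℤ) {x : MHom k m n} (hx : x ∈ MDeg k m n i) {y : MHom k m' n'}
    (hy : y ∈ MDeg k m' n' j) :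
    Mrelabel k (finAddFlip : Fin (m + m') ≃ Fin (m' + m))
      (finAddFlip : Fin (n + n') ≃ Fin (n' + n)) (Mhcomp k m n m' n' x y) =
    (i * j).negOnePow • Mhcomp k m' n' m n y x := by
  refine MDeg_induction (P := fun x => Mrelabel k _ _ (Mhcomp k m n m' n' x y) =
      (i * j).negOnePow • Mhcomp k m' n' m n y x) hx (fun Γ h => ?_) (by simp)
    (fun x y hx hy => by simp only [map_add, LinearMap.add_apply, hx, hy, smul_add])
    (fun c x hx => by simp only [map_smul, LinearMap.smul_apply, hx, smul_comm c])
  refine MDeg_induction (P := fun y => Mrelabel k _ _ (Mhcomp k m n m' n' (cls k Γ) y) =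
      (i * j).negOnePow • Mhcomp k m' n' m n y (cls k Γ)) hy (fun Γ' h' => ?_) (by simp)
    (fun x y hx hy => by simp only [map_add, LinearMap.add_apply, hx, hy, smul_add])
    (fun c x hx => by simp only [map_smul, LinearMap.smul_apply, hx, smul_comm c])
  rw [Mhcomp_cls, Mhcomp_cls, Mrelabel_cls, OGraph.cls_hcomp_comm, ← h, ← h', ← Nat.cast_mul,
    units_smul_eq]

theorem Mone_hcomp_one (m n : ℕ) : Mhcomp k m m n n (cls k (OGraph.one m)) (cls k (OGraph.one n)) =
    cls k (OGraph.one (m + n)) := by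
  rw [Mhcomp_cls, OGraph.cls_one_hcomp_one]

theorem Minterchange (i j : ℤ) (x : MHom k n p) {x' : MHom k n' p'} (hx' : x' ∈ MDeg k n' p' i)
    {y : MHom k m n} (hy : y ∈ MDeg k m n j) (y' : MHom k m' n') :
    Mvcomp k (m + m') (n + n') (p + p') (Mhcomp k n p n' p' x x') (Mhcomp k m n m' n' y y') =
      (i * j).negOnePow • Mhcomp k m p m' p' (Mvcomp k m n p x y) (Mvcomp k m' n' p' x' y') := by
  refine MDeg_induction (P := fun x' => Mvcomp k (m + m') (n + n') (p + p')
        (Mhcomp k n p n' p' x x') (Mhcomp k m n m' n' y y') =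
      (i * j).negOnePow • Mhcomp k m p m' p' (Mvcomp k m n p x y) (Mvcomp k m' n' p' x' y'))
    hx' (fun Γ' h => ?_) (by simp)
    (fun x y hx hy => by simp only [map_add, LinearMap.add_apply, hx, hy, smul_add])
    (fun c x hx => by simp only [map_smul, LinearMap.smul_apply, hx, smul_comm c])
  refine MDeg_induction (P := fun y => Mvcomp k (m + m') (n + n') (p + p')
        (Mhcomp k n p n' p' x (cls k Γ')) (Mhcomp k m n m' n' y y') =
      (i * j).negOnePow • Mhcomp k m p m' p' (Mvcomp k m n p x y)
        (Mvcomp k m' n' p' (cls k Γ') y'))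
    hy (fun Δ h' => ?_) (by simp)
    (fun x y hx hy => by simp only [map_add, LinearMap.add_apply, hx, hy, smul_add])
    (fun c x hx => by simp only [map_smul, LinearMap.smul_apply, hx, smul_comm c])
  induction x using MHom_induction with
  | hc Γ =>
    induction y' using MHom_induction with
    | hc Δ' =>
      simp only [Mhcomp_cls, Mvcomp_cls]
      rw [OGraph.cls_interchange, ← h, ← h', ← Nat.cast_mul, units_smul_eq]
    | hz => simp
    | ha x y hx hy => simp only [map_add, hx, hy, smul_add]
    | hs c x hx => simp only [map_smul, hx, smul_comm c]
  | hz => simp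
  | ha x y hx hy => simp only [map_add, LinearMap.add_apply, hx, hy, smul_add]
  | hs c x hx => simp only [map_smul, LinearMap.smul_apply, hx, smul_comm c]

theorem M_isProp : (M k).IsProp where
  d_mem _ _ _ _ hx := Md_mem k hx
  d_d _ _ x := Md_Md k x
  relabel_mem e f _ _ hx := Mrelabel_mem k e f hx
  relabel_d e f x := Md_relabel k e f x
  relabel_refl x := Mrelabel_refl k x
  relabel_trans e e' f f' x := Mrelabel_trans k e e' f f' x
  one_mem n := cls_mem' k (by rw [degree_one]; rfl)
  one_d n := Md_one k n
  vcomp_mem m n p _ _ _ hx _ hy := join_mem (Mvcomp_join k) hx hy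
  vcomp_d m n p _ _ hx y := Md_join (Mvcomp_join k) hx y
  hcomp_mem m n m' n' _ _ _ hx _ hy := join_mem (Mhcomp_join k) hx hy
  hcomp_d m n m' n' _ _ hx y := Md_join (Mhcomp_join k) hx y
  vcomp_assoc _ _ _ _ x y z := Mvcomp_assoc k x y z
  one_vcomp _ _ x := Mone_vcomp k x
  vcomp_one _ _ x := Mvcomp_one k x
  vcomp_relabel e f g x y := Mvcomp_relabel k e f g x y
  hcomp_assoc _ _ _ _ _ _ x y z := Mhcomp_assoc k x y z
  one_hcomp _ _ x := Mone_hcomp k x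
  hcomp_one _ _ x := Mhcomp_one k x
  hcomp_relabel e₁ f₁ e₂ f₂ x y := Mhcomp_relabel k e₁ f₁ e₂ f₂ x y
  hcomp_comm _ _ _ _ i j _ hx _ hy := Mhcomp_comm k i j hx hy
  one_hcomp_one m n := Mone_hcomp_one k m n
  interchange _ _ _ _ _ _ i j x _ hx' _ hy y' := Minterchange k i j x hx' hy y'

end Laws

/-! ### Koszul signs on homogeneous elements -/

section Koszul

variable {k : Type u} [CommRing k]
variable {A : Type v} [AddCommGroup A] [Module k A] (gA : ℤ → Submodule k A)
  [DirectSum.Decomposition gA]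
variable {B : Type v} [AddCommGroup B] [Module k B] (gB : ℤ → Submodule k B)
  [DirectSum.Decomposition gB]

theorem koszulSign_of_mem {i : ℤ} {a : A} (ha : a ∈ gA i) :
    koszulSign gA a = ((i.negOnePow : ℤˣ) : ℤ) • a := by
  lift a to gA i using ha
  rw [koszulSign, LinearMap.comp_apply, LinearEquiv.coe_coe, DirectSum.decomposeLinearEquiv_apply,
    DirectSum.decompose_coe, ← DirectSum.lof_eq_of k, DirectSum.toModule_lof]
  rfl

/-- `koszulSwap` passes through the decompositions into degrees. A homogeneous element has a single
component, on which the graded braiding is explicit. -/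
theorem koszulSwap_of_mem {i j : ℤ} {a : A} (ha : a ∈ gA i) {b : B} (hb : b ∈ gB j) :
    koszulSwap gA gB (a ⊗ₜ[k] b) = (((i * j).negOnePow : ℤˣ) : ℤ) • (b ⊗ₜ[k] a) := by
  lift a to gA i using ha
  lift b to gB j using hb
  rw [koszulSwap]
  simp only [LinearMap.comp_apply, LinearEquiv.coe_coe, TensorProduct.congr_tmul,
    DirectSum.decomposeLinearEquiv_apply, DirectSum.decompose_coe]
  rw [← DirectSum.lof_eq_of k, ← DirectSum.lof_eq_of k, TensorProduct.gradedComm_of_tmul_of,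
    Units.smul_def]
  refine (map_zsmul _ _ _).trans ?_
  rw [TensorProduct.congr_tmul, mul_comm, ← Int.negOnePow_def]
  refine congrArg (_ • ·) (congrArg₂ (· ⊗ₜ[k] ·) ((LinearEquiv.symm_apply_eq _).2 ?_)
    ((LinearEquiv.symm_apply_eq _).2 ?_)) <;>
  · rw [DirectSum.decomposeLinearEquiv_apply, DirectSum.decompose_coe, DirectSum.lof_eq_of]

/-- The braiding of the two middle factors. -/
def midSwap : (A ⊗[k] A) ⊗[k] (B ⊗[k] B) →ₗ[k] (A ⊗[k] B) ⊗[k] (A ⊗[k] B) :=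
  (TensorProduct.assoc k A B (A ⊗[k] B)).symm.toLinearMap ∘ₗ
    LinearMap.lTensor A
      ((TensorProduct.assoc k B A B).toLinearMap ∘ₗ
        LinearMap.rTensor B (koszulSwap gA gB) ∘ₗ
        (TensorProduct.assoc k A B B).symm.toLinearMap) ∘ₗ
    (TensorProduct.assoc k A A (B ⊗[k] B)).toLinearMap

theorem tensorComul_tmul (cA : A →ₗ[k] A ⊗[k] A) (cB : B →ₗ[k] B ⊗[k] B) (a : A) (b : B) :
    tensorComul gA gB cA cB (a ⊗ₜ[k] b) = midSwap gA gB (cA a ⊗ₜ[k] cB b) := rfl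

theorem midSwap_of_mem {i j : ℤ} (a : A) {a' : A} (ha : a' ∈ gA i) {b : B} (hb : b ∈ gB j)
    (b' : B) : midSwap gA gB ((a ⊗ₜ[k] a') ⊗ₜ[k] (b ⊗ₜ[k] b')) =
      (((i * j).negOnePow : ℤˣ) : ℤ) • ((a ⊗ₜ[k] b) ⊗ₜ[k] (a' ⊗ₜ[k] b')) := by
  simp only [midSwap, LinearMap.comp_apply, LinearEquiv.coe_coe, TensorProduct.assoc_tmul,
    LinearMap.lTensor_tmul, TensorProduct.assoc_symm_tmul, LinearMap.rTensor_tmul]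
  rw [koszulSwap_of_mem gA gB ha hb, zsmul_tmul, map_zsmul, tmul_zsmul, map_zsmul]
  rfl

end Koszul

/-! ### The coproduct and the counit on ordered graphs -/

section Comul

variable (k : Type u) [CommRing k] {m m' n n' p : ℕ}

/-- The value prescribed for the coproduct of a graph. -/
def comulQ (Γ : OGraph m n) : MHom k m n ⊗[k] MHom k m n :=
  TensorProduct.map (charQ k Γ) (charQ k Γ) (serre k Γ.Prods (cell k fun _ => Cell.I))

/-- The coproduct of a face graph uses its own, smaller cube. By naturality of the Serre coproduct
it can be computed in the cube of Γ, which makes the coproducts of all faces comparable. -/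
theorem comulQ_face (Γ : OGraph m n) {c : Fin Γ.N → Cell} (h : Γ.Valid c) :
    comulQ k (Γ.face c) =
      TensorProduct.map (faceQ k Γ) (faceQ k Γ) (serre k _ (cell k c)) := by
  rw [comulQ, charQ_face, TensorProduct.map_comp, LinearMap.comp_apply,
    ← serre_extend k (Γ.faceVal_strictMono c) h.ne_I, OGraph.extend_top]

theorem comulQ_eq (Γ : OGraph m n) :
    comulQ k Γ = TensorProduct.map (faceQ k Γ) (faceQ k Γ) (serre k _ (cell k Γ.top)) := by
  conv_lhs => rw [← Γ.face_top]
  exact comulQ_face k Γ Γ.valid_top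

theorem comulQ_eq_sum (Γ : OGraph m n) :
    comulQ k Γ = ∑ t ∈ serreTerms Γ.top, (serreSign t : k) •
      (cls k (Γ.face fun v => (t v).1) ⊗ₜ[k] cls k (Γ.face fun v => (t v).2)) := by
  rw [comulQ_eq, serre_cell_cast, map_sum]
  refine Finset.sum_congr rfl fun t _ => ?_
  rw [map_smul, cellPair, TensorProduct.map_tmul, faceQ_cell, faceQ_cell]

theorem comulQ_cubeFace (Γ : OGraph m n) (x : Γ.Prods → Cell) :
    comulQ k (Γ.cubeFace x) =
      TensorProduct.map (charQ k Γ) (charQ k Γ) (serre k _ (cell k x)) := by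
  rw [Γ.cubeFace_eq x Γ.top, comulQ_face k Γ (Γ.valid_extend x),
    serre_extend k (Subtype.strictMono_coe _) OGraph.top_ne_I, charQ_eq, TensorProduct.map_comp,
    LinearMap.comp_apply]

/-- The coproduct before passing to the quotient. -/
def freeComul (m n : ℕ) : FreeMod k m n →ₗ[k] MHom k m n ⊗[k] MHom k m n :=
  Finsupp.linearCombination k (comulQ k)

theorem freeComul_ofGraph (Γ : OGraph m n) : freeComul k m n (ofGraph k Γ) = comulQ k Γ := by
  rw [freeComul, ofGraph, Finsupp.linearCombination_single, one_smul]

/-- Each cell is the top cell of a face graph, so a coproduct prescribed on top cells agrees with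
the Serre coproduct on the whole cube. The coalgebra axioms are inherited through this identity. -/
theorem freeComul_freeChar (Γ : OGraph m n) (c : CubeChain k Γ.Prods) :
    freeComul k m n (freeChar k Γ c) =
      TensorProduct.map (charQ k Γ) (charQ k Γ) (serre k _ c) := by
  have h : freeComul k m n ∘ₗ freeChar k Γ =
      TensorProduct.map (charQ k Γ) (charQ k Γ) ∘ₗ serre k _ := cubeChain_ext fun x => by
    rw [LinearMap.comp_apply, LinearMap.comp_apply, freeChar_cell, freeComul_ofGraph,
      comulQ_cubeFace]
  exact LinearMap.congr_fun h c

theorem tensorD_charQ (Γ : OGraph m n) (c : CubeChain k Γ.Prods ⊗[k] CubeChain k Γ.Prods) :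
    tensorD (MDeg k m n) (Md k m n) (Md k m n) (TensorProduct.map (charQ k Γ) (charQ k Γ) c) =
      TensorProduct.map (charQ k Γ) (charQ k Γ) (cubeD₂ k c) := by
  have h₁ : Md k m n ∘ₗ charQ k Γ = charQ k Γ ∘ₗ cubeD k _ :=
    LinearMap.ext fun c => Md_charQ k Γ c
  -- The dimension of a cell is the degree of its face graph, so the two sign involutions
  -- correspond.
  have h₂ : koszulSign (MDeg k m n) ∘ₗ charQ k Γ = charQ k Γ ∘ₗ cubeSign k :=
    cubeChain_ext fun x => by
      rw [LinearMap.comp_apply, LinearMap.comp_apply, cubeSign_cell,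
        koszulSign_of_mem _ (charQ_mem k Γ x), map_zsmul, Int.coe_negOnePow_natCast, cellSign_eq]
  rw [tensorD, cubeD₂, LinearMap.add_apply, LinearMap.add_apply, map_add]
  congr 1
  · rw [← LinearMap.comp_apply, ← LinearMap.comp_apply, ← TensorProduct.map_comp,
      ← TensorProduct.map_comp, h₁, LinearMap.comp_id, LinearMap.id_comp]
  · rw [← LinearMap.comp_apply, ← LinearMap.comp_apply, ← TensorProduct.map_comp,
      ← TensorProduct.map_comp, h₁, h₂]

theorem freeComul_freeD (x : FreeMod k m n) :
    freeComul k m n (freeD k x) =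
      tensorD (MDeg k m n) (Md k m n) (Md k m n) (freeComul k m n x) := by
  have h : freeComul k m n ∘ₗ freeD k =
      tensorD (MDeg k m n) (Md k m n) (Md k m n) ∘ₗ freeComul k m n := freeMod_ext fun Γ => by
    rw [LinearMap.comp_apply, LinearMap.comp_apply, freeD_ofGraph, freeComul_freeChar,
      freeComul_ofGraph, comulQ, tensorD_charQ, serre_cubeD]
  exact LinearMap.congr_fun h x

theorem comulQ_relabel (e : Fin m ≃ Fin m') (f : Fin n ≃ Fin n') (Γ : OGraph m n) :
    comulQ k (Γ.relabel e f) =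
      TensorProduct.map (Mrelabel k e f) (Mrelabel k e f) (comulQ k Γ) := by
  refine (congrArg (fun f => TensorProduct.map f f (serre k Γ.Prods (cell k fun _ => Cell.I)))
    (charQ_relabel k e f Γ)).trans ?_
  rw [TensorProduct.map_comp]
  rfl

theorem permSign_face_top (Γ : OGraph m n) {N' : ℕ} (e : Fin Γ.N ≃ Fin N') {c : Fin Γ.N → Cell}
    (h : Γ.Valid c) : (Γ.face c).reorderSign e = permSign e c := by
  have key : ∀ v, (Γ.face c).top v = .I ↔ c v = .I := fun v =>
    OGraph.top_eq_I.trans (OGraph.isProd_face.trans ⟨fun h => h.1, fun h' => ⟨h', h v h'⟩⟩)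
  refine (OGraph.reorderSign_eq (Γ.face c) e).trans ?_
  refine Finset.prod_congr rfl fun v _ => Finset.prod_congr rfl fun w _ => ?_
  exact if_congr (and_congr Iff.rfl (and_congr (key v) (key w))) rfl rfl

theorem Cell.comul_I {c : Cell} {b : Cell × Cell} (h : b ∈ c.comul) :
    (b.1 = .I → c = .I) ∧ (b.2 = .I → c = .I) := by
  obtain ⟨a, b⟩ := b
  rw [Cell.mem_comul_iff] at h
  rcases h with ⟨rfl, rfl, rfl⟩ | ⟨rfl, rfl, rfl⟩ | ⟨rfl, rfl, rfl⟩ | ⟨rfl, rfl, rfl⟩ <;> simp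

theorem OGraph.valid_fst {Γ : OGraph m n} {t : Fin Γ.N → Cell × Cell}
    (ht : t ∈ serreTerms Γ.top) : Γ.Valid fun v => (t v).1 :=
  fun v hv => OGraph.top_eq_I.1 ((Cell.comul_I (mem_serreTerms.1 ht v)).1 hv)

theorem OGraph.valid_snd {Γ : OGraph m n} {t : Fin Γ.N → Cell × Cell}
    (ht : t ∈ serreTerms Γ.top) : Γ.Valid fun v => (t v).2 :=
  fun v hv => OGraph.top_eq_I.1 ((Cell.comul_I (mem_serreTerms.1 ht v)).2 hv)

theorem sum_serreTerms_comp_symm {ι κ A : Type*} [Fintype ι] [Fintype κ] [AddCommMonoid A]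
    [DecidableEq ι] [DecidableEq κ] (e : ι ≃ κ) (x : ι → Cell) (f : (κ → Cell × Cell) → A) :
    ∑ t ∈ Fintype.piFinset (fun i => ((x ∘ e.symm) i).comul), f t =
      ∑ t ∈ Fintype.piFinset (fun i => (x i).comul), f (t ∘ e.symm) := by
  symm
  refine Finset.sum_nbij' (fun t => t ∘ e.symm) (fun t => t ∘ e) ?_ ?_ ?_ ?_ ?_
  · intro t ht
    rw [Fintype.mem_piFinset] at ht ⊢
    exact fun i => ht _
  · intro t ht
    rw [Fintype.mem_piFinset] at ht ⊢
    intro i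
    simpa using ht (e i)
  · intro t _
    funext i
    simp
  · intro t _
    funext i
    simp
  · intro t _
    rfl

/-- In every term both faces are reordered, each with its own permutation sign. Together with the
changed Serre sign these give the sign of Γ, by `serreSign_comp_symm`. -/
theorem comulQ_reorder (Γ : OGraph m n) {N' : ℕ} (e : Fin Γ.N ≃ Fin N') :
    comulQ k (Γ.reorder e) = (Γ.reorderSign e : k) • comulQ k Γ := by
  rw [comulQ_eq_sum, comulQ_eq_sum, Finset.smul_sum]
  refine (sum_serreTerms_comp_symm e Γ.top _).trans (Finset.sum_congr rfl fun t ht => ?_)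
  have key : ∀ c : Fin Γ.N → Cell, Γ.Valid c →
      cls k ((Γ.reorder e).face (c ∘ e.symm)) = (permSign e c : k) • cls k (Γ.face c) := by
    intro c hc
    rw [Γ.face_reorder e c, cls_reorder k (Γ.face c) e, ← permSign_face_top Γ e hc,
      Int.cast_smul_eq_zsmul]
  have h₁ := key _ (OGraph.valid_fst ht)
  have h₂ := key _ (OGraph.valid_snd ht)
  refine (congrArg₂ (fun a b => (serreSign (t ∘ e.symm) : k) • (a ⊗ₜ[k] b)) h₁ h₂).trans ?_
  rw [TensorProduct.smul_tmul_smul, smul_smul, smul_smul, Γ.reorderSign_eq]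
  congr 1
  rw [← Int.cast_mul, ← Int.cast_mul, ← Int.cast_mul]
  exact congrArg Int.cast (serreSign_comp_symm e ht)

section Join

variable {k} {a b c d : ℕ} {J : Joining a b c d m n}
  {B : MHom k a b →ₗ[k] MHom k c d →ₗ[k] MHom k m n}

theorem fst_append {a b : ℕ} (t : Fin a → Cell × Cell) (u : Fin b → Cell × Cell) :
    (fun v => (Fin.append t u v).1) = Fin.append (fun v => (t v).1) (fun v => (u v).1) := by
  funext v
  induction v using Fin.addCases <;> simp

theorem snd_append {a b : ℕ} (t : Fin a → Cell × Cell) (u : Fin b → Cell × Cell) :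
    (fun v => (Fin.append t u v).2) = Fin.append (fun v => (t v).2) (fun v => (u v).2) := by
  funext v
  induction v using Fin.addCases <;> simp

/-- Terms for the join are pairs of terms for `x` and `y`. The additional factor of
`serreSign_append` is the sign produced by `midSwap`. -/
theorem comulQ_join (hB : ∀ x y, B (cls k x) (cls k y) = cls k (J.join x y))
    (x : OGraph a b) (y : OGraph c d) : comulQ k (J.join x y) =
      TensorProduct.map (TensorProduct.lift B) (TensorProduct.lift B)
        (midSwap (MDeg k a b) (MDeg k c d) (comulQ k x ⊗ₜ[k] comulQ k y)) := by
  have h : comulQ k (J.join x y) = TensorProduct.map (joinFaceQ k J x y) (joinFaceQ k J x y)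
      (serre k _ (cell k (Fin.append x.top y.top))) := by
    rw [comulQ_eq, J.top_join]
    rfl
  rw [h, serre_cell_cast, sum_serreTerms_append, comulQ_eq_sum k x, comulQ_eq_sum k y, map_sum,
    TensorProduct.sum_tmul, map_sum, map_sum]
  refine Finset.sum_congr rfl fun t ht => ?_
  rw [TensorProduct.tmul_sum, map_sum, map_sum, map_sum]
  refine Finset.sum_congr rfl fun u hu => ?_
  -- The two middle tensor factors are homogeneous, with degrees given by the dimensions of their
  -- cells.
  have h₁ := cls_mem' k (i := (cellDim fun v => (t v).2 : ℕ))
    (congrArg Nat.cast (OGraph.degree_face (OGraph.valid_snd ht)))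
  have h₂ := cls_mem' k (i := (cellDim fun v => (u v).1 : ℕ))
    (congrArg Nat.cast (OGraph.degree_face (OGraph.valid_fst hu)))
  rw [TensorProduct.smul_tmul_smul, map_smul, map_smul, map_smul, midSwap_of_mem _ _ _ h₁ h₂,
    ← Nat.cast_mul, Int.coe_negOnePow_natCast, ← Int.cast_smul_eq_zsmul k, map_smul, smul_smul,
    TensorProduct.map_tmul, TensorProduct.lift.tmul, TensorProduct.lift.tmul, cellPair,
    TensorProduct.map_tmul, fst_append, snd_append, joinFaceQ_append hB, joinFaceQ_append hB,
    faceQ_cell, faceQ_cell, faceQ_cell, faceQ_cell, serreSign_append]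
  congr 1
  push_cast
  rfl

end Join

/-- The cube is a point, so the graph is grouplike. This settles the defining relations between
graphs without products. -/
theorem comulQ_of_degree_eq_zero (Γ : OGraph m n) (h : Γ.degree = 0) :
    comulQ k Γ = cls k Γ ⊗ₜ[k] cls k Γ := by
  have := Fintype.card_eq_zero_iff.1 h
  have hs : serreTerms (fun _ : Γ.Prods => Cell.I) = {fun _ => (.I, .I)} := by
    ext t
    rw [mem_serreTerms, Finset.mem_singleton]
    exact ⟨fun _ => Subsingleton.elim _ _, fun _ i => isEmptyElim i⟩
  rw [comulQ, serre_cell, hs, Finset.sum_singleton, serreSign, Fintype.prod_empty, one_smul,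
    cellPair, TensorProduct.map_tmul, charQ_cell, Γ.cubeFace_top]

/-- The coproduct is ι[0] ⊗ Γ + Γ ⊗ ι[1], and the class of Γ is a factor of both terms. This is what
the relation ε ∘ * = 0 requires. -/
theorem comulQ_of_degree_eq_one (Γ : OGraph m n) (h : Γ.degree = 1) (h₀ : cls k Γ = 0) :
    comulQ k Γ = 0 := by
  obtain ⟨v, hv⟩ := Fintype.card_eq_one_iff.1 h
  have key : ∀ x : Γ.Prods → Cell, x v = .I → charQ k Γ (cell k x) = 0 := by
    intro x hx
    have : x = fun _ => .I := funext fun w => by rw [hv w, hx]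
    rw [charQ_cell, this, Γ.cubeFace_top, h₀]
  rw [comulQ, serre_cell_cast, map_sum]
  refine Finset.sum_eq_zero fun t ht => ?_
  rw [map_smul, cellPair, TensorProduct.map_tmul]
  have := mem_serreTerms.1 ht v
  simp only [Cell.comul, Finset.mem_insert, Finset.mem_singleton] at this
  rcases this with h | h
  · rw [key (fun i => (t i).2) (by rw [h]), TensorProduct.tmul_zero, smul_zero]
  · rw [key (fun i => (t i).1) (by rw [h]), TensorProduct.zero_tmul, smul_zero]

/-- The counit before passing to the quotient. -/
def freeCounit (m n : ℕ) : FreeMod k m n →ₗ[k] k := Finsupp.linearCombination k (graphCounit k)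

theorem freeCounit_ofGraph (Γ : OGraph m n) :
    freeCounit k m n (ofGraph k Γ) = graphCounit k Γ := by
  rw [freeCounit, ofGraph, Finsupp.linearCombination_single, one_smul]

theorem graphCounit_cubeFace (Γ : OGraph m n) (x : Γ.Prods → Cell) :
    graphCounit k (Γ.cubeFace x) = cubeCounit k (cell k x) := by
  rw [graphCounit, Γ.degree_cubeFace, cubeCounit_cell, ← ite_not]
  refine if_congr ?_ rfl rfl
  rw [cellDim, Finset.card_eq_zero, Finset.filter_eq_empty_iff]
  simp

theorem freeCounit_freeChar (Γ : OGraph m n) (c : CubeChain k Γ.Prods) :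
    freeCounit k m n (freeChar k Γ c) = cubeCounit k c := by
  have h : freeCounit k m n ∘ₗ freeChar k Γ = cubeCounit k := cubeChain_ext fun x => by
    rw [LinearMap.comp_apply, freeChar_cell, freeCounit_ofGraph, graphCounit_cubeFace]
  exact LinearMap.congr_fun h c

/-- Two opposite faces have intervals at the same coordinates, so the counit takes the same value on
both. -/
theorem cubeCounit_cubeD {ι : Type} [Fintype ι] [LinearOrder ι] (c : CubeChain k ι) :
    cubeCounit k (cubeD k ι c) = 0 := by
  have h : cubeCounit k ∘ₗ cubeD k ι = 0 := ?_
  · exact LinearMap.congr_fun h c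
  refine cubeChain_ext fun x => ?_
  rw [LinearMap.comp_apply, cubeD_cell, map_sum, LinearMap.zero_apply]
  refine Finset.sum_eq_zero fun i _ => ?_
  split_ifs with hi
  · rw [map_zsmul, map_sub, cubeCounit_cell, cubeCounit_cell]
    have key : ∀ b, b ≠ Cell.I →
        ((∃ j, Function.update x i b j = .I) ↔ ∃ j, j ≠ i ∧ x j = .I) := by
      intro b hb
      refine exists_congr fun j => ?_
      by_cases hj : j = i
      · subst hj; simp [hb]
      · simp [hj]
    simp only [key .one (by simp), key .zero (by simp), sub_self, smul_zero]
  · exact map_zero _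

theorem freeCounit_freeD (x : FreeMod k m n) : freeCounit k m n (freeD k x) = 0 := by
  have h : freeCounit k m n ∘ₗ freeD k = 0 := freeMod_ext fun Γ => by
    rw [LinearMap.comp_apply, freeD_ofGraph, freeCounit_freeChar, cubeCounit_cubeD,
      LinearMap.zero_apply]
  exact LinearMap.congr_fun h x

theorem graphCounit_join {a b c d : ℕ} (J : Joining a b c d m n) (x : OGraph a b)
    (y : OGraph c d) : graphCounit k (J.join x y) = graphCounit k x * graphCounit k y := by
  simp only [graphCounit, J.degree_join, Nat.add_eq_zero_iff]
  split_ifs <;> simp_all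

end Comul

/-! ### Maps vanishing on the ideal -/

section Vanish

variable (k : Type u) [CommRing k] {m m' n n' p : ℕ}

theorem freePart_ofGraph (i : ℤ) (Γ : OGraph m n) :
    freePart k i (ofGraph k Γ) = if (Γ.degree : ℤ) = i then ofGraph k Γ else 0 := by
  rw [freePart, ofGraph, Finsupp.linearCombination_single, one_smul]
  rfl

theorem freePart_apply (i : ℤ) (x : FreeMod k m n) (Γ : OGraph m n) :
    freePart k i x Γ = if (Γ.degree : ℤ) = i then x Γ else 0 := by
  classical
  induction x using Finsupp.induction_linear with
  | zero => simp
  | add x y hx hy => rw [map_add, Finsupp.add_apply, hx, hy, Finsupp.add_apply]; split_ifs <;> simp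
  | single Δ c =>
    rw [freePart, Finsupp.linearCombination_single, Finsupp.smul_apply]
    by_cases h : Δ = Γ
    · subst h
      split_ifs <;> simp [ofGraph]
    · split_ifs <;> simp [ofGraph, h]

theorem sum_freePart (x : FreeMod k m n) :
    ∑ i ∈ x.support.image (fun Γ => (Γ.degree : ℤ)), freePart k i x = x := by
  classical
  ext Γ
  rw [Finsupp.finsetSum_apply]
  simp only [freePart_apply]
  rw [Finset.sum_ite_eq]
  split_ifs with h
  · rfl
  · by_contra h'
    exact h (Finset.mem_image_of_mem _ (Finsupp.mem_support_iff.2 (Ne.symm h')))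

theorem freePart_freePart (i j : ℤ) (x : FreeMod k m n) :
    freePart k i (freePart k j x) = if i = j then freePart k j x else 0 := by
  ext Γ
  rw [freePart_apply, freePart_apply]
  split_ifs with h₁ h₂ h₃ h₃ <;> simp_all [freePart_apply]

theorem freePart_freeD (i : ℤ) (x : FreeMod k m n) :
    freePart k i (freeD k x) = freeD k (freePart k (i + 1) x) := by
  have h : (freePart k i : FreeMod k m n →ₗ[k] _) ∘ₗ freeD k =
      freeD k ∘ₗ freePart k (i + 1) := freeMod_ext fun Γ => by
    have key : ∀ x : Γ.Prods → Cell, cellDim x + 1 = Γ.degree →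
        freePart k i (freeChar k Γ (cell k x)) =
          if (Γ.degree : ℤ) = i + 1 then freeChar k Γ (cell k x) else 0 := by
      intro x hx
      rw [freeChar_cell, freePart_ofGraph, Γ.degree_cubeFace]
      exact if_congr (by omega) rfl rfl
    have key' : ∀ (r : ℤ) (x y : Γ.Prods → Cell), cellDim x + 1 = Γ.degree →
        cellDim y + 1 = Γ.degree → freePart k i (freeChar k Γ (r • (cell k x - cell k y))) =
          if (Γ.degree : ℤ) = i + 1 then freeChar k Γ (r • (cell k x - cell k y)) else 0 := by
      intro r x y hx hy
      rw [map_zsmul, map_zsmul, map_sub, map_sub, key x hx, key y hy]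
      split_ifs
      · rfl
      · rw [sub_zero, smul_zero]
    rw [LinearMap.comp_apply, LinearMap.comp_apply, freePart_ofGraph, freeD_ofGraph, cubeD_cell,
      map_sum, map_sum]
    by_cases hd : (Γ.degree : ℤ) = i + 1
    · rw [if_pos hd, freeD_ofGraph, cubeD_cell, map_sum]
      refine Finset.sum_congr rfl fun v _ => ?_
      rw [if_pos rfl]
      exact (key' _ _ _ ((cellDim_update rfl (by simp)).trans (cellDim_I Γ))
        ((cellDim_update rfl (by simp)).trans (cellDim_I Γ))).trans (if_pos hd)
    · rw [if_neg hd, map_zero]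
      refine Finset.sum_eq_zero fun v _ => ?_
      rw [if_pos rfl]
      exact (key' _ _ _ ((cellDim_update rfl (by simp)).trans (cellDim_I Γ))
        ((cellDim_update rfl (by simp)).trans (cellDim_I Γ))).trans (if_neg hd)
  exact LinearMap.congr_fun h x

theorem freeRelabel_ofGraph (e : Fin m ≃ Fin m') (f : Fin n ≃ Fin n') (Γ : OGraph m n) :
    freeRelabel k e f (ofGraph k Γ) = ofGraph k (Γ.relabel e f) := Finsupp.mapDomain_single

theorem freePart_freeRelabel (e : Fin m ≃ Fin m') (f : Fin n ≃ Fin n') (i : ℤ)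
    (x : FreeMod k m n) :
    freePart k i (freeRelabel k e f x) = freeRelabel k e f (freePart k i x) := by
  have h : freePart k i ∘ₗ freeRelabel k e f = freeRelabel k e f ∘ₗ freePart k i :=
    freeMod_ext fun Γ => by
      rw [LinearMap.comp_apply, LinearMap.comp_apply, freeRelabel_ofGraph, freePart_ofGraph,
        freePart_ofGraph, ← freeRelabel_ofGraph, ← map_zero (freeRelabel k e f), ← apply_ite]
      rfl
  exact LinearMap.congr_fun h x

section Join

variable {k} {a b c d : ℕ} {J : Joining a b c d m n}
  {F : FreeMod k a b →ₗ[k] FreeMod k c d →ₗ[k] FreeMod k m n}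

/-- Joining with a graph shifts degrees by a fixed amount; joining with an arbitrary element would
not. -/
theorem freePart_join_left
    (hF : ∀ x y, F (ofGraph k x) (ofGraph k y) = ofGraph k (J.join x y)) (i : ℤ)
    (x : FreeMod k a b) (y : OGraph c d) :
    freePart k i (F x (ofGraph k y)) = F (freePart k (i - y.degree) x) (ofGraph k y) := by
  have h : freePart k i ∘ₗ F.flip (ofGraph k y) =
      F.flip (ofGraph k y) ∘ₗ freePart k (i - y.degree) := freeMod_ext fun x => by
    rw [LinearMap.comp_apply, LinearMap.comp_apply, LinearMap.flip_apply, hF, freePart_ofGraph,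
      freePart_ofGraph, J.degree_join]
    by_cases hx : (x.degree : ℤ) = i - y.degree
    · rw [if_pos hx, if_pos (by push_cast; omega), LinearMap.flip_apply, hF]
    · rw [if_neg hx, if_neg (by push_cast; omega), map_zero]
  exact LinearMap.congr_fun h x

theorem freePart_join_right
    (hF : ∀ x y, F (ofGraph k x) (ofGraph k y) = ofGraph k (J.join x y)) (i : ℤ)
    (x : OGraph a b) (y : FreeMod k c d) :
    freePart k i (F (ofGraph k x) y) = F (ofGraph k x) (freePart k (i - x.degree) y) := by
  have h : freePart k i ∘ₗ F (ofGraph k x) =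
      F (ofGraph k x) ∘ₗ freePart k (i - x.degree) := freeMod_ext fun y => by
    rw [LinearMap.comp_apply, LinearMap.comp_apply, hF, freePart_ofGraph,
      freePart_ofGraph, J.degree_join]
    by_cases hy : (y.degree : ℤ) = i - x.degree
    · rw [if_pos hy, if_pos (by push_cast; omega), hF]
    · rw [if_neg hy, if_neg (by push_cast; omega), map_zero]
  exact LinearMap.congr_fun h y

end Join

/-- Every relation is homogeneous: reordering preserves the number of products, and `decide` counts
them in the explicit graphs. -/
theorem exists_degree_of_rel {x : FreeMod k m n} (h : Rel k m n x) :
    ∃ d : ℤ, ∀ i, freePart k i x = if d = i then x else 0 := by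
  have key : ∀ {m n : ℕ} (Γ Γ' : OGraph m n) (r : ℤ), Γ.degree = Γ'.degree → ∀ i,
      freePart k i (ofGraph k Γ - r • ofGraph k Γ') =
        if (Γ'.degree : ℤ) = i then ofGraph k Γ - r • ofGraph k Γ' else 0 := by
    intro m n Γ Γ' r h i
    rw [map_sub, map_zsmul, freePart_ofGraph, freePart_ofGraph, h]
    split_ifs <;> simp
  have key' : ∀ {m n : ℕ} (Γ Γ' : OGraph m n), Γ.degree = Γ'.degree →
      ∃ d : ℤ, ∀ i, freePart k i (ofGraph k Γ - ofGraph k Γ') =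
        if d = i then ofGraph k Γ - ofGraph k Γ' else 0 := by
    intro m n Γ Γ' h
    exact ⟨Γ'.degree, fun i => by simpa using key Γ Γ' 1 h i⟩
  cases h with
  | reorder Γ e => exact ⟨Γ.degree, key _ _ _ (Γ.degree_reorder e)⟩
  | dproduct => exact key' _ _ (by decide)
  | leftCounit => exact key' _ _ (by decide)
  | rightCounit => exact key' _ _ (by decide)
  | coassoc => exact key' _ _ (by decide)
  | productCounit => exact ⟨_, fun i => freePart_ofGraph k i _⟩

variable {k} in
/-- A family of linear maps vanishes on the ideal if its kernels contain the relations and are closed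
under the operations of the free prop. -/
theorem eq_zero_of_inIdeal {A : ℕ → ℕ → Type*} [∀ m n, AddCommMonoid (A m n)]
    [∀ m n, Module k (A m n)] (φ : ∀ m n, FreeMod k m n →ₗ[k] A m n)
    (hrel : ∀ {m n} (x : FreeMod k m n), Rel k m n x → φ m n x = 0)
    (hd : ∀ {m n} (x : FreeMod k m n), φ m n x = 0 → φ m n (freeD k x) = 0)
    (hr : ∀ {m n m' n'} (e : Fin m ≃ Fin m') (f : Fin n ≃ Fin n') (x : FreeMod k m n),
      φ m n x = 0 → φ m' n' (freeRelabel k e f x) = 0)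
    (hvl : ∀ {m n p} (x : FreeMod k n p) (y : OGraph m n), φ n p x = 0 →
      φ m p (freeVcomp k m n p x (ofGraph k y)) = 0)
    (hvr : ∀ {m n p} (x : OGraph n p) (y : FreeMod k m n), φ m n y = 0 →
      φ m p (freeVcomp k m n p (ofGraph k x) y) = 0)
    (hhl : ∀ {m n m' n'} (x : FreeMod k m n) (y : OGraph m' n'), φ m n x = 0 →
      φ (m + m') (n + n') (freeHcomp k m n m' n' x (ofGraph k y)) = 0)
    (hhr : ∀ {m n m' n'} (x : OGraph m n) (y : FreeMod k m' n'), φ m' n' y = 0 →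
      φ (m + m') (n + n') (freeHcomp k m n m' n' (ofGraph k x) y) = 0)
    {x : FreeMod k m n} (hx : InIdeal k m n x) : φ m n x = 0 := by
  -- An arbitrary second argument is reduced to a graph, so that the degree shift is defined.
  have hspan : ∀ {m n : ℕ} {A : Type _} [AddCommMonoid A] [Module k A] (f : FreeMod k m n →ₗ[k] A),
      (∀ Γ, f (ofGraph k Γ) = 0) → ∀ y, f y = 0 := by
    intro m n A _ _ f hf y
    exact LinearMap.congr_fun (freeMod_ext (f := f) (g := 0) hf) y
  -- The ideal is closed under homogeneous parts, but this is not known of the kernel. The induction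
  -- therefore carries the vanishing on all parts; each operation with a graph only shifts the
  -- degree, and an element is the sum of its parts.
  have key : ∀ i, φ m n (freePart k i x) = 0 := by
    induction hx with
    | rel h =>
      intro i
      obtain ⟨d, hd⟩ := exists_degree_of_rel k h
      rw [hd]
      split_ifs
      · exact hrel _ h
      · exact map_zero _
    | zero => intro i; rw [map_zero, map_zero]
    | add _ _ hx hy => intro i; rw [map_add, map_add, hx, hy, add_zero]
    | smul c _ hx => intro i; rw [map_smul, map_smul, hx, smul_zero]
    | part j _ hx =>
      intro i
      rw [freePart_freePart]
      split_ifs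
      · exact hx j
      · exact map_zero _
    | d _ hx => intro i; rw [freePart_freeD]; exact hd _ (hx _)
    | relabel e f _ hx => intro i; rw [freePart_freeRelabel]; exact hr e f _ (hx i)
    | @vcomp_left m n p x _ y hx =>
      intro i
      refine hspan (φ m p ∘ₗ freePart k i ∘ₗ freeVcomp k m n p x) (fun Γ => ?_) y
      have := freePart_join_left (J := vJoining m n p) (freeVcomp_ofGraph k) i x Γ
      rw [LinearMap.comp_apply, LinearMap.comp_apply, this]
      exact hvl _ _ (hx _)
    | @vcomp_right m n p x y _ hy =>
      intro i
      refine hspan (φ m p ∘ₗ freePart k i ∘ₗ (freeVcomp k m n p).flip y) (fun Γ => ?_) x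
      have := freePart_join_right (J := vJoining m n p) (freeVcomp_ofGraph k) i Γ y
      rw [LinearMap.comp_apply, LinearMap.comp_apply, LinearMap.flip_apply, this]
      exact hvr _ _ (hy _)
    | @hcomp_left m n m' n' x _ y hx =>
      intro i
      refine hspan (φ _ _ ∘ₗ freePart k i ∘ₗ freeHcomp k m n m' n' x) (fun Γ => ?_) y
      have := freePart_join_left (J := hJoining m n m' n') (freeHcomp_ofGraph k) i x Γ
      rw [LinearMap.comp_apply, LinearMap.comp_apply, this]
      exact hhl _ _ (hx _)
    | @hcomp_right m n m' n' x y _ hy =>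
      intro i
      refine hspan (φ _ _ ∘ₗ freePart k i ∘ₗ (freeHcomp k m n m' n').flip y) (fun Γ => ?_) x
      have := freePart_join_right (J := hJoining m n m' n') (freeHcomp_ofGraph k) i Γ y
      rw [LinearMap.comp_apply, LinearMap.comp_apply, LinearMap.flip_apply, this]
      exact hhr _ _ (hy _)
  rw [← sum_freePart k x, map_sum]
  exact Finset.sum_eq_zero fun i _ => key i

end Vanish

/-! ### The coalgebra structure of `M` -/

section Hopf

variable (k : Type u) [CommRing k] {m m' n n' p : ℕ}

/-- Both graphs are grouplike and the coproduct takes values in M ⊗ M, where their classes already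
agree. -/
theorem comulQ_sub_eq_zero {Γ Γ' : OGraph m n} (h : Rel k m n (ofGraph k Γ - ofGraph k Γ'))
    (h₁ : Γ.degree = 0) (h₂ : Γ'.degree = 0) :
    freeComul k m n (ofGraph k Γ - ofGraph k Γ') = 0 := by
  have hc : cls k Γ = cls k Γ' := cls_eq_of_rel h
  rw [map_sub, freeComul_ofGraph, freeComul_ofGraph, comulQ_of_degree_eq_zero k Γ h₁,
    comulQ_of_degree_eq_zero k Γ' h₂, hc, sub_self]

theorem freeComul_rel {x : FreeMod k m n} (h : Rel k m n x) : freeComul k m n x = 0 := by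
  have h' := h
  cases h with
  | reorder Γ e =>
    rw [map_sub, map_zsmul, freeComul_ofGraph, freeComul_ofGraph, comulQ_reorder,
      ← Int.cast_smul_eq_zsmul k, sub_self]
  | dproduct => exact comulQ_sub_eq_zero k h' (by decide) (by decide)
  | leftCounit => exact comulQ_sub_eq_zero k h' (by decide) (by decide)
  | rightCounit => exact comulQ_sub_eq_zero k h' (by decide) (by decide)
  | coassoc => exact comulQ_sub_eq_zero k h' (by decide) (by decide)
  | productCounit =>
    rw [freeComul_ofGraph]
    exact comulQ_of_degree_eq_one k _ (by decide)
      ((Submodule.Quotient.mk_eq_zero _).2 (InIdeal.rel h'))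

theorem freeCounit_rel {x : FreeMod k m n} (h : Rel k m n x) : freeCounit k m n x = 0 := by
  have key : ∀ {m n : ℕ} (Γ Γ' : OGraph m n), Γ.degree = 0 → Γ'.degree = 0 →
      freeCounit k m n (ofGraph k Γ - ofGraph k Γ') = 0 := by
    intro m n Γ Γ' h₁ h₂
    rw [map_sub, freeCounit_ofGraph, freeCounit_ofGraph, graphCounit, graphCounit, h₁, h₂,
      sub_self]
  cases h with
  | reorder Γ e =>
    rw [map_sub, map_zsmul, freeCounit_ofGraph, freeCounit_ofGraph, graphCounit, graphCounit,
      Γ.degree_reorder]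
    -- In degree zero there are no inversions, so the sign is one; in positive degree both values
    -- are zero.
    split_ifs with h
    · have := Fintype.card_eq_zero_iff.1 h
      rw [OGraph.reorderSign, Finset.univ_eq_empty, Finset.filter_empty, Finset.card_empty,
        pow_zero, one_smul, sub_self]
    · rw [smul_zero, sub_self]
  | dproduct => exact key _ _ (by decide) (by decide)
  | leftCounit => exact key _ _ (by decide) (by decide)
  | rightCounit => exact key _ _ (by decide) (by decide)
  | coassoc => exact key _ _ (by decide) (by decide)
  | productCounit =>
    rw [freeCounit_ofGraph]
    exact if_neg (by decide)

section Join

variable {k} {a b c d : ℕ} {J : Joining a b c d m n}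
  {B : MHom k a b →ₗ[k] MHom k c d →ₗ[k] MHom k m n}
  {F : FreeMod k a b →ₗ[k] FreeMod k c d →ₗ[k] FreeMod k m n}

/-- The right-hand side depends only on the coproducts of `x` and `y`, so the kernel of `freeComul`
is closed under composition with arbitrary elements. -/
theorem freeComul_join (hB : ∀ x y, B (cls k x) (cls k y) = cls k (J.join x y))
    (hF : ∀ x y, F (ofGraph k x) (ofGraph k y) = ofGraph k (J.join x y))
    (x : FreeMod k a b) (y : FreeMod k c d) :
    freeComul k m n (F x y) =
      TensorProduct.map (TensorProduct.lift B) (TensorProduct.lift B)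
        (midSwap (MDeg k a b) (MDeg k c d) (freeComul k a b x ⊗ₜ[k] freeComul k c d y)) := by
  have h : F.compr₂ (freeComul k m n) =
      ((TensorProduct.mk k _ _).compl₁₂ (freeComul k a b) (freeComul k c d)).compr₂
        (TensorProduct.map (TensorProduct.lift B) (TensorProduct.lift B) ∘ₗ
          midSwap (MDeg k a b) (MDeg k c d)) := by
    refine freeMod_ext fun x => freeMod_ext fun y => ?_
    simp only [LinearMap.compr₂_apply, LinearMap.compl₁₂_apply, LinearMap.comp_apply,
      TensorProduct.mk_apply, hF, freeComul_ofGraph, comulQ_join hB]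
  exact LinearMap.congr_fun₂ h x y

theorem freeCounit_join (hF : ∀ x y, F (ofGraph k x) (ofGraph k y) = ofGraph k (J.join x y))
    (x : FreeMod k a b) (y : FreeMod k c d) :
    freeCounit k m n (F x y) = freeCounit k a b x * freeCounit k c d y := by
  have h : F.compr₂ (freeCounit k m n) =
      (LinearMap.mul k k).compl₁₂ (freeCounit k a b) (freeCounit k c d) := by
    refine freeMod_ext fun x => freeMod_ext fun y => ?_
    simp only [LinearMap.compr₂_apply, LinearMap.compl₁₂_apply, LinearMap.mul_apply', hF,
      freeCounit_ofGraph, graphCounit_join]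
  exact LinearMap.congr_fun₂ h x y

end Join

theorem freeComul_freeRelabel (e : Fin m ≃ Fin m') (f : Fin n ≃ Fin n') (x : FreeMod k m n) :
    freeComul k m' n' (freeRelabel k e f x) =
      TensorProduct.map (Mrelabel k e f) (Mrelabel k e f) (freeComul k m n x) := by
  have h : freeComul k m' n' ∘ₗ freeRelabel k e f =
      TensorProduct.map (Mrelabel k e f) (Mrelabel k e f) ∘ₗ freeComul k m n :=
    freeMod_ext fun Γ => by
      rw [LinearMap.comp_apply, LinearMap.comp_apply, freeRelabel_ofGraph, freeComul_ofGraph,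
        freeComul_ofGraph, comulQ_relabel]
  exact LinearMap.congr_fun h x

theorem freeCounit_freeRelabel (e : Fin m ≃ Fin m') (f : Fin n ≃ Fin n') (x : FreeMod k m n) :
    freeCounit k m' n' (freeRelabel k e f x) = freeCounit k m n x := by
  have h : freeCounit k m' n' ∘ₗ freeRelabel k e f = freeCounit k m n :=
    freeMod_ext fun Γ => by
      rw [LinearMap.comp_apply, freeRelabel_ofGraph, freeCounit_ofGraph, freeCounit_ofGraph]
      rfl
  exact LinearMap.congr_fun h x

/-- The coproduct intertwines each operation of the free prop with an operation on tensor squares of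
`M`, which sends zero to zero. -/
theorem freeComul_ideal {x : FreeMod k m n} (hx : x ∈ ideal k m n) : freeComul k m n x = 0 := by
  refine eq_zero_of_inIdeal (A := fun m n => MHom k m n ⊗[k] MHom k m n) (freeComul k) (fun x h => freeComul_rel k h) (fun x h => ?_)
    (fun e f x h => ?_) (fun x y h => ?_) (fun x y h => ?_) (fun x y h => ?_) (fun x y h => ?_) hx
  · rw [freeComul_freeD, h, map_zero]
  · rw [freeComul_freeRelabel, h, map_zero]
  · rw [freeComul_join (Mvcomp_join k) (freeVcomp_ofGraph k), h, TensorProduct.zero_tmul, map_zero,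
      map_zero]
  · rw [freeComul_join (Mvcomp_join k) (freeVcomp_ofGraph k), h, TensorProduct.tmul_zero, map_zero,
      map_zero]
  · rw [freeComul_join (Mhcomp_join k) (freeHcomp_ofGraph k), h, TensorProduct.zero_tmul, map_zero,
      map_zero]
  · rw [freeComul_join (Mhcomp_join k) (freeHcomp_ofGraph k), h, TensorProduct.tmul_zero, map_zero,
      map_zero]

theorem freeCounit_ideal {x : FreeMod k m n} (hx : x ∈ ideal k m n) :
    freeCounit k m n x = 0 := by
  refine eq_zero_of_inIdeal (A := fun _ _ => k) (freeCounit k) (fun x h => freeCounit_rel k h)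
    (fun x h => ?_)
    (fun e f x h => ?_) (fun x y h => ?_) (fun x y h => ?_) (fun x y h => ?_) (fun x y h => ?_) hx
  · rw [freeCounit_freeD]
  · rw [freeCounit_freeRelabel, h]
  · rw [freeCounit_join (J := vJoining _ _ _) (freeVcomp_ofGraph k), h, zero_mul]
  · rw [freeCounit_join (J := vJoining _ _ _) (freeVcomp_ofGraph k), h, mul_zero]
  · rw [freeCounit_join (J := hJoining _ _ _ _) (freeHcomp_ofGraph k), h, zero_mul]
  · rw [freeCounit_join (J := hJoining _ _ _ _) (freeHcomp_ofGraph k), h, mul_zero]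

/-- The coproduct of `M`. -/
def Mcomul (m n : ℕ) : MHom k m n →ₗ[k] MHom k m n ⊗[k] MHom k m n :=
  (ideal k m n).liftQ (freeComul k m n) fun _ hx => freeComul_ideal k hx

/-- The counit of `M`. -/
def Mcounit (m n : ℕ) : MHom k m n →ₗ[k] k :=
  (ideal k m n).liftQ (freeCounit k m n) fun _ hx => freeCounit_ideal k hx

theorem Mcomul_mkQ (x : FreeMod k m n) :
    Mcomul k m n ((ideal k m n).mkQ x) = freeComul k m n x := rfl

theorem Mcounit_mkQ (x : FreeMod k m n) :
    Mcounit k m n ((ideal k m n).mkQ x) = freeCounit k m n x := rfl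

theorem Mcomul_cls (Γ : OGraph m n) : Mcomul k m n (cls k Γ) = comulQ k Γ := by
  rw [cls, Mcomul_mkQ, freeComul_ofGraph]

theorem Mcounit_cls (Γ : OGraph m n) : Mcounit k m n (cls k Γ) = graphCounit k Γ := by
  rw [cls, Mcounit_mkQ, freeCounit_ofGraph]

/-- Together with the next lemma: characteristic maps are morphisms of coalgebras. -/
theorem Mcomul_charQ (Γ : OGraph m n) : Mcomul k m n ∘ₗ charQ k Γ =
    TensorProduct.map (charQ k Γ) (charQ k Γ) ∘ₗ serre k _ := LinearMap.ext fun c => by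
  rw [LinearMap.comp_apply, LinearMap.comp_apply, ← mkQ_freeChar, Mcomul_mkQ, freeComul_freeChar]

theorem Mcounit_charQ (Γ : OGraph m n) : Mcounit k m n ∘ₗ charQ k Γ = cubeCounit k :=
  LinearMap.ext fun c => by
    rw [LinearMap.comp_apply, ← mkQ_freeChar, Mcounit_mkQ, freeCounit_freeChar]

theorem cellDim_add_cellDim {ι : Type} [Fintype ι] [LinearOrder ι] {x : ι → Cell}
    {t : ι → Cell × Cell} (ht : t ∈ serreTerms x) :
    cellDim (fun i => (t i).1) + cellDim (fun i => (t i).2) = cellDim x := by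
  unfold cellDim
  rw [Finset.card_filter, Finset.card_filter, Finset.card_filter, ← Finset.sum_add_distrib]
  refine Finset.sum_congr rfl fun i _ => ?_
  rcases Cell.mem_comul_iff.1 (mem_serreTerms.1 ht i : ((t i).1, (t i).2) ∈ _) with
    ⟨h, h₁, h₂⟩ | ⟨h, h₁, h₂⟩ | ⟨h, h₁, h₂⟩ | ⟨h, h₁, h₂⟩ <;> simp [h, h₁, h₂]

theorem Mcomul_mem {i : ℤ} {x : MHom k m n} (hx : x ∈ MDeg k m n i) :
    Mcomul k m n x ∈ tensorDeg (MDeg k m n) (MDeg k m n) i := by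
  refine MDeg_induction (P := fun x => Mcomul k m n x ∈ tensorDeg (MDeg k m n) (MDeg k m n) i) hx
    (fun Γ h => ?_) (by rw [map_zero]; exact zero_mem _)
    (fun x y hx hy => by rw [map_add]; exact add_mem hx hy)
    (fun c x hx => by rw [map_smul]; exact Submodule.smul_mem _ c hx)
  rw [Mcomul_cls, comulQ, serre_cell_cast, map_sum]
  refine Submodule.sum_mem _ fun t ht => ?_
  rw [map_smul, cellPair, TensorProduct.map_tmul]
  -- The first tensor factor has the dimension of its cell as degree. The second has the
  -- complementary degree, since every interval goes to exactly one factor.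
  refine Submodule.smul_mem _ _ (Submodule.mem_iSup_of_mem (cellDim fun v => (t v).1 : ℤ) ?_)
  refine Submodule.apply_mem_map₂ (TensorProduct.mk k _ _) (charQ_mem k Γ _) ?_
  have hd : i - (cellDim fun v => (t v).1 : ℕ) = (cellDim fun v => (t v).2 : ℕ) := by
    have h₁ := cellDim_add_cellDim ht
    rw [cellDim_I] at h₁
    omega
  rw [hd]
  exact charQ_mem k Γ _

theorem Mcomul_Md (x : MHom k m n) : Mcomul k m n (Md k m n x) =
    tensorD (MDeg k m n) (Md k m n) (Md k m n) (Mcomul k m n x) := by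
  obtain ⟨x, rfl⟩ := (ideal k m n).mkQ_surjective x
  rw [Md_mkQ, Mcomul_mkQ, Mcomul_mkQ, freeComul_freeD]

theorem Mcounit_Md (x : MHom k m n) : Mcounit k m n (Md k m n x) = 0 := by
  obtain ⟨x, rfl⟩ := (ideal k m n).mkQ_surjective x
  rw [Md_mkQ, Mcounit_mkQ, freeCounit_freeD]

theorem Mcounit_of_mem {i : ℤ} (hi : i ≠ 0) {x : MHom k m n} (hx : x ∈ MDeg k m n i) :
    Mcounit k m n x = 0 := by
  refine MDeg_induction (P := fun x => Mcounit k m n x = 0) hx (fun Γ h => ?_) (map_zero _)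
    (fun x y hx hy => by rw [map_add, hx, hy, add_zero])
    (fun c x hx => by rw [map_smul, hx, smul_zero])
  rw [Mcounit_cls]
  exact if_neg (by omega)

/-- Each class of a graph is the image of a top cell under a morphism of coalgebras, so
coassociativity is pushed forward from the cube. The counit laws follow in the same way. -/
theorem Mcomul_coassoc (x : MHom k m n) :
    TensorProduct.assoc k _ _ _ (LinearMap.rTensor _ (Mcomul k m n) (Mcomul k m n x)) =
      LinearMap.lTensor _ (Mcomul k m n) (Mcomul k m n x) := by
  have h : (TensorProduct.assoc k _ _ _).toLinearMap ∘ₗ LinearMap.rTensor _ (Mcomul k m n) ∘ₗ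
      Mcomul k m n = LinearMap.lTensor _ (Mcomul k m n) ∘ₗ Mcomul k m n := ?_
  · exact LinearMap.congr_fun h x
  refine MHom_ext fun Γ => ?_
  simp only [LinearMap.comp_apply, LinearEquiv.coe_coe]
  rw [Mcomul_cls, comulQ]
  have h₁ : LinearMap.rTensor _ (Mcomul k m n) ∘ₗ TensorProduct.map (charQ k Γ) (charQ k Γ) =
      TensorProduct.map (TensorProduct.map (charQ k Γ) (charQ k Γ)) (charQ k Γ) ∘ₗ
        LinearMap.rTensor _ (serre k _) := by
    rw [LinearMap.rTensor, LinearMap.rTensor, ← TensorProduct.map_comp, ← TensorProduct.map_comp,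
      Mcomul_charQ, LinearMap.id_comp, LinearMap.comp_id]
  have h₂ : LinearMap.lTensor _ (Mcomul k m n) ∘ₗ TensorProduct.map (charQ k Γ) (charQ k Γ) =
      TensorProduct.map (charQ k Γ) (TensorProduct.map (charQ k Γ) (charQ k Γ)) ∘ₗ
        LinearMap.lTensor _ (serre k _) := by
    rw [LinearMap.lTensor, LinearMap.lTensor, ← TensorProduct.map_comp, ← TensorProduct.map_comp,
      Mcomul_charQ, LinearMap.id_comp, LinearMap.comp_id]
  rw [← LinearMap.comp_apply (LinearMap.lTensor _ _), h₂,
    ← LinearMap.comp_apply (LinearMap.rTensor _ _), h₁, LinearMap.comp_apply, LinearMap.comp_apply,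
    ← serre_coassoc, ← LinearEquiv.coe_coe, ← LinearEquiv.coe_coe, ← LinearMap.comp_apply,
    ← LinearMap.comp_apply (TensorProduct.map _ _), TensorProduct.map_map_comp_assoc_eq]

theorem Mcounit_left (x : MHom k m n) :
    TensorProduct.lid k _ (LinearMap.rTensor _ (Mcounit k m n) (Mcomul k m n x)) = x := by
  have h : (TensorProduct.lid k _).toLinearMap ∘ₗ LinearMap.rTensor _ (Mcounit k m n) ∘ₗ
      Mcomul k m n = LinearMap.id := ?_
  · exact LinearMap.congr_fun h x
  refine MHom_ext fun Γ => ?_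
  have h₁ : (TensorProduct.lid k _).toLinearMap ∘ₗ LinearMap.rTensor _ (Mcounit k m n) ∘ₗ
      TensorProduct.map (charQ k Γ) (charQ k Γ) =
      charQ k Γ ∘ₗ (TensorProduct.lid k _).toLinearMap ∘ₗ LinearMap.rTensor _ (cubeCounit k) := by
    rw [← Mcounit_charQ k Γ]
    exact TensorProduct.ext' fun x y => by simp
  have h₂ := LinearMap.congr_fun h₁ (serre k _ (cell k fun _ => Cell.I))
  simp only [LinearMap.comp_apply, LinearEquiv.coe_coe] at h₂ ⊢
  rw [Mcomul_cls, comulQ, h₂, serre_counit_left, charQ_cell, Γ.cubeFace_top, LinearMap.id_apply]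

theorem Mcounit_right (x : MHom k m n) :
    TensorProduct.rid k _ (LinearMap.lTensor _ (Mcounit k m n) (Mcomul k m n x)) = x := by
  have h : (TensorProduct.rid k _).toLinearMap ∘ₗ LinearMap.lTensor _ (Mcounit k m n) ∘ₗ
      Mcomul k m n = LinearMap.id := ?_
  · exact LinearMap.congr_fun h x
  refine MHom_ext fun Γ => ?_
  have h₁ : (TensorProduct.rid k _).toLinearMap ∘ₗ LinearMap.lTensor _ (Mcounit k m n) ∘ₗ
      TensorProduct.map (charQ k Γ) (charQ k Γ) =
      charQ k Γ ∘ₗ (TensorProduct.rid k _).toLinearMap ∘ₗ LinearMap.lTensor _ (cubeCounit k) := by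
    rw [← Mcounit_charQ k Γ]
    exact TensorProduct.ext' fun x y => by simp
  have h₂ := LinearMap.congr_fun h₁ (serre k _ (cell k fun _ => Cell.I))
  simp only [LinearMap.comp_apply, LinearEquiv.coe_coe] at h₂ ⊢
  rw [Mcomul_cls, comulQ, h₂, serre_counit_right, charQ_cell, Γ.cubeFace_top, LinearMap.id_apply]

theorem Mcomul_relabel (e : Fin m ≃ Fin m') (f : Fin n ≃ Fin n') (x : MHom k m n) :
    Mcomul k m' n' (Mrelabel k e f x) =
      TensorProduct.map (Mrelabel k e f) (Mrelabel k e f) (Mcomul k m n x) := by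
  obtain ⟨x, rfl⟩ := (ideal k m n).mkQ_surjective x
  exact freeComul_freeRelabel k e f x

theorem Mcounit_relabel (e : Fin m ≃ Fin m') (f : Fin n ≃ Fin n') (x : MHom k m n) :
    Mcounit k m' n' (Mrelabel k e f x) = Mcounit k m n x := by
  obtain ⟨x, rfl⟩ := (ideal k m n).mkQ_surjective x
  exact freeCounit_freeRelabel k e f x

theorem Mcomul_one (n : ℕ) : Mcomul k n n (cls k (OGraph.one n)) =
    cls k (OGraph.one n) ⊗ₜ[k] cls k (OGraph.one n) := by
  rw [Mcomul_cls, comulQ_of_degree_eq_zero k _ (degree_one n)]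

theorem Mcounit_one (n : ℕ) : Mcounit k n n (cls k (OGraph.one n)) = 1 := by
  rw [Mcounit_cls]
  exact if_pos (degree_one n)

section Join

variable {k} {a b c d : ℕ} {J : Joining a b c d m n}
  {B : MHom k a b →ₗ[k] MHom k c d →ₗ[k] MHom k m n}

theorem Mcomul_join (hB : ∀ x y, B (cls k x) (cls k y) = cls k (J.join x y)) :
    Mcomul k m n ∘ₗ TensorProduct.lift B =
      TensorProduct.map (TensorProduct.lift B) (TensorProduct.lift B) ∘ₗ
        tensorComul (MDeg k a b) (MDeg k c d) (Mcomul k a b) (Mcomul k c d) := by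
  refine TensorProduct.ext (MHom_ext fun x => MHom_ext fun y => ?_)
  change Mcomul k m n (B (cls k x) (cls k y)) =
    TensorProduct.map _ _ (tensorComul _ _ _ _ (cls k x ⊗ₜ[k] cls k y))
  rw [hB, tensorComul_tmul, Mcomul_cls, Mcomul_cls, Mcomul_cls, comulQ_join hB]

theorem Mcounit_join (hB : ∀ x y, B (cls k x) (cls k y) = cls k (J.join x y)) (x : MHom k a b)
    (y : MHom k c d) : Mcounit k m n (B x y) = Mcounit k a b x * Mcounit k c d y := by
  have h : B.compr₂ (Mcounit k m n) =
      (LinearMap.mul k k).compl₁₂ (Mcounit k a b) (Mcounit k c d) := by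
    refine MHom_ext fun x => MHom_ext fun y => ?_
    simp only [LinearMap.compr₂_apply, LinearMap.compl₁₂_apply, LinearMap.mul_apply', hB,
      Mcounit_cls, graphCounit_join]
  exact LinearMap.congr_fun₂ h x y

end Join

theorem M_isHopfProp : (M k).IsHopfProp (Mcomul k) (Mcounit k) where
  toIsProp := M_isProp k
  comul_mem _ _ _ _ hx := Mcomul_mem k hx
  comul_d _ _ x := Mcomul_Md k x
  counit_deg _ _ _ hi _ hx := Mcounit_of_mem k hi hx
  counit_d _ _ x := Mcounit_Md k x
  coassoc _ _ x := Mcomul_coassoc k x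
  counit_left _ _ x := Mcounit_left k x
  counit_right _ _ x := Mcounit_right k x
  relabel_comul e f x := Mcomul_relabel k e f x
  relabel_counit e f x := Mcounit_relabel k e f x
  one_comul n := Mcomul_one k n
  one_counit n := Mcounit_one k n
  vcomp_comul _ _ _ := Mcomul_join (Mvcomp_join k)
  vcomp_counit _ _ _ x y := Mcounit_join (Mvcomp_join k) x y
  hcomp_comul _ _ _ _ := Mcomul_join (Mhcomp_join k)
  hcomp_counit _ _ _ _ x y := Mcounit_join (Mhcomp_join k) x y

theorem graphCounit_reorder (Γ : OGraph m n) {N' : ℕ} (e : Fin Γ.N ≃ Fin N') :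
    graphCounit k (Γ.reorder e) = Γ.reorderSign e • graphCounit k Γ := by
  have h := freeCounit_rel k (Rel.reorder Γ e)
  rwa [map_sub, map_zsmul, freeCounit_ofGraph, freeCounit_ofGraph, sub_eq_zero] at h

theorem comulQ_reorder' (Γ : OGraph m n) {N' : ℕ} (e : Fin Γ.N ≃ Fin N') :
    comulQ k (Γ.reorder e) = Γ.reorderSign e • comulQ k Γ := by
  rw [comulQ_reorder, ← Int.cast_smul_eq_zsmul k]

end Hopf

end HopfProp

end

theorem theoremt (k : Type*) [CommRing k] :
    -- the characteristic maps of ordered graphs are chain maps sending `[0,1]^d` to the graph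
    (∀ (m n : ℕ) (Γ : HopfProp.OGraph m n),
      (∀ c : HopfProp.CubeChain k Γ.Prods,
        HopfProp.charMap k Γ (HopfProp.cubeD k Γ.Prods c) =
          (HopfProp.M k).d m n (HopfProp.charMap k Γ c)) ∧
      HopfProp.charMap k Γ (HopfProp.topCell k Γ.Prods) = HopfProp.cls k Γ) ∧
    -- the prescribed values are independent of the order of the vertices
    (∀ (m n : ℕ) (Γ : HopfProp.OGraph m n) (N' : ℕ) (e : Fin Γ.N ≃ Fin N'),
      HopfProp.graphComul k (Γ.reorder e) = Γ.reorderSign e • HopfProp.graphComul k Γ ∧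
      HopfProp.graphCounit k (Γ.reorder e) = Γ.reorderSign e • HopfProp.graphCounit k Γ) ∧
    -- there are unique linear maps on `M` with the prescribed values on graphs, and they make `M`
    -- into a Hopf prop
    ∃ (Δ : ∀ m n : ℕ, (HopfProp.M k).hom m n →ₗ[k]
        TensorProduct k ((HopfProp.M k).hom m n) ((HopfProp.M k).hom m n))
      (ε : ∀ m n : ℕ, (HopfProp.M k).hom m n →ₗ[k] k),
      (∀ (m n : ℕ) (Γ : HopfProp.OGraph m n),
        Δ m n (HopfProp.cls k Γ) = HopfProp.graphComul k Γ) ∧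
      (∀ (m n : ℕ) (Γ : HopfProp.OGraph m n),
        ε m n (HopfProp.cls k Γ) = HopfProp.graphCounit k Γ) ∧
      (∀ (m n : ℕ) (Δ' : (HopfProp.M k).hom m n →ₗ[k]
          TensorProduct k ((HopfProp.M k).hom m n) ((HopfProp.M k).hom m n)),
        (∀ Γ : HopfProp.OGraph m n, Δ' (HopfProp.cls k Γ) = HopfProp.graphComul k Γ) →
          Δ' = Δ m n) ∧
      (∀ (m n : ℕ) (ε' : (HopfProp.M k).hom m n →ₗ[k] k),
        (∀ Γ : HopfProp.OGraph m n, ε' (HopfProp.cls k Γ) = HopfProp.graphCounit k Γ) →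
          ε' = ε m n) ∧
      (HopfProp.M k).IsHopfProp Δ ε := by
  -- `charMap`, `graphComul` and the structure maps of `M k` unfold to `charQ`, `comulQ` and the
  -- operations treated above, so the results apply definitionally.
  refine ⟨fun m n Γ => ⟨fun c => (HopfProp.Md_charQ k Γ c).symm, ?_⟩,
    fun m n Γ N' e => ⟨HopfProp.comulQ_reorder' k Γ e, HopfProp.graphCounit_reorder k Γ e⟩,
    HopfProp.Mcomul k, HopfProp.Mcounit k, fun m n Γ => HopfProp.Mcomul_cls k Γ,
    fun m n Γ => HopfProp.Mcounit_cls k Γ, fun m n Δ' h => ?_, fun m n ε' h => ?_,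
    HopfProp.M_isHopfProp k⟩
  · exact (HopfProp.charQ_cell k Γ _).trans (congrArg (HopfProp.cls k) Γ.cubeFace_top)
  -- Classes of graphs span `M`, so the prescribed values determine the map.
  · exact HopfProp.MHom_ext fun Γ => (h Γ).trans (HopfProp.Mcomul_cls k Γ).symm
  · exact HopfProp.MHom_ext fun Γ => (h Γ).trans (HopfProp.Mcounit_cls k Γ).symm
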